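/- **Curves.** For $a,b\in\mathbb Z^2$ put $a\wedge b=a_1b_2-a_2b_1$. An $n$-marked plane rational tropical curve $(\overline\Gamma,\boldsymbol p,h)$ consists of a finite tree $\overline\Gamma$ without bivalent vertices whose complement $\Gamma$ to the univalent vertices is a metric tree with unbounded ends isometric to $[0,\infty)$ and other edges of positive finite length, distinct points $\boldsymbol p=(p_1,\dots,p_n)$ of $\Gamma$, and a map $h:\Gamma\to\mathbb R^2$ that is affine on each edge $E$ with integral differential, nonconstant on each end, and balanced: at each vertex $V$ of $\Gamma$ the images $D(h|_E)(a_V(E))$ of the outgoing unit tangent vectors sum to zero. Its degree is the multiset of the vectors $D(h|_E)(a_V(E))$ over all ends $E$. Curves are considered up to isometries that respect $\boldsymbol p$ and $h$; $\mathrm{Aut}(\overline\Gamma,\boldsymbol p,h)$ is the group of self-isometries of this kind. The combinatorial type is the marked tree together with the differentials of $h$ on the edges. **Data.** Let $\Delta$ be a finite multiset of vectors of $\mathbb Z^2\setminus\{0\}$ which is balanced (its sum is $0$) and nondegenerate (it spans $\mathbb R^2$). Let $\overline n=(n_k)_{k\ge0}$ be a finitely supported sequence of nonnegative integers with $\sum_{k\ge0}(k+1)n_k=|\Delta|-1$,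 and let $n=\sum_{k\ge0}n_k$. Let $\mathcal M_{0,\overline n}(\mathbb R^2,\Delta)$ be the space of $n$-marked plane rational tropical curves of degree $\Delta$ such that $p_i$ is an interior point of an edge for $1\le i\le n_0$, and is a vertex of valency $k+2$ for $\sum_{j<k}n_j<i\le\sum_{j\le k}n_j$, $k\ge1$. The curves of a given combinatorial type form an open cell, parametrized by a translation in $\mathbb R^2$ and the positive lengths of the bounded edges (edges being subdivided by the marked points). Letting some of these lengths vanish (shrinking edges to points) one obtains the closure of the cell. The evaluation map $\mathrm{Ev}$ sends $(\overline\Gamma,\boldsymbol p,h)$ to $h(\boldsymbol p)\in\mathbb R^{2n}$. An open cell is essential if it has dimension $2n$ and its image under $\mathrm{Ev}$ has dimension $2n$; $\overline{\mathcal M}^{\,e}$ is the union of the closures of the essential cells, and $\mathcal M^e_{0,\overline n}(\mathbb R^2,\Delta)$ is its part formed by elements of $\mathcal M_{0,\overline n}(\mathbb R^2,\Delta)$. Let $X^{2n}\subset\mathbb R^{2n}$ be the set of those $\boldsymbol x$ such that each element $(\overline\Gamma,\boldsymbol p,h)\in\overline{\mathcal M}^{\,e}$ with $h(\boldsymbol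 p)=\boldsymbol x$ lies in an open essential cell (no length vanishes), each connected component of $\overline\Gamma\setminus\boldsymbol p$ contains exactly one univalent vertex while its other vertices are trivalent, and $h$ is nonconstant on each edge. **Weights.** Let $y^{1/2}$ be a formal variable and put $$[\alpha]_y^-=\frac{y^{\alpha/2}-y^{-\alpha/2}}{y^{1/2}-y^{-1/2}},\qquad[\alpha]_y^+=\frac{y^{\alpha/2}+y^{-\alpha/2}}{y^{1/2}+y^{-1/2}}\ .$$ For a family $B=(b_1,\dots,b_{m})$, $m\ge3$, of nonzero vectors of $\mathbb Z^2$ with zero sum define inductively $R_y(B)=[\,|b_1\wedge b_2|\,]_y^+$ if $m=3$, and, if $m\ge4$, $$R_y(B)=\sum_{\substack{1\le i<j\le m\\ b_i+b_j\ne0}}[\,|b_i\wedge b_j|\,]_y^+\cdot R_y(B_{ij})\ ,$$ where $B_{ij}$ is obtained from $B$ by replacing its members $b_i$ and $b_j$ with the one vector $b_i+b_j$. For a vertex $V$ of a curve let $\Delta_V$ be the family of vectors $D(h|_E)(a_V(E))$ over all edges $E$ incident to $V$. The refined weight of a marked vertex $V$ is $RM_y(V)=R_y(\Delta_V)$. The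 refined weight of an unmarked trivalent vertex $V$ is $RM_y(V)=[\mu]_y^-$, where $\mu=|b\wedge b'|$ for any two of the three vectors $b,b'$ of $\Delta_V$. The refined weight of a curve is $$RM_y(\overline\Gamma,\boldsymbol p,h)=\frac1{|\mathrm{Aut}(\overline\Gamma,\boldsymbol p,h)|}\prod_{V}RM_y(V)\ ,$$ where $V$ runs over the vertices of $\Gamma$. **Theorem.** For each $\boldsymbol x\in X^{2n}$ there are only finitely many isomorphism classes of curves $(\overline\Gamma,\boldsymbol p,h)\in\mathcal M^e_{0,\overline n}(\mathbb R^2,\Delta)$ with $h(\boldsymbol p)=\boldsymbol x$, and the sum $$RD_y(\Delta,\overline n,\boldsymbol x)=\sum_{\substack{(\overline\Gamma,\boldsymbol p,h)\in\mathcal M^e_{0,\overline n}(\mathbb R^2,\Delta)\\ h(\boldsymbol p)=\boldsymbol x}}RM_y(\overline\Gamma,\boldsymbol p,h)\in\mathbb Q(y^{1/2})$$ does not depend on the choice of $\boldsymbol x\in X^{2n}$. -/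

import Mathlib

namespace PlaneTropical

/-- The standard area form `a ∧ b = a₁ b₂ - a₂ b₁` on the lattice. -/
def wedge (a b : ℤ × ℤ) : ℤ := a.1 * b.2 - a.2 * b.1

/-- The common value of `|a ∧ b|` over two distinct members `a, b` of a multiset that consists of
two vectors, or of three vectors with zero sum (see `area_pair` and `area_triple`). -/
def area (S : Multiset (ℤ × ℤ)) : ℕ :=
  ((S ×ˢ S).map fun p => (wedge p.1 p.2).natAbs).sup

theorem area_pair (a b : ℤ × ℤ) : area {a, b} = (wedge a b).natAbs := by
  have h : wedge b a = -wedge a b := by simp only [wedge]; ring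
  have ha : wedge a a = 0 := by simp only [wedge]; ring
  have hb : wedge b b = 0 := by simp only [wedge]; ring
  simp [area, h, ha, hb]

theorem area_triple (a b c : ℤ × ℤ) (h : a + b + c = 0) :
    area {a, b, c} = (wedge a b).natAbs := by
  have hc : c = -(a + b) := by rw [eq_neg_iff_add_eq_zero, add_comm]; exact h
  have h1 : wedge a a = 0 := by simp only [wedge]; ring
  have h2 : wedge b b = 0 := by simp only [wedge]; ring
  have h3 : wedge b a = -wedge a b := by simp only [wedge]; ring
  have h4 : wedge a (c) = -wedge a b := by subst hc; simp [wedge]; ring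
  have h5 : wedge b (c) = wedge a b := by subst hc; simp [wedge]; ring
  have h6 : wedge (c) a = wedge a b := by subst hc; simp [wedge]; ring
  have h7 : wedge (c) b = -wedge a b := by subst hc; simp [wedge]; ring
  have h8 : wedge (c) (c) = 0 := by subst hc; simp [wedge]; ring
  simp [area, h1, h2, h3, h4, h5, h6, h7, h8]

/-! ### Refined weights of vertices

Refined weights are rational functions in `y^{1/2}`; the indeterminate `RatFunc.X` stands for the
formal square root `y^{1/2}`. -/

/-- The formal variable `y^{1/2}`. -/
noncomputable def sqrtY : RatFunc ℚ := RatFunc.X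

/-- `[α]_y^- = (y^{α/2} - y^{-α/2}) / (y^{1/2} - y^{-1/2})`. -/
noncomputable def bracketMinus (α : ℕ) : RatFunc ℚ :=
  (sqrtY ^ α - (sqrtY ^ α)⁻¹) / (sqrtY - sqrtY⁻¹)

/-- `[α]_y^+ = (y^{α/2} + y^{-α/2}) / (y^{1/2} + y^{-1/2})`. -/
noncomputable def bracketPlus (α : ℕ) : RatFunc ℚ :=
  (sqrtY ^ α + (sqrtY ^ α)⁻¹) / (sqrtY + sqrtY⁻¹)

/-- The refined weight of a marked point of valency `k + 2` whose outgoing vectors form the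
balanced multiset `S`.  A marked point in the interior of an edge (`k = 0`) has weight `1`; a
marked trivalent vertex has weight `[μ]_y^+`.  For valency `≥ 4` one sums over the splittings of
the vertex into a marked trivalent vertex `W` and a marked vertex `V'` of valency one less, joined
by an edge that is not contracted.  Such a splitting is the choice of the two edges that go to
`W`: `Multiset.powersetCard 2` lists the two-element submultisets `P` of `S` with multiplicity,
that is, it counts equal vectors at different edges as different.  Then `W` has the outgoing
vectors `P` and `-P.sum`, and `V'` has the rest of `S` and `P.sum`; the joining edge is
contracted exactly if `P.sum = 0`. -/
noncomputable def markedWeight : ℕ → Multiset (ℤ × ℤ) → RatFunc ℚ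
  | 0, _ => 1
  | 1, S => bracketPlus (area S)
  | k + 2, S =>
    (((S.powersetCard 2).filter fun P => P.sum ≠ 0).map fun P =>
      bracketPlus (area P) * markedWeight (k + 1) (P.sum ::ₘ (S - P))).sum

/-! ### Combinatorial types of marked rational tropical curves -/

/-- A finite tree with `numEnds` unbounded ends and `n` distinct marked vertices.  A marked point
in the interior of an edge is regarded as a (bivalent) marked vertex subdividing that edge. -/
structure MarkedTree (n : ℕ) where
  /-- number of finite vertices (vertices of the curve and marked points) -/
  numVerts : ℕ
  /-- number of ends -/
  numEnds : ℕ
  /-- the graph formed by the bounded edges -/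
  graph : SimpleGraph (Fin numVerts)
  isTree : graph.IsTree
  /-- the finite vertex to which an end is attached -/
  foot : Fin numEnds → Fin numVerts
  /-- the marked points -/
  mark : Fin n → Fin numVerts
  mark_injective : Function.Injective mark

namespace MarkedTree

variable {n : ℕ} (T : MarkedTree n)

/-- The valency of a finite vertex: bounded edges and ends are counted. -/
noncomputable def valency (v : Fin T.numVerts) : ℕ :=
  (T.graph.neighborSet v).ncard + (Finset.univ.filter fun e => T.foot e = v).card

/-- The vertex `v` is a marked point. -/
def IsMarked (v : Fin T.numVerts) : Prop := ∃ i, T.mark i = v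

/-- The compactified tree: every end gets a univalent vertex at infinity. -/
def compactGraph : SimpleGraph (Fin T.numVerts ⊕ Fin T.numEnds) :=
  SimpleGraph.fromRel fun a b =>
    match a, b with
    | .inl v, .inl w => T.graph.Adj v w
    | .inl v, .inr e => T.foot e = v
    | _, _ => False

/-- The vertices of the compactified tree that are not marked points. -/
def unmarkedVerts : Set (Fin T.numVerts ⊕ Fin T.numEnds) :=
  {a | ∀ i, a ≠ .inl (T.mark i)}

/-- The complement of the marked points in the compactified tree is regular: every connected
component contains exactly one univalent vertex, and its other vertices are trivalent.
A component of the complement either contains a vertex, or it is the interior of a bounded edge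
that joins two marked points, in which case it has no univalent vertex. -/
def IsRegular : Prop :=
  (∀ i j, ¬ T.graph.Adj (T.mark i) (T.mark j)) ∧
  (∀ c : (T.compactGraph.induce T.unmarkedVerts).ConnectedComponent,
    ∃! e : Fin T.numEnds,
      (T.compactGraph.induce T.unmarkedVerts).connectedComponentMk
        ⟨.inr e, fun _ => Sum.inr_ne_inl⟩ = c) ∧
  (∀ v, ¬ T.IsMarked v → T.valency v = 3)

/-- Marked points are of the kind prescribed by `(n_k)`: with the marked points numbered from `0`,
the points number `i` with `n_0 + ... + n_{k-1} ≤ i < n_0 + ... + n_k` have valency `k + 2`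
(for `k = 0` they are interior points of edges). -/
def HasProfile (N : ℕ →₀ ℕ) : Prop :=
  ∀ (i : Fin n) (k : ℕ), ∑ j ∈ Finset.range k, N j ≤ (i : ℕ) →
    (i : ℕ) < ∑ j ∈ Finset.range (k + 1), N j → T.valency (T.mark i) = k + 2

end MarkedTree

/-- A combinatorial type of `n`-marked plane rational tropical curves: a marked tree such that no
vertex is univalent and only marked points are bivalent, together with the differentials of the
map to the plane on all edges, subject to the balancing condition. -/
structure CurveType (n : ℕ) extends MarkedTree n where
  two_le_valency : ∀ v, 2 ≤ toMarkedTree.valency v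
  three_le_valency : ∀ v, ¬ toMarkedTree.IsMarked v → 3 ≤ toMarkedTree.valency v
  /-- the image of the unit tangent vector at `v` to the edge `vw`; it may vanish
  (contracted edge), and it is set to `0` if `vw` is not an edge -/
  slope : Fin numVerts → Fin numVerts → ℤ × ℤ
  slope_symm : ∀ v w, slope w v = -slope v w
  slope_of_not_adj : ∀ v w, ¬ graph.Adj v w → slope v w = 0
  /-- the image of the unit tangent vector to an end at its finite vertex -/
  dir : Fin numEnds → ℤ × ℤ
  dir_ne_zero : ∀ e, dir e ≠ 0
  balanced : ∀ v, (∑ w, slope v w) + ∑ e with foot e = v, dir e = 0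

namespace CurveType

variable {n : ℕ} (T : CurveType n)

/-- The degree: the multiset of directions of the ends. -/
def degree : Multiset (ℤ × ℤ) := Finset.univ.val.map T.dir

open Classical in
/-- The multiset of the outgoing vectors of all edges and ends at a vertex. -/
noncomputable def star (v : Fin T.numVerts) : Multiset (ℤ × ℤ) :=
  (Finset.univ.filter fun w => T.graph.Adj v w).val.map (T.slope v) +
    (Finset.univ.filter fun e => T.foot e = v).val.map T.dir

open Classical in
/-- The refined weight of a vertex: `[μ]_y^-` for an unmarked trivalent vertex, and `markedWeight`
for a marked one. -/
noncomputable def vertexWeight (v : Fin T.numVerts) : RatFunc ℚ :=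
  if T.IsMarked v then markedWeight (T.valency v - 2) (T.star v)
  else bracketMinus (area (T.star v))

/-- The metric data of a curve: the images of the vertices, and the lengths of bounded edges
(as a function of pairs of vertices). -/
abbrev Params := (Fin T.numVerts → ℝ × ℝ) × (Fin T.numVerts → Fin T.numVerts → ℝ)

/-- The closed cell of a combinatorial type: edge lengths are nonnegative, and the map is affine
with the prescribed differential on each bounded edge.  A zero length means that the
edge has been shrunk to a point. -/
def closedCell : Set T.Params :=
  {q | (∀ v w, q.2 w v = q.2 v w) ∧ (∀ v w, ¬ T.graph.Adj v w → q.2 v w = 0) ∧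
    (∀ v w, T.graph.Adj v w → 0 ≤ q.2 v w) ∧
    (∀ v w, T.graph.Adj v w →
      q.1 w = q.1 v + q.2 v w • (((T.slope v w).1 : ℝ), ((T.slope v w).2 : ℝ)))}

/-- The open cell of a combinatorial type: the actual curves, with positive edge lengths. -/
def openCell : Set T.Params :=
  {q | q ∈ T.closedCell ∧ ∀ v w, T.graph.Adj v w → 0 < q.2 v w}

/-- Evaluation at the marked points. -/
def ev (q : T.Params) : Fin n → ℝ × ℝ := fun i => q.1 (T.mark i)

/-- The dimension of the open cell: two translations and the lengths of the bounded edges. -/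
noncomputable def cellDim : ℕ := 2 + T.graph.edgeSet.ncard

/-- Enumeratively essential combinatorial types of degree `D` with marked points as prescribed by
`N`: the cell has dimension `2n`, and its image under evaluation has dimension `2n`. -/
def IsEssential (D : Multiset (ℤ × ℤ)) (N : ℕ →₀ ℕ) : Prop :=
  T.degree = D ∧ T.HasProfile N ∧ T.cellDim = 2 * n ∧
    Module.finrank ℝ (vectorSpan ℝ (T.ev '' T.openCell)) = 2 * n

/-- The map to the plane is nonconstant on each edge. -/
def Immersed : Prop := ∀ v w, T.graph.Adj v w → T.slope v w ≠ 0

end CurveType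

/-- An `n`-marked plane rational tropical curve. -/
structure PlaneCurve (n : ℕ) extends CurveType n where
  params : toCurveType.Params
  params_mem : params ∈ toCurveType.openCell

namespace PlaneCurve

variable {n : ℕ}

/-- Isomorphisms of marked plane tropical curves: isometries of the metric trees that respect the
marked points and the maps to the plane. -/
structure Iso (C C' : PlaneCurve n) where
  onVerts : Fin C.numVerts ≃ Fin C'.numVerts
  onEnds : Fin C.numEnds ≃ Fin C'.numEnds
  adj_iff : ∀ v w, C'.graph.Adj (onVerts v) (onVerts w) ↔ C.graph.Adj v w
  map_foot : ∀ e, C'.foot (onEnds e) = onVerts (C.foot e)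
  map_mark : ∀ i, C'.mark i = onVerts (C.mark i)
  map_len : ∀ v w, C'.params.2 (onVerts v) (onVerts w) = C.params.2 v w
  map_pos : ∀ v, C'.params.1 (onVerts v) = C.params.1 v
  map_slope : ∀ v w, C'.slope (onVerts v) (onVerts w) = C.slope v w
  map_dir : ∀ e, C'.dir (onEnds e) = C.dir e

namespace Iso

/-- The identity isomorphism. -/
def refl (C : PlaneCurve n) : Iso C C :=
  ⟨Equiv.refl _, Equiv.refl _, by simp, by simp, by simp, by simp, by simp, by simp, by simp⟩

/-- The inverse isomorphism. -/
def symm {C C' : PlaneCurve n} (f : Iso C C') : Iso C' C where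
  onVerts := f.onVerts.symm
  onEnds := f.onEnds.symm
  adj_iff v w := by simpa using (f.adj_iff (f.onVerts.symm v) (f.onVerts.symm w)).symm
  map_foot e := by
    rw [Equiv.eq_symm_apply]; simpa using (f.map_foot (f.onEnds.symm e)).symm
  map_mark i := by rw [Equiv.eq_symm_apply]; exact (f.map_mark i).symm
  map_len v w := by simpa using (f.map_len (f.onVerts.symm v) (f.onVerts.symm w)).symm
  map_pos v := by simpa using (f.map_pos (f.onVerts.symm v)).symm
  map_slope v w := by simpa using (f.map_slope (f.onVerts.symm v) (f.onVerts.symm w)).symm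
  map_dir e := by simpa using (f.map_dir (f.onEnds.symm e)).symm

/-- The composition of isomorphisms. -/
def trans {C C' C'' : PlaneCurve n} (f : Iso C C') (g : Iso C' C'') : Iso C C'' where
  onVerts := f.onVerts.trans g.onVerts
  onEnds := f.onEnds.trans g.onEnds
  adj_iff v w := by simp [g.adj_iff, f.adj_iff]
  map_foot e := by simp [g.map_foot, f.map_foot]
  map_mark i := by simp [g.map_mark, f.map_mark]
  map_len v w := by simp [g.map_len, f.map_len]
  map_pos v := by simp [g.map_pos, f.map_pos]
  map_slope v w := by simp [g.map_slope, f.map_slope]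
  map_dir e := by simp [g.map_dir, f.map_dir]

end Iso

/-- The refined weight of a plane curve: the product of the weights of its vertices, divided by the
number of its automorphisms. -/
noncomputable def weight (C : PlaneCurve n) : RatFunc ℚ :=
  (Nat.card (Iso C C) : RatFunc ℚ)⁻¹ * ∏ v, C.vertexWeight v

/-- Two plane curves are isomorphic. -/
def isoSetoid (n : ℕ) : Setoid (PlaneCurve n) where
  r C C' := Nonempty (Iso C C')
  iseqv := ⟨fun C => ⟨Iso.refl C⟩, fun ⟨f⟩ => ⟨f.symm⟩, fun ⟨f⟩ ⟨g⟩ => ⟨f.trans g⟩⟩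

theorem Iso.star_eq {C C' : PlaneCurve n} (f : Iso C C') (v : Fin C.numVerts) :
    C'.star (f.onVerts v) = C.star v := by
  classical
  unfold CurveType.star
  congr 1
  · have : (Finset.univ.filter fun w => C'.graph.Adj (f.onVerts v) w)
        = (Finset.univ.filter fun w => C.graph.Adj v w).map f.onVerts.toEmbedding := by
      ext w
      obtain ⟨w, rfl⟩ := f.onVerts.surjective w
      simp [f.adj_iff]
    rw [this, Finset.map_val, Multiset.map_map]
    exact Multiset.map_congr rfl fun w _ => f.map_slope v w
  · have : (Finset.univ.filter fun e => C'.foot e = f.onVerts v)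
        = (Finset.univ.filter fun e => C.foot e = v).map f.onEnds.toEmbedding := by
      ext e
      obtain ⟨e, rfl⟩ := f.onEnds.surjective e
      simp [f.map_foot]
    rw [this, Finset.map_val, Multiset.map_map]
    exact Multiset.map_congr rfl fun e _ => f.map_dir e

theorem card_star (T : CurveType n) (v : Fin T.numVerts) :
    Multiset.card (T.star v) = T.valency v := by
  classical
  have : T.graph.neighborSet v
      = ((Finset.univ.filter fun w => T.graph.Adj v w : Finset _) : Set (Fin T.numVerts)) := by
    ext w; simp
  rw [MarkedTree.valency, this, Set.ncard_coe_finset]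
  simp only [CurveType.star, Multiset.card_add, Multiset.card_map, Finset.card_val]

theorem weight_eq_of_iso {C C' : PlaneCurve n} (f : Iso C C') : C.weight = C'.weight := by
  have hcard : Nat.card (Iso C C) = Nat.card (Iso C' C') := by
    refine Nat.card_congr ⟨fun g => (f.symm.trans g).trans f, fun g => (f.trans g).trans f.symm,
      fun g => ?_, fun g => ?_⟩ <;>
    · cases g
      simp only [Iso.trans, Iso.symm, Iso.mk.injEq]
      constructor <;> ext <;> simp
  have hprod : ∏ v, C.vertexWeight v = ∏ v, C'.vertexWeight v := by
    refine Fintype.prod_equiv f.onVerts _ _ fun v => ?_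
    have hm : C'.IsMarked (f.onVerts v) ↔ C.IsMarked v := by
      simp [MarkedTree.IsMarked, f.map_mark]
    simp only [CurveType.vertexWeight, ← card_star, f.star_eq]
    by_cases hv : C.IsMarked v
    · rw [if_pos hv, if_pos (hm.2 hv)]
    · rw [if_neg hv, if_neg (mt hm.1 hv)]
  rw [weight, weight, hcard, hprod]

/-- The refined weight of an isomorphism class of plane curves. -/
noncomputable def classWeight (c : Quotient (isoSetoid n)) : RatFunc ℚ :=
  Quotient.lift (s := isoSetoid n) weight (fun _ _ h => h.elim weight_eq_of_iso) c

end PlaneCurve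

/-- The (isomorphism classes of) curves of degree `D` with marked points as prescribed by `N` that
belong to enumeratively essential cells and whose marked points are mapped to `x`. -/
def curvesThrough {n : ℕ} (D : Multiset (ℤ × ℤ)) (N : ℕ →₀ ℕ) (x : Fin n → ℝ × ℝ) :
    Set (Quotient (PlaneCurve.isoSetoid n)) :=
  {c | ∃ C : PlaneCurve n, C.IsEssential D N ∧ C.ev C.params = x ∧ Quotient.mk _ C = c}

/-- The refined count of the curves through `x`. -/
noncomputable def refinedCount {n : ℕ} (D : Multiset (ℤ × ℤ)) (N : ℕ →₀ ℕ) (x : Fin n → ℝ × ℝ) :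
    RatFunc ℚ :=
  ∑ᶠ c ∈ curvesThrough D N x, PlaneCurve.classWeight c

/-- The set `X^{2n}` of generic configurations: every element over `x` of the closure of the union
of the essential cells is an actual curve whose marked points are of the prescribed kind (no
edge is shrunk to a point: shrinking makes a marked point coincide with another one or raises its
valency, or creates an unmarked vertex of valency at least `4`), the complement of its marked
points is regular, and it is nonconstant on every edge. -/
def genericConfigurations (n : ℕ) (D : Multiset (ℤ × ℤ)) (N : ℕ →₀ ℕ) : Set (Fin n → ℝ × ℝ) :=
  {x | ∀ T : CurveType n, T.IsEssential D N → ∀ q ∈ T.closedCell, T.ev q = x →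
    q ∈ T.openCell ∧ T.IsRegular ∧ T.Immersed}

/-- A multiset of lattice vectors spans the real plane. -/
def Nondegenerate (D : Multiset (ℤ × ℤ)) : Prop :=
  Submodule.span ℝ {u : ℝ × ℝ | ∃ b ∈ D, u = ((b.1 : ℝ), (b.2 : ℝ))} = ⊤

end PlaneTropical

namespace PlaneTropical

/-! ### Identities between the weights -/

/-! The count is converted into a weighted count of cones. Name the vertices and ends of the curves
by `Fin V` and `Fin E`. For an essential type, evaluation at the marked points identifies the space
of plane maps with the given edge directions with the whole space of point configurations
(`Shape.good_of_isEssential`). The edge lengths thus become linearly independent linear forms on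
that space (`Shape.Good.exists_length_eq`), and the configurations met by the type form the open
cone on which these forms are positive. A generic configuration lies on the boundary of no such
cone. Joining two configurations by a line that meets the walls one facet of each cone at a time, it
suffices that at each wall the weights, taken with the signs of the crossing, sum to zero
(`count_eq_of_walls`).

On a wall a single edge `ab` shrinks. The types around it arise by redistributing the half-edges and
ends attached to `ab` (its branches) between `a` and `b` (`Shape.reattach`). The dimension count
makes unmarked vertices trivalent (`Shape.Valid.trivalent`), and two marked points are never
adjacent, so one endpoint, say `b`, is unmarked and receives exactly two branches `i, j`. All these
types share the wall, so their forms for the length of `ab` are proportional to each other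
(`Shape.Good.length_reattach`). Translating a branch along its own direction does not affect the
wall, so branch `i` acts on the length of `ab` through a multiple `d i` of the area form with its
vector `b i`; the factor of proportionality for the pair is then `(d i - d j) * (b i ∧ b j)`
(`Shape.Good.length_slide_pair`). Its sign turns the weight of `b` into the antisymmetric bracket of
`b i ∧ b j`, with a remaining sign of `d i - d j`.

If `a` is marked, it decouples the branches and at most one `d i` is nonzero
(`Shape.Good.branchForm_eq_zero_or`). Only the pairs containing that branch contribute, and they
cancel by `sum_oddBracket_markedWeight`, which follows from the recursive definition of the marked
weight by induction. If `a` is unmarked, four branches meet; invariance under global translation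
fixes the differences of the `d i` up to a common factor, and the cancellation is the three-term
identity `oddBracket_oddBracket_cyclic` (`sum_pairs_unmarked`).

Finally, the positions of the marked points determine the metric of a curve of essential type, so
isomorphisms are just renamings. By orbit counting, the labelled count is `V! * E!` times the
refined count, the automorphism groups accounting for the stabilizers
(`Shape.count_eq_mul_refinedCount`). -/

theorem wedge_add_left (a b c : ℤ × ℤ) : wedge (a + b) c = wedge a c + wedge b c := by
  simp only [wedge, Prod.fst_add, Prod.snd_add]; ring

theorem wedge_add_right (a b c : ℤ × ℤ) : wedge a (b + c) = wedge a b + wedge a c := by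
  simp only [wedge, Prod.fst_add, Prod.snd_add]; ring

theorem wedge_neg_right (a b : ℤ × ℤ) : wedge a (-b) = -wedge a b := by
  simp only [wedge, Prod.fst_neg, Prod.snd_neg]; ring

theorem wedge_neg_left (a b : ℤ × ℤ) : wedge (-a) b = -wedge a b := by
  simp only [wedge, Prod.fst_neg, Prod.snd_neg]; ring

theorem wedge_self (a : ℤ × ℤ) : wedge a a = 0 := by
  simp only [wedge]; ring

theorem wedge_swap (a b : ℤ × ℤ) : wedge a b = -wedge b a := by
  simp only [wedge]; ring

theorem sqrtY_ne_zero : sqrtY ≠ 0 := RatFunc.X_ne_zero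

/-- The antisymmetric extension of `[α]_y^-` to the integers. -/
noncomputable def oddBracket (z : ℤ) : RatFunc ℚ :=
  (sqrtY ^ z - (sqrtY ^ z)⁻¹) / (sqrtY - sqrtY⁻¹)

/-- The symmetric extension of `[α]_y^+` to the integers. -/
noncomputable def evenBracket (z : ℤ) : RatFunc ℚ :=
  (sqrtY ^ z + (sqrtY ^ z)⁻¹) / (sqrtY + sqrtY⁻¹)

theorem oddBracket_neg (z : ℤ) : oddBracket (-z) = -oddBracket z := by
  simp only [oddBracket, zpow_neg, inv_inv]; ring

theorem evenBracket_neg (z : ℤ) : evenBracket (-z) = evenBracket z := by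
  simp only [evenBracket, zpow_neg, inv_inv]; ring

theorem oddBracket_zero : oddBracket 0 = 0 := by simp [oddBracket]

theorem bracketPlus_natAbs (z : ℤ) : bracketPlus z.natAbs = evenBracket z := by
  obtain ⟨m, rfl | rfl⟩ := z.eq_nat_or_neg
  · simp [bracketPlus, evenBracket]
  · rw [evenBracket_neg]
    simp [bracketPlus, evenBracket]

theorem sign_mul_bracketMinus_natAbs (z : ℤ) :
    ((SignType.sign z : SignType) : RatFunc ℚ) * bracketMinus z.natAbs = oddBracket z := by
  rcases lt_trichotomy z 0 with h | h | h
  · obtain ⟨m, rfl⟩ : ∃ m : ℕ, z = -m := ⟨z.natAbs, by omega⟩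
    rw [sign_neg h, oddBracket_neg]
    simp [bracketMinus, oddBracket]
  · subst h; simp [oddBracket_zero]
  · obtain ⟨m, rfl⟩ : ∃ m : ℕ, z = m := ⟨z.natAbs, by omega⟩
    rw [sign_pos h]
    simp [bracketMinus, oddBracket]

/-- After multiplying out, each monomial `y^{(±p±q±r)/2}` that occurs does so twice, with opposite
signs. This governs the walls at marked vertices. -/
theorem evenBracket_oddBracket_cyclic (p q r : ℤ) :
    oddBracket (p - r) * evenBracket q + oddBracket (q - p) * evenBracket r +
      oddBracket (r - q) * evenBracket p = 0 := by
  have h0 := sqrtY_ne_zero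
  simp only [oddBracket, evenBracket, zpow_sub₀ h0]
  have hp : sqrtY ^ p ≠ 0 := zpow_ne_zero _ h0
  have hq : sqrtY ^ q ≠ 0 := zpow_ne_zero _ h0
  have hr : sqrtY ^ r ≠ 0 := zpow_ne_zero _ h0
  generalize sqrtY ^ p = P at *
  generalize sqrtY ^ q = Q at *
  generalize sqrtY ^ r = R at *
  rw [div_mul_div_comm, div_mul_div_comm, div_mul_div_comm, ← add_div, ← add_div]
  convert zero_div _
  field_simp
  ring

/-- The monomials again cancel in pairs. This governs the walls at an unmarked four-valent vertex.
-/
theorem oddBracket_oddBracket_cyclic (p q r : ℤ) :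
    oddBracket p * oddBracket (q - r) + oddBracket q * oddBracket (r - p) +
      oddBracket r * oddBracket (p - q) = 0 := by
  have h0 := sqrtY_ne_zero
  simp only [oddBracket, zpow_sub₀ h0]
  have hp : sqrtY ^ p ≠ 0 := zpow_ne_zero _ h0
  have hq : sqrtY ^ q ≠ 0 := zpow_ne_zero _ h0
  have hr : sqrtY ^ r ≠ 0 := zpow_ne_zero _ h0
  generalize sqrtY ^ p = P at *
  generalize sqrtY ^ q = Q at *
  generalize sqrtY ^ r = R at *
  rw [div_mul_div_comm, div_mul_div_comm, div_mul_div_comm, ← add_div, ← add_div]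
  convert zero_div _
  field_simp
  ring

/-- The identity behind the splitting of a marked vertex, for three vectors `a, b, c`. -/
theorem oddBracket_wedge_three (a b c : ℤ × ℤ) :
    oddBracket (wedge a b) * evenBracket (wedge (a + b) c) +
      oddBracket (wedge a c) * evenBracket (wedge (a + c) b) =
      oddBracket (wedge a (b + c)) * evenBracket (wedge b c) := by
  have e : evenBracket (wedge (a + c) b) = evenBracket (wedge b c - wedge a b) := by
    rw [← evenBracket_neg]; congr 1; simp only [wedge_add_left]; rw [wedge_swap b c]; ring
  have h := evenBracket_oddBracket_cyclic (wedge (a + b) c) (wedge b c - wedge a b) (wedge b c)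
  rw [e]
  have e1 : wedge (a + b) c - wedge b c = wedge a c := by rw [wedge_add_left]; ring
  have e2 : wedge b c - wedge a b - wedge (a + b) c = -wedge a (b + c) := by
    rw [wedge_add_left, wedge_add_right]; ring
  have e3 : wedge b c - (wedge b c - wedge a b) = wedge a b := by ring
  rw [e1, e2, e3, oddBracket_neg] at h
  linear_combination h

/-! ### Sums over two-element sets -/

section Pairs

variable {ι R : Type*} [DecidableEq ι]

/-- Each ordered pair of distinct indices lies in exactly one two-element set. -/
theorem sum_powersetCard_two [AddCommMonoid R] (I : Finset ι) (Y : ι → ι → R) :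
    ∑ P ∈ I.powersetCard 2, ∑ i ∈ P, ∑ j ∈ P.erase i, Y i j =
      ∑ i ∈ I, ∑ j ∈ I.erase i, Y i j := by
  rw [Finset.sum_comm' (t' := I) (s' := fun i => (I.powersetCard 2).filter (i ∈ ·))]
  · refine Finset.sum_congr rfl fun i hi => ?_
    rw [Finset.sum_comm' (t' := I.erase i) (s' := fun j => {{i, j}})]
    · simp
    · intro P j
      simp only [Finset.mem_filter, Finset.mem_powersetCard, Finset.mem_erase,
        Finset.mem_singleton]
      constructor
      · rintro ⟨⟨⟨hP, hc⟩, hiP⟩, hji, hj⟩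
        refine ⟨?_, hji, hP hj⟩
        symm
        refine Finset.eq_of_subset_of_card_le ?_ ?_
        · intro k hk
          simp only [Finset.mem_insert, Finset.mem_singleton] at hk
          rcases hk with rfl | rfl <;> assumption
        · rw [hc, Finset.card_pair (Ne.symm hji)]
      · rintro ⟨rfl, hji, hj⟩
        refine ⟨⟨⟨?_, Finset.card_pair (Ne.symm hji)⟩, by simp⟩, hji, by simp⟩
        intro k hk
        simp only [Finset.mem_insert, Finset.mem_singleton] at hk
        rcases hk with rfl | rfl <;> assumption
  · intro P i
    simp only [Finset.mem_filter, Finset.mem_powersetCard]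
    constructor
    · rintro ⟨⟨hP, hc⟩, hi⟩; exact ⟨⟨⟨hP, hc⟩, hi⟩, hP hi⟩
    · rintro ⟨⟨⟨hP, hc⟩, hi⟩, -⟩; exact ⟨⟨hP, hc⟩, hi⟩

end Pairs

/-! ### The recursion for marked weights and its wall-crossing identity -/

theorem map_val_eq_sdiff_add {ι α : Type*} [DecidableEq ι] {I P : Finset ι} (h : P ⊆ I) (b : ι → α) :
    I.val.map b = (I \ P).val.map b + P.val.map b := by
  rw [← Multiset.map_add, Finset.sdiff_val, tsub_add_cancel_of_le (Finset.val_le_iff.2 h)]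

/-- The merged pair either avoids the distinguished vector `c` or contains it. The two kinds play
different roles in the induction below, where `c` is the vector that varies. -/
theorem markedWeight_cons_map (k : ℕ) {ι : Type*} [DecidableEq ι] (c : ℤ × ℤ) (J : Finset ι)
    (b : ι → ℤ × ℤ) :
    markedWeight (k + 2) (c ::ₘ J.val.map b) = (∑ P ∈ J.powersetCard 2,
      if ∑ i ∈ P, b i ≠ 0 then bracketPlus (area (P.val.map b)) *
        markedWeight (k + 1) ((∑ i ∈ P, b i) ::ₘ c ::ₘ (J \ P).val.map b) else 0) +
      ∑ j ∈ J, if c + b j ≠ 0 then evenBracket (wedge c (b j)) *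
        markedWeight (k + 1) ((c + b j) ::ₘ (J.erase j).val.map b) else 0 := by
  rw [markedWeight, Multiset.powersetCard_cons, Multiset.filter_add, Multiset.map_add,
    Multiset.sum_add]
  congr 1
  · rw [Multiset.powersetCard_map, ← Finset.map_val_val_powersetCard, Multiset.filter_map,
      Multiset.map_map, Multiset.filter_map, Multiset.map_map, ← Finset.sum_filter, Finset.sum,
      Finset.filter_val]
    congr 1
    refine Multiset.map_congr rfl fun P hP => ?_
    rw [Multiset.mem_filter, Finset.mem_val, Finset.mem_powersetCard] at hP
    simp only [Function.comp_apply]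
    rw [map_val_eq_sdiff_add hP.1.1 b, ← Multiset.cons_add, add_tsub_cancel_right]
    rfl
  · rw [Multiset.powersetCard_one, Multiset.map_map, Multiset.map_map, Multiset.filter_map,
      Multiset.map_map, ← Finset.sum_filter, Finset.sum, Finset.filter_val]
    congr 1
    refine Multiset.map_congr (Multiset.filter_congr fun j _ => by simp) fun j hj => ?_
    rw [Multiset.mem_filter] at hj
    simp only [Function.comp_apply]
    have hj' : J.val.map b = b j ::ₘ (J.erase j).val.map b := by
      rw [← Multiset.map_cons, Finset.erase_val, Multiset.cons_erase hj.1]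
    have : (c ::ₘ J.val.map b) - (c ::ₘ {b j}) = (J.erase j).val.map b := by
      rw [hj']; simp
    rw [this]
    have h2 : area (c ::ₘ {b j}) = (wedge c (b j)).natAbs := area_pair c (b j)
    rw [h2, bracketPlus_natAbs]
    simp

/-- The wall-crossing identity at a marked vertex. -/
theorem sum_oddBracket_markedWeight (k : ℕ) (b₀ : ℤ × ℤ) {ι : Type} [DecidableEq ι] (I : Finset ι)
    (b : ι → ℤ × ℤ) (hI : I.card = k + 2) (hsum : b₀ + ∑ i ∈ I, b i = 0) :
    ∑ i ∈ I, oddBracket (wedge b₀ (b i)) *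
      markedWeight k ((b₀ + b i) ::ₘ (I.erase i).val.map b) = 0 := by
  induction k using Nat.strong_induction_on generalizing ι with
  | _ k ih =>
  match k, hI, ih with
  | 0, hI, _ =>
    -- With weight `1` at the marked point, only `b₀ ∧ b j = -(b₀ ∧ b i)` is needed.
    obtain ⟨i, j, hij, rfl⟩ := Finset.card_eq_two.1 hI
    rw [Finset.sum_pair hij] at hsum ⊢
    have : b j = -b₀ - b i := by
      rw [eq_sub_iff_add_eq, eq_neg_iff_add_eq_zero, ← hsum]; abel
    simp [markedWeight, this, sub_eq_add_neg, wedge_add_right, wedge_neg_right, wedge_self,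
      oddBracket_neg]
  | 1, hI, _ =>
    obtain ⟨i, j, l, hij, hil, hjl, rfl⟩ := Finset.card_eq_three.1 hI
    have key : ∀ i j l : ι, i ≠ j → i ≠ l → j ≠ l → b₀ + (b i + (b j + b l)) = 0 →
        markedWeight 1 ((b₀ + b i) ::ₘ (({i, j, l} : Finset ι).erase i).val.map b) =
          evenBracket (wedge (b j) (b l)) := by
      intro i j l hij hil hjl h
      have e : ({i, j, l} : Finset ι).erase i = {j, l} := by
        rw [Finset.erase_insert]; simp [hij, hil]
      have e2 : (b₀ + b i) ::ₘ ({j, l} : Finset ι).val.map b = {b j, b l, b₀ + b i} := by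
        rw [Finset.insert_val_of_notMem (by simpa using hjl)]
        simp only [Finset.singleton_val, Multiset.map_cons, Multiset.map_singleton,
          Multiset.insert_eq_cons]
        rw [Multiset.cons_swap, ← Multiset.singleton_add (b l), ← Multiset.singleton_add (b₀ + b i),
          add_comm]
      rw [e, e2, markedWeight, area_triple _ _ _ (by rw [← h]; abel), bracketPlus_natAbs]
    rw [Finset.sum_insert (by simp [hij, hil]), Finset.sum_pair hjl] at hsum ⊢
    rw [key i j l hij hil hjl hsum]
    rw [show ({i, j, l} : Finset ι) = {j, i, l} from Finset.insert_comm _ _ _,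
      key j i l hij.symm hjl hil (by rw [← hsum]; abel)]
    rw [show ({j, i, l} : Finset ι) = {l, j, i} by ext; simp; tauto,
      key l j i hjl.symm hil.symm hij.symm (by rw [← hsum]; abel)]
    have h0 : b₀ = -(b i) + (-(b j) + -(b l)) := by
      rw [← neg_add, ← neg_add, eq_neg_iff_add_eq_zero, hsum]
    have h := evenBracket_oddBracket_cyclic (wedge (b i) (b j)) (wedge (b j) (b l))
      (wedge (b l) (b i))
    have e1 : wedge b₀ (b i) = wedge (b i) (b j) - wedge (b l) (b i) := by
      rw [h0]; simp only [wedge_add_left, wedge_neg_left, wedge_self]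
      rw [wedge_swap (b j) (b i)]; ring
    have e2 : wedge b₀ (b j) = wedge (b j) (b l) - wedge (b i) (b j) := by
      rw [h0]; simp only [wedge_add_left, wedge_neg_left, wedge_self]
      rw [wedge_swap (b l) (b j)]; ring
    have e3 : wedge b₀ (b l) = wedge (b l) (b i) - wedge (b j) (b l) := by
      rw [h0]; simp only [wedge_add_left, wedge_neg_left, wedge_self]
      rw [wedge_swap (b i) (b l)]; ring
    rw [wedge_swap (b i) (b l), evenBracket_neg, wedge_swap (b j) (b i), evenBracket_neg, e1, e2, e3]
    linear_combination h
  | k + 2, hI, ih =>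
    -- Expand every weight by the pair merged first and exchange the sums. For a fixed pair `P = {i,
    -- j}` two contributions remain: `P` is merged while `b₀` joins some other vector, or `b₀` joins
    -- one member of `P` and the result is then merged with the other member.
    simp only [markedWeight_cons_map, mul_add, Finset.sum_add_distrib]
    simp only [Finset.mul_sum]
    rw [← sum_powersetCard_two, Finset.sum_comm' (t' := I.powersetCard 2) (s' := fun P => I \ P),
      ← Finset.sum_add_distrib]
    swap
    · intro i P
      simp only [Finset.mem_powersetCard, Finset.mem_sdiff, Finset.subset_erase]
      tauto
    refine Finset.sum_eq_zero fun P hP => ?_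
    rw [Finset.mem_powersetCard] at hP
    obtain ⟨hPI, hPc⟩ := hP
    have hsplit : ∑ i ∈ I, b i = ∑ i ∈ I \ P, b i + ∑ i ∈ P, b i :=
      (Finset.sum_sdiff hPI).symm
    have first : ∑ i ∈ I \ P, oddBracket (wedge b₀ (b i)) *
        (if ∑ i ∈ P, b i ≠ 0 then bracketPlus (area (P.val.map b)) *
          markedWeight (k + 1) ((∑ i ∈ P, b i) ::ₘ (b₀ + b i) ::ₘ (I.erase i \ P).val.map b)
          else 0) =
        -(bracketPlus (area (P.val.map b)) * oddBracket (wedge b₀ (∑ i ∈ P, b i)) *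
          markedWeight (k + 1) ((b₀ + ∑ i ∈ P, b i) ::ₘ (I \ P).val.map b)) := by
      -- A contracted joining edge is excluded on the left by the definition of the weight, and on
      -- the right the bracket of zero vanishes.
      by_cases h0 : ∑ i ∈ P, b i = 0
      · simp [h0, wedge, oddBracket_zero]
      -- In the shorter family `none` carries the vector merged from `P`. The induction hypothesis
      -- also contains the term in which `b₀` joins this vector; moved to the other side, it is the
      -- right-hand side here.
      · have h := ih (k + 1) (by omega) (Finset.insertNone (I \ P))
          (fun o => o.elim (∑ i ∈ P, b i) b)
          (by rw [Finset.card_insertNone, Finset.card_sdiff_of_subset hPI]; omega)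
          (by rw [Finset.sum_insertNone]; simp only [Option.elim]; rw [← hsum, hsplit]; abel)
        rw [Finset.sum_insertNone] at h
        simp only [Option.elim_none, Option.elim_some] at h
        have e0 : ((Finset.insertNone (I \ P)).erase none).val.map
            (fun o => o.elim (∑ i ∈ P, b i) b) = (I \ P).val.map b := by
          have : (Finset.insertNone (I \ P)).erase none = (I \ P).map Function.Embedding.some := by
            ext o; cases o <;> simp
          rw [this, Finset.map_val, Multiset.map_map]; rfl
        have e1 : ∀ i ∈ I \ P, ((Finset.insertNone (I \ P)).erase (some i)).val.map
            (fun o => o.elim (∑ i ∈ P, b i) b) =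
            (∑ i ∈ P, b i) ::ₘ (I.erase i \ P).val.map b := by
          intro i _
          have : (Finset.insertNone (I \ P)).erase (some i) = Finset.insertNone (I.erase i \ P) := by
            ext o; cases o <;> simp; tauto
          rw [this]
          change Multiset.map _ (none ::ₘ ((I.erase i \ P).map Function.Embedding.some).val) = _
          rw [Multiset.map_cons, Finset.map_val, Multiset.map_map]; rfl
        rw [e0] at h
        rw [eq_neg_iff_add_eq_zero, ← mul_zero (bracketPlus (area (P.val.map b))), ← h, mul_add,
          Finset.mul_sum, add_comm, mul_assoc]
        congr 1
        refine Finset.sum_congr rfl fun i hi => ?_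
        rw [if_pos h0, e1 i hi, Multiset.cons_swap]; ring
    rw [first]
    obtain ⟨i, j, hij, rfl⟩ := Finset.card_eq_two.1 hPc
    have hij' : ({i, j} : Finset ι).erase i = {j} := by
      rw [Finset.erase_insert]; simpa using hij
    have hji' : ({i, j} : Finset ι).erase j = {i} := by
      rw [Finset.pair_comm, Finset.erase_insert]; simpa using hij.symm
    have hI1 : (I.erase i).erase j = I \ {i, j} := by ext; simp; tauto
    have hI2 : (I.erase j).erase i = I \ {i, j} := by ext; simp; tauto
    rw [Finset.sum_pair hij, Finset.sum_pair hij, hij', hji', Finset.sum_singleton,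
      Finset.sum_singleton, hI1, hI2]
    have ea : bracketPlus (area (({i, j} : Finset ι).val.map b)) =
        evenBracket (wedge (b i) (b j)) := by
      rw [← bracketPlus_natAbs, ← area_pair, Finset.insert_val_of_notMem (by simpa using hij)]
      simp
    rw [ea, add_assoc b₀, add_assoc b₀ (b j), add_comm (b j) (b i)]
    -- If the merged vector vanishes, the second contribution is excluded, but then `b i + b j =
    -- -b₀` and the coefficient of the first one is zero. Otherwise `oddBracket_wedge_three` applies
    -- with a common marked weight.
    by_cases h0 : b₀ + (b i + b j) = 0
    · have : b i + b j = -b₀ := by rw [eq_neg_iff_add_eq_zero, add_comm, h0]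
      simp [this, wedge_neg_right, wedge_self, oddBracket_zero]
    · rw [if_pos h0, if_pos h0]
      have h3 := oddBracket_wedge_three b₀ (b i) (b j)
      linear_combination markedWeight (k + 1)
        ((b₀ + (b i + b j)) ::ₘ (I \ {i, j}).val.map b) * h3

/-! ### Cuts of trees -/

section Cuts

variable {α : Type*} {G : SimpleGraph α}

/-- `χ` is the indicator function of the side of `q` with respect to the edge `pq`. -/
structure IsCut (G : SimpleGraph α) (p q : α) (χ : α → ℤ) : Prop where
  left : χ p = 0
  right : χ q = 1
  eq_of_adj : ∀ v w, G.Adj v w → s(v, w) ≠ s(p, q) → χ v = χ w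

theorem eq_of_reachable {β : Type*} {f : α → β} (h : ∀ v w, G.Adj v w → f v = f w) {v w : α}
    (hvw : G.Reachable v w) : f v = f w := by
  obtain ⟨p⟩ := hvw
  induction p with
  | nil => rfl
  | cons hadj _ ih => exact (h _ _ hadj).trans ih

/-- Every edge of a forest is a bridge; after deleting it, take the indicator of the vertices not
reachable from `p`. -/
theorem exists_isCut_of_isAcyclic (hG : G.IsAcyclic) {p q : α} (h : G.Adj p q) :
    ∃ χ, IsCut G p q χ := by
  classical
  have hb := SimpleGraph.isAcyclic_iff_forall_adj_isBridge.1 hG h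
  rw [SimpleGraph.isBridge_iff] at hb
  refine ⟨fun x => if (G.deleteEdges {s(p, q)}).Reachable p x then 0 else 1, by simp, by simp [hb],
    fun v w hvw hne => ?_⟩
  have hvw' : (G.deleteEdges {s(p, q)}).Adj v w := by
    rw [SimpleGraph.deleteEdges_adj]; exact ⟨hvw, by simpa using hne⟩
  have : (G.deleteEdges {s(p, q)}).Reachable p v ↔ (G.deleteEdges {s(p, q)}).Reachable p w :=
    ⟨fun h => h.trans hvw'.reachable, fun h => h.trans hvw'.symm.reachable⟩
  simp only [this]

theorem isAcyclic_of_exists_isCut (h : ∀ p q, G.Adj p q → ∃ χ, IsCut G p q χ) :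
    G.IsAcyclic := by
  rw [SimpleGraph.isAcyclic_iff_forall_adj_isBridge]
  intro p q hpq
  rw [SimpleGraph.isBridge_iff]
  intro hr
  obtain ⟨χ, h0, h1, h2⟩ := h p q hpq
  have := eq_of_reachable (f := χ) (fun v w hvw => by
    rw [SimpleGraph.deleteEdges_adj] at hvw
    exact h2 v w hvw.1 (by simpa using hvw.2)) hr
  omega

theorem IsCut.symm {p q : α} {χ : α → ℤ} (h : IsCut G p q χ) : IsCut G q p fun x => 1 - χ x :=
  ⟨by simp [h.right], by simp [h.left], fun v w hvw hne => by
    rw [h.eq_of_adj v w hvw (by rwa [Sym2.eq_swap (a := p)])]⟩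

/-- The value of a flow on an edge is the flux through the corresponding cut. -/
theorem IsCut.flow_eq [Fintype α] {p q : α} {χ : α → ℤ} (h : IsCut G p q χ)
    (hne : p ≠ q) {A : Type*} [AddCommGroup A] [IsAddTorsionFree A] (δ : α → α → A)
    (hδ : ∀ v w, δ w v = -δ v w)
    (hδ0 : ∀ v w, ¬ G.Adj v w → δ v w = 0) : δ q p = ∑ v, χ v • ∑ w, δ v w := by
  classical
  have h1 : ∑ v, χ v • ∑ w, δ v w = ∑ v, ∑ w, χ v • δ v w := by simp [Finset.smul_sum]
  have h2 : ∑ v, ∑ w, χ v • δ v w = -∑ v, ∑ w, χ w • δ v w := by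
    rw [Finset.sum_comm, ← Finset.sum_neg_distrib]
    refine Finset.sum_congr rfl fun v _ => ?_
    rw [← Finset.sum_neg_distrib]
    refine Finset.sum_congr rfl fun w _ => ?_
    rw [hδ v w, smul_neg]
  -- Antisymmetrizing the double sum leaves only the cut edge, once in each orientation. This is why
  -- the sum is doubled and division by two is needed at the end.
  have h3 : (2 : ℕ) • ∑ v, χ v • ∑ w, δ v w = ∑ v, ∑ w, (χ v - χ w) • δ v w := by
    rw [two_smul]
    conv_lhs => rw [h1]; arg 2; rw [h2]
    rw [← sub_eq_add_neg, ← Finset.sum_sub_distrib]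
    refine Finset.sum_congr rfl fun v _ => ?_
    rw [← Finset.sum_sub_distrib]
    exact Finset.sum_congr rfl fun w _ => (sub_smul _ _ _).symm
  have h4 : ∀ v w, (χ v - χ w) • δ v w =
      (if v = q then if w = p then δ q p else 0 else 0) +
        (if v = p then if w = q then δ q p else 0 else 0) := by
    intro v w
    by_cases e1 : v = q ∧ w = p
    · obtain ⟨rfl, rfl⟩ := e1
      simp [h.left, h.right, hne.symm]
    by_cases e2 : v = p ∧ w = q
    · obtain ⟨rfl, rfl⟩ := e2
      simp [h.left, h.right, hne, hδ v w]
    have e3 : (χ v - χ w) • δ v w = 0 := by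
      by_cases hvw : G.Adj v w
      · rw [h.eq_of_adj v w hvw, sub_self, zero_smul]
        rw [Ne, Sym2.eq_iff]; tauto
      · rw [hδ0 v w hvw, smul_zero]
    have f1 : (if v = q then if w = p then δ q p else 0 else 0) = 0 := by
      split_ifs with a b
      exacts [absurd ⟨a, b⟩ e1, rfl, rfl]
    have f2 : (if v = p then if w = q then δ q p else 0 else 0) = 0 := by
      split_ifs with a b
      exacts [absurd ⟨a, b⟩ e2, rfl, rfl]
    rw [e3, f1, f2, add_zero]
  have h5 : (2 : ℕ) • ∑ v, χ v • ∑ w, δ v w = (2 : ℕ) • δ q p := by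
    rw [h3]
    simp only [h4, Finset.sum_add_distrib]
    simp [two_smul]
  exact (nsmul_right_injective two_ne_zero h5).symm

end Cuts

/-! ### Labelled combinatorial types -/

/-- The data of a combinatorial type with vertices `Fin V` and ends `Fin E`. -/
@[ext]
structure Shape (n V E : ℕ) where
  graph : SimpleGraph (Fin V)
  foot : Fin E → Fin V
  mark : Fin n → Fin V
  slope : Fin V → Fin V → ℤ × ℤ
  dir : Fin E → ℤ × ℤ

namespace Shape

variable {n V E : ℕ} (K : Shape n V E)

open Classical in
/-- The multiset of the outgoing vectors at a vertex. -/
noncomputable def star (v : Fin V) : Multiset (ℤ × ℤ) :=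
  (∑ w, if K.graph.Adj v w then {K.slope v w} else 0) +
    ∑ e, if K.foot e = v then {K.dir e} else 0

/-- The laws of a combinatorial type. -/
structure Valid : Prop where
  isTree : K.graph.IsTree
  mark_injective : Function.Injective K.mark
  two_le : ∀ v, 2 ≤ Multiset.card (K.star v)
  three_le : ∀ v, (∀ i, K.mark i ≠ v) → 3 ≤ Multiset.card (K.star v)
  slope_symm : ∀ v w, K.slope w v = -K.slope v w
  slope_of_not_adj : ∀ v w, ¬ K.graph.Adj v w → K.slope v w = 0
  dir_ne_zero : ∀ e, K.dir e ≠ 0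
  sum_star : ∀ v, (K.star v).sum = 0

theorem sum_singleton_eq_map {ι α : Type*} (s : Finset ι) (f : ι → α) :
    ∑ i ∈ s, ({f i} : Multiset α) = s.val.map f := by
  rw [Finset.sum, ← Multiset.sum_map_singleton (s.val.map f), Multiset.map_map]; rfl

variable {K}

/-- The combinatorial type with the given data. -/
def Valid.toCurveType (h : K.Valid) : CurveType n :=
  have hstar : ∀ (T : MarkedTree n) (hV : T = ⟨V, E, K.graph, h.isTree, K.foot, K.mark,
      h.mark_injective⟩) (v : Fin T.numVerts), T.valency v = Multiset.card (K.star (Fin.cast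
        (by rw [hV]) v)) := by
    rintro _ rfl v
    classical
    have : K.graph.neighborSet v
        = ((Finset.univ.filter fun w => K.graph.Adj v w : Finset _) : Set (Fin V)) := by
      ext w; simp
    rw [MarkedTree.valency, this, Set.ncard_coe_finset, star, ← Finset.sum_filter,
      ← Finset.sum_filter, sum_singleton_eq_map, sum_singleton_eq_map, Multiset.card_add,
      Multiset.card_map, Multiset.card_map, Finset.card_val, Finset.card_val]
    congr!
  { numVerts := V
    numEnds := E
    graph := K.graph
    isTree := h.isTree
    foot := K.foot
    mark := K.mark
    mark_injective := h.mark_injective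
    two_le_valency := fun v => by rw [hstar _ rfl]; exact h.two_le _
    three_le_valency := fun v hv => by
      rw [hstar _ rfl]; exact h.three_le _ fun i hi => hv ⟨i, hi⟩
    slope := K.slope
    slope_symm := h.slope_symm
    slope_of_not_adj := h.slope_of_not_adj
    dir := K.dir
    dir_ne_zero := h.dir_ne_zero
    balanced := fun v => by
      classical
      have := h.sum_star v
      rw [star, ← Finset.sum_filter, ← Finset.sum_filter, sum_singleton_eq_map,
        sum_singleton_eq_map, Multiset.sum_add] at this
      rw [← this]
      congr 1
      rw [Finset.sum_map_val, Finset.sum_filter]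
      refine Finset.sum_congr rfl fun w _ => ?_
      split_ifs with hw
      · rfl
      · exact h.slope_of_not_adj v w hw }

theorem Valid.star_toCurveType (h : K.Valid) (v : Fin V) :
    h.toCurveType.star v = K.star v := by
  classical
  rw [star, ← Finset.sum_filter, ← Finset.sum_filter, sum_singleton_eq_map, sum_singleton_eq_map]
  rfl

theorem exists_toCurveType_eq (T : CurveType n) (hV : T.numVerts = V) (hE : T.numEnds = E) :
    ∃ (K : Shape n V E) (h : K.Valid), h.toCurveType = T := by
  subst hV hE
  have hstar : ∀ v, T.star v = star ⟨T.graph, T.foot, T.mark, T.slope, T.dir⟩ v := by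
    intro v
    classical
    rw [star, ← Finset.sum_filter, ← Finset.sum_filter, sum_singleton_eq_map, sum_singleton_eq_map]
    unfold CurveType.star
    congr!
  refine ⟨⟨T.graph, T.foot, T.mark, T.slope, T.dir⟩, ⟨T.isTree, T.mark_injective, fun v => ?_,
    fun v hv => ?_, T.slope_symm, T.slope_of_not_adj, T.dir_ne_zero, fun v => ?_⟩, rfl⟩
  · rw [← hstar, PlaneCurve.card_star]; exact T.two_le_valency v
  · rw [← hstar, PlaneCurve.card_star]
    exact T.three_le_valency v fun ⟨i, hi⟩ => hv i hi
  · classical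
    rw [← hstar, CurveType.star, Multiset.sum_add, ← T.balanced v]
    congr 1
    rw [Finset.sum_map_val, Finset.sum_filter]
    refine Finset.sum_congr rfl fun w _ => ?_
    split_ifs with hw
    · rfl
    · exact (T.slope_of_not_adj v w hw).symm

/-- Two types with equal trees and equal directions of ends have equal slopes. -/
theorem Valid.slope_unique {K' : Shape n V E} (h : K.Valid) (h' : K'.Valid)
    (hg : K.graph = K'.graph) (hf : K.foot = K'.foot) (hd : K.dir = K'.dir) :
    K.slope = K'.slope := by
  classical
  -- Balancing prescribes the divergence of the slopes at each vertex in terms of the ends, hence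
  -- also the flux through every cut, and that flux is the slope of the cut edge.
  have hs : ∀ {L : Shape n V E}, L.Valid → ∀ v,
      ∑ w, L.slope v w = -∑ e, if L.foot e = v then L.dir e else 0 := by
    intro L hL v
    have := hL.sum_star v
    rw [star, ← Finset.sum_filter, ← Finset.sum_filter, sum_singleton_eq_map,
        sum_singleton_eq_map, Multiset.sum_add, Finset.sum_map_val, Finset.sum_map_val,
        Finset.sum_filter, Finset.sum_filter, ← eq_neg_iff_add_eq_zero] at this
    rw [← this]
    refine Finset.sum_congr rfl fun w _ => ?_
    split_ifs with hw
    · rfl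
    · exact hL.slope_of_not_adj v w hw
  funext q p
  by_cases hpq : K.graph.Adj p q
  · obtain ⟨χ, hχ⟩ := exists_isCut_of_isAcyclic h.isTree.2 hpq
    rw [hχ.flow_eq hpq.ne K.slope h.slope_symm h.slope_of_not_adj]
    rw [hg] at hχ
    rw [hχ.flow_eq hpq.ne K'.slope h'.slope_symm h'.slope_of_not_adj]
    simp only [hs h, hs h', hf, hd]
  · rw [h.slope_of_not_adj q p fun h => hpq h.symm, h'.slope_of_not_adj q p fun h => hpq ?_]
    rw [hg]; exact h.symm

end Shape

/-! ### The space of plane maps of a labelled type -/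

/-- A lattice vector as a vector of the real plane. -/
def toPlane (b : ℤ × ℤ) : ℝ × ℝ := ((b.1 : ℝ), (b.2 : ℝ))

theorem toPlane_neg (a : ℤ × ℤ) : toPlane (-a) = -toPlane a := by
  simp [toPlane]

theorem toPlane_zero : toPlane 0 = 0 := by
  simp [toPlane]

namespace Shape

variable {n V E : ℕ} (K : Shape n V E)

/-- The maps of the vertices to the plane with the prescribed directions of the edges. -/
def maps : Submodule ℝ (Fin V → ℝ × ℝ) where
  carrier := {p | ∀ v w, K.graph.Adj v w → ∃ t : ℝ, p w = p v + t • toPlane (K.slope v w)}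
  zero_mem' := fun v w _ => ⟨0, by simp⟩
  add_mem' := fun {p p'} hp hp' v w hvw => by
    obtain ⟨t, ht⟩ := hp v w hvw
    obtain ⟨t', ht'⟩ := hp' v w hvw
    exact ⟨t + t', by simp only [Pi.add_apply, ht, ht', add_smul]; abel⟩
  smul_mem' := fun c p hp v w hvw => by
    obtain ⟨t, ht⟩ := hp v w hvw
    exact ⟨c * t, by simp only [Pi.smul_apply, ht, smul_add, mul_smul]⟩

/-- The maps all of whose edges have positive length. -/
def IsOpen (p : Fin V → ℝ × ℝ) : Prop :=
  ∀ v w, K.graph.Adj v w → ∃ t : ℝ, 0 < t ∧ p w = p v + t • toPlane (K.slope v w)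

/-- Evaluation at the marked points. -/
def evMap : (Fin V → ℝ × ℝ) →ₗ[ℝ] (Fin n → ℝ × ℝ) := LinearMap.funLeft ℝ (ℝ × ℝ) K.mark

@[simp]
theorem evMap_apply (p : Fin V → ℝ × ℝ) (i : Fin n) : K.evMap p i = p (K.mark i) := rfl

/-- No edge is contracted, and the maps are determined by arbitrary values at the marked points. -/
structure Good : Prop where
  slope_ne_zero : ∀ v w, K.graph.Adj v w → K.slope v w ≠ 0
  injective : ∀ p ∈ K.maps, K.evMap p = 0 → p = 0
  surjective : ∀ x, ∃ p ∈ K.maps, K.evMap p = x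

variable {K}

theorem IsOpen.mem_maps {p : Fin V → ℝ × ℝ} (h : K.IsOpen p) : p ∈ K.maps := fun v w hvw =>
  let ⟨t, _, ht⟩ := h v w hvw; ⟨t, ht⟩

open Classical in
-- The lengths are chosen for ordered pairs, and on a contracted edge they are not determined by
-- `p`. Using the order of the vertices to prefer one orientation makes the choice symmetric.
theorem exists_lengths (hK : K.Valid) {P : ℝ → Prop} {p : Fin V → ℝ × ℝ}
    (h : ∀ v w, K.graph.Adj v w → ∃ t : ℝ, P t ∧ p w = p v + t • toPlane (K.slope v w)) :
    ∃ len : Fin V → Fin V → ℝ, (∀ v w, len w v = len v w) ∧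
      (∀ v w, ¬ K.graph.Adj v w → len v w = 0) ∧ (∀ v w, K.graph.Adj v w → P (len v w)) ∧
      ∀ v w, K.graph.Adj v w → p w = p v + len v w • toPlane (K.slope v w) := by
  choose! t ht0 ht using h
  let len : Fin V → Fin V → ℝ := fun v w =>
    if K.graph.Adj v w then if v < w then t v w else t w v else 0
  refine ⟨len, fun v w => ?_, fun v w hvw => if_neg hvw, fun v w hvw => ?_, fun v w hvw => ?_⟩
  · simp only [len, K.graph.adj_comm w v]
    split_ifs with h1 h2 h3 h4
    · exact absurd h2 (not_lt.2 h3.le)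
    · rfl
    · rfl
    · have : v = w := le_antisymm (not_lt.1 h2) (not_lt.1 h4)
      rw [this]
    · rfl
  · simp only [len, if_pos hvw]
    split_ifs
    · exact ht0 v w hvw
    · exact ht0 w v hvw.symm
  · simp only [len, if_pos hvw]
    split_ifs
    · exact ht v w hvw
    · rw [ht w v hvw.symm, hK.slope_symm v w, toPlane_neg, smul_neg, add_assoc, neg_add_cancel,
        add_zero]

/-- An open map underlies a point of the open cell. -/
theorem IsOpen.exists_mem_openCell {p : Fin V → ℝ × ℝ} (hK : K.Valid) (h : K.IsOpen p) :
    ∃ q ∈ hK.toCurveType.openCell, q.1 = p := by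
  obtain ⟨len, h1, h2, h3, h4⟩ := exists_lengths hK (P := fun t => 0 < t) h
  exact ⟨(p, len), ⟨⟨h1, h2, fun v w hvw => (h3 v w hvw).le, h4⟩, h3⟩, rfl⟩

theorem isOpen_of_mem_openCell (hK : K.Valid) {q : hK.toCurveType.Params}
    (hq : q ∈ hK.toCurveType.openCell) : K.IsOpen q.1 := fun v w hvw =>
  ⟨q.2 v w, hq.2 v w hvw, hq.1.2.2.2 v w hvw⟩

variable (K) in
/-- The linear span of the closed cell. -/
def cellSpan : Submodule ℝ ((Fin V → ℝ × ℝ) × (Fin V → Fin V → ℝ)) where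
  carrier := {q | (∀ v w, q.2 w v = q.2 v w) ∧ (∀ v w, ¬ K.graph.Adj v w → q.2 v w = 0) ∧
    (∀ v w, K.graph.Adj v w → q.1 w = q.1 v + q.2 v w • toPlane (K.slope v w))}
  zero_mem' := ⟨fun _ _ => rfl, fun _ _ _ => rfl, fun v w _ => by simp⟩
  add_mem' := fun {q q'} hq hq' => ⟨fun v w => by
      simp only [Prod.snd_add, Pi.add_apply, hq.1 v w, hq'.1 v w], fun v w h => by
      simp only [Prod.snd_add, Pi.add_apply, hq.2.1 v w h, hq'.2.1 v w h, add_zero], fun v w h => by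
      simp only [Prod.snd_add, Prod.fst_add, Pi.add_apply, hq.2.2 v w h, hq'.2.2 v w h, add_smul]
      abel⟩
  smul_mem' := fun c q hq => ⟨fun v w => by
      simp only [Prod.smul_snd, Pi.smul_apply, hq.1 v w], fun v w h => by
      simp only [Prod.smul_snd, Pi.smul_apply, hq.2.1 v w h, smul_zero], fun v w h => by
      simp only [Prod.smul_snd, Prod.smul_fst, Pi.smul_apply, hq.2.2 v w h, smul_add, smul_assoc]⟩

/-- The position of one vertex and one number for each of the `V - 1` edges determine an element,
which gives the bound `2 + (V - 1)`. -/
theorem finrank_cellSpan_le (hK : K.Valid) : Module.finrank ℝ K.cellSpan ≤ V + 1 := by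
  classical
  have hcard := (SimpleGraph.isTree_iff_connected_and_card.1 hK.isTree).2
  have : Nonempty (Fin V) := hK.isTree.1.nonempty
  let r : Fin V := Classical.arbitrary _
  let f : K.cellSpan →ₗ[ℝ] (ℝ × ℝ) × (K.graph.edgeSet → ℝ) :=
    { toFun := fun q => (q.1.1 r, fun e => q.1.2 (Quot.out e.1).1 (Quot.out e.1).2)
      map_add' := fun q q' => rfl
      map_smul' := fun c q => rfl }
  have hf : Function.Injective f := by
    rw [injective_iff_map_eq_zero]
    rintro ⟨q, hq⟩ h0
    have h1 : q.1 r = 0 := congrArg Prod.fst h0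
    have h2 : ∀ v w, q.2 v w = 0 := by
      intro v w
      by_cases hvw : K.graph.Adj v w
      · have h3 := congrFun (congrArg Prod.snd h0) ⟨s(v, w), hvw⟩
        change q.2 (Quot.out s(v, w)).1 (Quot.out s(v, w)).2 = 0 at h3
        have h4 : s((Quot.out s(v, w)).1, (Quot.out s(v, w)).2) = s(v, w) := Quot.out_eq _
        rw [Sym2.eq_iff] at h4
        rcases h4 with ⟨e1, e2⟩ | ⟨e1, e2⟩
        · rwa [e1, e2] at h3
        · rw [e1, e2] at h3
          rw [← h3]; exact hq.1 w v
      · exact hq.2.1 v w hvw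
    have h5 : ∀ v, q.1 v = 0 := by
      intro v
      rw [← h1]
      refine eq_of_reachable (f := q.1) (fun v w hvw => ?_) (hK.isTree.1.preconnected v r)
      rw [hq.2.2 v w hvw, h2, zero_smul, add_zero]
    refine Subtype.ext (Prod.ext (funext h5) (funext fun v => funext fun w => h2 v w))
  have hle := LinearMap.finrank_le_finrank_of_injective hf
  refine hle.trans ?_
  have : Fintype K.graph.edgeSet := Fintype.ofFinite _
  rw [Module.finrank_prod, Module.finrank_prod, Module.finrank_self, Module.finrank_fintype_fun_eq_card,
    ← Nat.card_eq_fintype_card]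
  rw [Nat.card_fin] at hcard
  omega

theorem finrank_points (n : ℕ) : Module.finrank ℝ (Fin n → ℝ × ℝ) = 2 * n := by
  rw [Module.finrank_pi_fintype]
  simp [Module.finrank_prod, mul_comm]

open Classical in
/-- Essential types are good. -/
theorem good_of_isEssential (hK : K.Valid) {D : Multiset (ℤ × ℤ)} {N : ℕ →₀ ℕ}
    (h : hK.toCurveType.IsEssential D N) : V + 1 = 2 * n ∧ K.Good := by
  obtain ⟨-, -, hdim, hspan⟩ := h
  have hcard := (SimpleGraph.isTree_iff_connected_and_card.1 hK.isTree).2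
  have hV : V + 1 = 2 * n := by
    rw [Nat.card_fin, Nat.card_coe_set_eq] at hcard
    change 2 + K.graph.edgeSet.ncard = 2 * n at hdim
    omega
  refine ⟨hV, ?_⟩
  let evL : K.cellSpan →ₗ[ℝ] (Fin n → ℝ × ℝ) :=
    K.evMap ∘ₗ LinearMap.fst ℝ (Fin V → ℝ × ℝ) (Fin V → Fin V → ℝ) ∘ₗ K.cellSpan.subtype
  have htop : vectorSpan ℝ (hK.toCurveType.ev '' hK.toCurveType.openCell) = ⊤ :=
    Submodule.eq_top_of_finrank_eq (by rw [hspan, finrank_points])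
  have hmem : ∀ x ∈ hK.toCurveType.ev '' hK.toCurveType.openCell, x ∈ LinearMap.range evL := by
    rintro _ ⟨q, hq, rfl⟩
    exact ⟨⟨q, hq.1.1, hq.1.2.1, hq.1.2.2.2⟩, rfl⟩
  have hsurj : LinearMap.range evL = ⊤ := by
    rw [eq_top_iff, ← htop, vectorSpan_def, Submodule.span_le]
    rintro _ ⟨x, hx, y, hy, rfl⟩
    exact Submodule.sub_mem _ (hmem x hx) (hmem y hy)
  -- Evaluation maps a space of dimension at most `V + 1 = 2 * n` onto one of dimension `2 * n`.
  have hinj : LinearMap.ker evL = ⊥ := by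
    have h1 := LinearMap.finrank_range_add_finrank_ker evL
    rw [hsurj, finrank_top, finrank_points] at h1
    have h2 := finrank_cellSpan_le hK
    exact Submodule.finrank_eq_zero.1 (by omega)
  rw [LinearMap.ker_eq_bot'] at hinj
  refine ⟨fun v w hvw h0 => ?_, fun p hp hp0 => ?_, fun x => ?_⟩
  -- The length of a contracted edge could be changed without moving any vertex, giving a nonzero
  -- element of the kernel.
  · let len : Fin V → Fin V → ℝ := fun a b => if s(a, b) = s(v, w) then 1 else 0
    have hq : ((0, len) : (Fin V → ℝ × ℝ) × (Fin V → Fin V → ℝ)) ∈ K.cellSpan := by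
      refine ⟨fun a b => ?_, fun a b hab => ?_, fun a b _ => ?_⟩
      · change len b a = len a b
        simp only [len]
        rw [Sym2.eq_swap]
      · change len a b = 0
        refine if_neg fun h => hab ?_
        rw [← SimpleGraph.mem_edgeSet, h]; exact hvw
      · change (0 : ℝ × ℝ) = 0 + len a b • toPlane (K.slope a b)
        simp only [len]
        split_ifs with h
        · rw [Sym2.eq_iff] at h
          rcases h with ⟨rfl, rfl⟩ | ⟨rfl, rfl⟩
          · simp [h0, toPlane_zero]
          · rw [hK.slope_symm, h0]; simp [toPlane_zero]
        · simp
    have h1 := hinj ⟨_, hq⟩ rfl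
    have h2 := congrArg (fun q : K.cellSpan => q.1.2 v w) h1
    change len v w = 0 at h2
    simp [len] at h2
  · obtain ⟨len, l1, l2, -, l3⟩ := exists_lengths hK (P := fun _ => True)
      fun v w hvw => (hp v w hvw).imp fun t ht => ⟨trivial, ht⟩
    have hq : ((p, len) : (Fin V → ℝ × ℝ) × (Fin V → Fin V → ℝ)) ∈ K.cellSpan := ⟨l1, l2, l3⟩
    have h1 := hinj ⟨_, hq⟩ hp0
    exact congrArg (fun q : K.cellSpan => q.1.1) h1
  · have : x ∈ LinearMap.range evL := by rw [hsurj]; trivial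
    obtain ⟨⟨q, hq⟩, rfl⟩ := this
    exact ⟨q.1, fun v w hvw => ⟨q.2 v w, hq.2.2 v w hvw⟩, rfl⟩

end Shape

/-! ### Edge lengths as functions of the marked points -/

open Filter Topology

theorem eventually_pos_add_mul {a b : ℝ} (ha : 0 < a) : ∀ᶠ ε in 𝓝 (0 : ℝ), 0 < a + ε * b := by
  have : ContinuousAt (fun ε : ℝ => a + ε * b) 0 := by fun_prop
  exact this.eventually (lt_mem_nhds (by simpa using ha))

/-- The coefficient of a plane vector along a lattice vector. -/
noncomputable def along (b : ℤ × ℤ) : ℝ × ℝ →ₗ[ℝ] ℝ where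
  toFun u := (b.1 * u.1 + b.2 * u.2) / (b.1 * b.1 + b.2 * b.2)
  map_add' u u' := by simp only [Prod.fst_add, Prod.snd_add]; ring
  map_smul' c u := by
    simp only [Prod.smul_fst, Prod.smul_snd, smul_eq_mul, RingHom.id_apply]; ring

theorem along_toPlane {b : ℤ × ℤ} (hb : b ≠ 0) : along b (toPlane b) = 1 := by
  change ((b.1 : ℝ) * b.1 + b.2 * b.2) / (b.1 * b.1 + b.2 * b.2) = 1
  refine div_self fun h => hb ?_
  have h' : b.1 * b.1 + b.2 * b.2 = 0 := by exact_mod_cast h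
  refine Prod.ext ?_ ?_ <;> simp only [Prod.fst_zero, Prod.snd_zero] <;> nlinarith

theorem along_neg (b : ℤ × ℤ) (u : ℝ × ℝ) : along (-b) u = -along b u := by
  simp only [along, LinearMap.coe_mk, AddHom.coe_mk, Prod.fst_neg, Prod.snd_neg, Int.cast_neg]
  rw [← neg_div]
  congr 1 <;> ring

namespace Shape

variable {n V E : ℕ} {K : Shape n V E}

/-- A good type with an open map is essential. -/
theorem isEssential_of_good (hK : K.Valid) (hV : V + 1 = 2 * n) (hG : K.Good)
    {p₀ : Fin V → ℝ × ℝ} (h₀ : K.IsOpen p₀) {D : Multiset (ℤ × ℤ)} {N : ℕ →₀ ℕ}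
    (hD : Finset.univ.val.map K.dir = D) (hN : hK.toCurveType.HasProfile N) :
    hK.toCurveType.IsEssential D N := by
  have hcard := (SimpleGraph.isTree_iff_connected_and_card.1 hK.isTree).2
  refine ⟨hD, hN, ?_, ?_⟩
  · rw [Nat.card_fin, Nat.card_coe_set_eq] at hcard
    change 2 + K.graph.edgeSet.ncard = 2 * n
    omega
  · rw [← finrank_points n, ← finrank_top ℝ (Fin n → ℝ × ℝ)]
    suffices h : vectorSpan ℝ (hK.toCurveType.ev '' hK.toCurveType.openCell) = ⊤ by rw [h]
    rw [eq_top_iff]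
    intro x _
    obtain ⟨p, hp, rfl⟩ := hG.surjective x
    choose! t₀ ht₀ ht₀' using h₀
    choose! t ht using hp
    -- A small perturbation of an open map remains open, so differences of points of the image span
    -- every direction that is the evaluation of a map.
    have hev : ∀ᶠ ε in 𝓝[>] (0 : ℝ), ∀ v w, K.graph.Adj v w → 0 < t₀ v w + ε * t v w := by
      simp only [eventually_all]
      intro v w hvw
      exact (eventually_pos_add_mul (ht₀ v w hvw)).filter_mono nhdsWithin_le_nhds
    obtain ⟨ε, hε, hε0⟩ := (hev.and self_mem_nhdsWithin).exists
    have hopen : K.IsOpen (p₀ + ε • p) := fun v w hvw => ⟨_, hε v w hvw, by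
      simp only [Pi.add_apply, Pi.smul_apply, ht₀' v w hvw, ht v w hvw, smul_add, add_smul, mul_smul]
      abel⟩
    obtain ⟨q, hq, hqp⟩ := hopen.exists_mem_openCell hK
    obtain ⟨q₀, hq₀, hqp₀⟩ := IsOpen.exists_mem_openCell hK (p := p₀)
      fun v w hvw => ⟨_, ht₀ v w hvw, ht₀' v w hvw⟩
    have h1 := vsub_mem_vectorSpan ℝ (Set.mem_image_of_mem hK.toCurveType.ev hq)
      (Set.mem_image_of_mem hK.toCurveType.ev hq₀)
    have h2 : hK.toCurveType.ev q -ᵥ hK.toCurveType.ev q₀ = ε • K.evMap p := by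
      funext i
      change q.1 (K.mark i) - q₀.1 (K.mark i) = ε • p (K.mark i)
      rw [hqp, hqp₀]
      simp
    rw [h2] at h1
    have h3 := Submodule.smul_mem _ ε⁻¹ h1
    rwa [smul_smul, inv_mul_cancel₀ (ne_of_gt hε0), one_smul] at h3

theorem Good.bijective (h : K.Good) : Function.Bijective (K.evMap.domRestrict K.maps) := by
  refine ⟨?_, fun x => ?_⟩
  · rw [injective_iff_map_eq_zero]
    intro p hp
    exact Subtype.ext (h.injective p.1 p.2 hp)
  · obtain ⟨p, hp, hx⟩ := h.surjective x
    exact ⟨⟨p, hp⟩, hx⟩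

/-- The inverse of evaluation. -/
noncomputable def Good.solve (h : K.Good) : (Fin n → ℝ × ℝ) →ₗ[ℝ] (Fin V → ℝ × ℝ) :=
  K.maps.subtype ∘ₗ (LinearEquiv.ofBijective (K.evMap.domRestrict K.maps) h.bijective).symm

theorem Good.solve_mem (h : K.Good) (x : Fin n → ℝ × ℝ) : h.solve x ∈ K.maps :=
  Subtype.coe_prop _

theorem Good.evMap_solve (h : K.Good) (x : Fin n → ℝ × ℝ) : K.evMap (h.solve x) = x :=
  LinearEquiv.apply_symm_apply (LinearEquiv.ofBijective (K.evMap.domRestrict K.maps) h.bijective) x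

theorem Good.eq_of_evMap_eq (h : K.Good) {p p' : Fin V → ℝ × ℝ} (hp : p ∈ K.maps)
    (hp' : p' ∈ K.maps) (he : K.evMap p = K.evMap p') : p = p' :=
  sub_eq_zero.1 (h.injective _ (Submodule.sub_mem _ hp hp') (by rw [map_sub, he, sub_self]))

theorem Good.solve_evMap (h : K.Good) {p : Fin V → ℝ × ℝ} (hp : p ∈ K.maps) :
    h.solve (K.evMap p) = p :=
  h.eq_of_evMap_eq (h.solve_mem _) hp (h.evMap_solve _)

variable (K) in
/-- The length of an edge of a map. -/
noncomputable def len (v w : Fin V) : (Fin V → ℝ × ℝ) →ₗ[ℝ] ℝ :=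
  along (K.slope v w) ∘ₗ ((LinearMap.proj w : (Fin V → ℝ × ℝ) →ₗ[ℝ] ℝ × ℝ) - LinearMap.proj v)

theorem len_apply (v w : Fin V) (p : Fin V → ℝ × ℝ) :
    K.len v w p = along (K.slope v w) (p w - p v) := rfl

theorem len_eq {v w : Fin V} (hs : K.slope v w ≠ 0) {p : Fin V → ℝ × ℝ} {t : ℝ}
    (h : p w = p v + t • toPlane (K.slope v w)) : K.len v w p = t := by
  rw [len_apply, h, add_sub_cancel_left, map_smul, along_toPlane hs, smul_eq_mul, mul_one]

theorem Good.eq_add_len (h : K.Good) {p : Fin V → ℝ × ℝ} (hp : p ∈ K.maps) {v w : Fin V}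
    (hvw : K.graph.Adj v w) : p w = p v + K.len v w p • toPlane (K.slope v w) := by
  obtain ⟨t, ht⟩ := hp v w hvw
  rwa [len_eq (h.slope_ne_zero v w hvw) ht]

theorem Valid.len_symm (h : K.Valid) (v w : Fin V) : K.len w v = K.len v w := by
  refine LinearMap.ext fun p => ?_
  rw [len_apply, len_apply, h.slope_symm v w, along_neg, ← map_neg, neg_sub]

open Classical in
variable (K) in
/-- The length of an edge as a function of the positions of the marked points. -/
noncomputable def length (v w : Fin V) : (Fin n → ℝ × ℝ) →ₗ[ℝ] ℝ :=
  -- The default value has sign `0`, so types that are not good drop out of the signed sums at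
  -- walls.
  if h : K.Good then K.len v w ∘ₗ h.solve else 0

theorem Good.length_apply (h : K.Good) (v w : Fin V) (x : Fin n → ℝ × ℝ) :
    K.length v w x = K.len v w (h.solve x) := by
  rw [length, dif_pos h]; rfl

theorem Good.length_evMap (h : K.Good) (v w : Fin V) {p : Fin V → ℝ × ℝ} (hp : p ∈ K.maps) :
    K.length v w (K.evMap p) = K.len v w p := by
  rw [h.length_apply, h.solve_evMap hp]

theorem Valid.length_symm (h : K.Valid) (v w : Fin V) : K.length w v = K.length v w := by
  rw [length, length, h.len_symm]

theorem Good.isOpen_iff (h : K.Good) {p : Fin V → ℝ × ℝ} (hp : p ∈ K.maps) :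
    K.IsOpen p ↔ ∀ v w, K.graph.Adj v w → 0 < K.len v w p := by
  refine ⟨fun ho v w hvw => ?_, fun ho v w hvw => ⟨_, ho v w hvw, h.eq_add_len hp hvw⟩⟩
  obtain ⟨t, ht, he⟩ := ho v w hvw
  rwa [len_eq (h.slope_ne_zero v w hvw) he]

/-- A good type becomes a cone in the space of configurations: the unique map through `x` is a curve
of this type exactly when the edge lengths that it dictates are positive. -/
theorem Good.mem_image_openCell_iff (hK : K.Valid) (h : K.Good) (x : Fin n → ℝ × ℝ) :
    x ∈ hK.toCurveType.ev '' hK.toCurveType.openCell ↔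
      ∀ v w, K.graph.Adj v w → 0 < K.length v w x := by
  constructor
  · rintro ⟨q, hq, rfl⟩ v w hvw
    have ho := isOpen_of_mem_openCell hK hq
    have h1 := h.length_evMap v w ho.mem_maps
    rw [show hK.toCurveType.ev q = K.evMap q.1 from rfl, h1]
    exact (h.isOpen_iff ho.mem_maps).1 ho v w hvw
  · intro hl
    have ho : K.IsOpen (h.solve x) := (h.isOpen_iff (h.solve_mem x)).2 fun v w hvw => by
      rw [← h.length_apply]; exact hl v w hvw
    obtain ⟨q, hq, hqp⟩ := ho.exists_mem_openCell hK
    refine ⟨q, hq, ?_⟩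
    rw [show hK.toCurveType.ev q = K.evMap q.1 from rfl, hqp, h.evMap_solve]

/-- The map which moves one side of a cut along the cut edge. -/
theorem cut_mem_maps (hK : K.Valid) {a b : Fin V} {χ : Fin V → ℤ}
    (hχ : IsCut K.graph a b χ) :
    (fun x => (χ x : ℝ) • toPlane (K.slope a b)) ∈ K.maps := by
  intro v w hvw
  by_cases h : s(v, w) = s(a, b)
  · rw [Sym2.eq_iff] at h
    rcases h with ⟨rfl, rfl⟩ | ⟨rfl, rfl⟩
    · exact ⟨1, by simp [hχ.left, hχ.right]⟩
    · exact ⟨1, by simp [hχ.left, hχ.right, hK.slope_symm w v, toPlane_neg]⟩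
  · exact ⟨0, by simp [hχ.eq_of_adj v w hvw h]⟩

theorem len_cut_self {a b : Fin V} (hs : K.slope a b ≠ 0) {χ : Fin V → ℤ} (hχ : IsCut K.graph a b χ) :
    K.len a b (fun x => (χ x : ℝ) • toPlane (K.slope a b)) = 1 :=
  len_eq hs (by simp [hχ.left, hχ.right])

theorem len_cut_of_ne {a b : Fin V} {χ : Fin V → ℤ} (hχ : IsCut K.graph a b χ) {v w : Fin V}
    (hvw : K.graph.Adj v w) (h : s(v, w) ≠ s(a, b)) (u : ℝ × ℝ) :
    K.len v w (fun x => (χ x : ℝ) • u) = 0 := by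
  rw [len_apply, hχ.eq_of_adj v w hvw h, sub_self, map_zero]

/-- The edge lengths are linearly independent functions of the marked points. -/
theorem Good.exists_length_eq (h : K.Good) (hK : K.Valid) {a b : Fin V} (hab : K.graph.Adj a b) :
    ∃ y, K.length a b y = 1 ∧
      ∀ v w, K.graph.Adj v w → s(v, w) ≠ s(a, b) → K.length v w y = 0 := by
  obtain ⟨χ, hχ⟩ := exists_isCut_of_isAcyclic hK.isTree.2 hab
  have hm := cut_mem_maps hK hχ
  refine ⟨K.evMap fun x => (χ x : ℝ) • toPlane (K.slope a b), ?_, fun v w hvw hne => ?_⟩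
  · rw [h.length_evMap _ _ hm, len_cut_self (h.slope_ne_zero _ _ hab) hχ]
  · rw [h.length_evMap _ _ hm, len_cut_of_ne hχ hvw hne]

/-- The slopes are functions of the tree and of the directions of the ends, and the directions range
over the finitely many members of `D`. -/
theorem finite_valid (D : Multiset (ℤ × ℤ)) :
    {K : Shape n V E | K.Valid ∧ Finset.univ.val.map K.dir = D}.Finite := by
  classical
  let f : Shape n V E → SimpleGraph (Fin V) × (Fin E → Fin V) × (Fin n → Fin V) × (Fin E → ℤ × ℤ) :=
    fun K => (K.graph, K.foot, K.mark, K.dir)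
  refine Set.Finite.of_finite_image (f := f) ?_ ?_
  · refine Set.Finite.subset (s := Set.univ ×ˢ Set.univ ×ˢ Set.univ ×ˢ
      Set.pi Set.univ fun _ => {b | b ∈ D}) ?_ ?_
    · refine Set.finite_univ.prod (Set.finite_univ.prod (Set.finite_univ.prod ?_))
      exact Set.Finite.pi fun _ => D.toFinset.finite_toSet.subset fun b hb => by simpa using hb
    · rintro _ ⟨K, ⟨-, hK⟩, rfl⟩
      refine ⟨trivial, trivial, trivial, fun e _ => ?_⟩
      change K.dir e ∈ D
      rw [← hK]
      exact Multiset.mem_map_of_mem _ (Finset.mem_univ e)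
  · rintro K ⟨hK, -⟩ K' ⟨hK', -⟩ he
    simp only [f, Prod.mk.injEq] at he
    exact Shape.ext he.1 he.2.1 he.2.2.1 (hK.slope_unique hK' he.1 he.2.1 he.2.2.2) he.2.2.2

end Shape

namespace Shape

variable {n V E : ℕ} (K : Shape n V E) (a b : Fin V)

/-! ### Sliding branches along an edge -/

/-- `u` is a neighbour of the edge `ab`. -/
def Nbr (u : Fin V) : Prop := u ≠ a ∧ u ≠ b ∧ (K.graph.Adj a u ∨ K.graph.Adj b u)

/-- The half-edges and ends that are attached to the edge `ab`. -/
def IsBranch : Fin V ⊕ Fin E → Prop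
  | .inl u => K.Nbr a b u
  | .inr e => K.foot e = a ∨ K.foot e = b

open Classical in
/-- The finite set of the branches at the edge `ab`. -/
noncomputable def branches : Finset (Fin V ⊕ Fin E) := Finset.univ.filter (K.IsBranch a b)

/-- The outgoing vector of a branch. -/
def branchVec : Fin V ⊕ Fin E → ℤ × ℤ
  -- In a tree `u` is adjacent to only one of `a`, `b`, and the other slope is zero. The sum avoids
  -- recording to which of them the branch is attached.
  | .inl u => K.slope a u + K.slope b u
  | .inr e => K.dir e

theorem mem_branches {i : Fin V ⊕ Fin E} : i ∈ K.branches a b ↔ K.IsBranch a b i := by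
  simp [branches]

variable {a b} (hab : a ≠ b) (S : Finset (Fin V ⊕ Fin E))

open Classical in
/-- The vertex of the edge `ab` to which a branch is attached if those in `S` go to `b`. -/
noncomputable def attach (a b : Fin V) (S : Finset (Fin V ⊕ Fin E)) (i : Fin V ⊕ Fin E) : Fin V :=
  if i ∈ S then b else a

open Classical in
/-- The type obtained by attaching the branches in `S` to `b` and the other branches to `a`. -/
noncomputable def reattach : Shape n V E where
  graph :=
    { Adj := fun x y => (x = a ∧ y = b) ∨ (x = b ∧ y = a) ∨
        (K.Nbr a b x ∧ y = attach a b S (.inl x)) ∨ (K.Nbr a b y ∧ x = attach a b S (.inl y)) ∨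
        ((x ≠ a ∧ x ≠ b) ∧ (y ≠ a ∧ y ≠ b) ∧ K.graph.Adj x y)
      symm := ⟨fun x y h => by have := K.graph.adj_comm x y; tauto⟩
      loopless := ⟨fun x h => by
        have h1 := K.graph.irrefl (v := x)
        unfold Nbr attach at h
        split_ifs at h <;> grind⟩ }
  foot := fun e => if K.foot e = a ∨ K.foot e = b then attach a b S (.inr e) else K.foot e
  mark := K.mark
  slope := fun x y =>
    if x = a ∧ y = b then ∑ i ∈ S, K.branchVec a b i
    else if x = b ∧ y = a then -∑ i ∈ S, K.branchVec a b i
    else if K.Nbr a b x ∧ y = attach a b S (.inl x) then -K.branchVec a b (.inl x)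
    else if K.Nbr a b y ∧ x = attach a b S (.inl y) then K.branchVec a b (.inl y)
    else if (x ≠ a ∧ x ≠ b) ∧ (y ≠ a ∧ y ≠ b) then K.slope x y else 0
  dir := K.dir

theorem attach_eq_or (i : Fin V ⊕ Fin E) : attach a b S i = a ∨ attach a b S i = b := by
  unfold attach; split_ifs <;> simp

theorem reattach_adj {x y : Fin V} : (K.reattach hab S).graph.Adj x y ↔
    (x = a ∧ y = b) ∨ (x = b ∧ y = a) ∨
        (K.Nbr a b x ∧ y = attach a b S (.inl x)) ∨ (K.Nbr a b y ∧ x = attach a b S (.inl y)) ∨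
        ((x ≠ a ∧ x ≠ b) ∧ (y ≠ a ∧ y ≠ b) ∧ K.graph.Adj x y) := Iff.rfl

open Classical in
theorem reattach_slope (x y : Fin V) : (K.reattach hab S).slope x y =
    if x = a ∧ y = b then ∑ i ∈ S, K.branchVec a b i
    else if x = b ∧ y = a then -∑ i ∈ S, K.branchVec a b i
    else if K.Nbr a b x ∧ y = attach a b S (.inl x) then -K.branchVec a b (.inl x)
    else if K.Nbr a b y ∧ x = attach a b S (.inl y) then K.branchVec a b (.inl y)
    else if (x ≠ a ∧ x ≠ b) ∧ (y ≠ a ∧ y ≠ b) then K.slope x y else 0 := rfl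

theorem reattach_nbr (u : Fin V) : (K.reattach hab S).Nbr a b u ↔ K.Nbr a b u := by
  have := attach_eq_or (a := a) (b := b) S (.inl u)
  simp only [Nbr, reattach_adj]
  grind

theorem reattach_isBranch (i : Fin V ⊕ Fin E) :
    (K.reattach hab S).IsBranch a b i ↔ K.IsBranch a b i := by
  cases i with
  | inl u => exact K.reattach_nbr hab S u
  | inr e =>
    have := attach_eq_or (a := a) (b := b) S (.inr e)
    simp only [IsBranch, reattach]
    grind

theorem reattach_branches : (K.reattach hab S).branches a b = K.branches a b := by
  ext i
  rw [mem_branches, mem_branches, reattach_isBranch]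

open Classical in
theorem reattach_branchVec {i : Fin V ⊕ Fin E} (hi : K.IsBranch a b i) :
    (K.reattach hab S).branchVec a b i = K.branchVec a b i := by
  cases i with
  | inl u =>
    have hu : K.Nbr a b u := hi
    have hna : ¬ K.Nbr a b a := fun h => h.1 rfl
    have hnb : ¬ K.Nbr a b b := fun h => h.2.1 rfl
    have h1 : u ≠ a := hu.1
    have h2 : u ≠ b := hu.2.1
    rcases attach_eq_or (a := a) (b := b) S (.inl u) with h | h
    · simp [branchVec, reattach, h, hu, hna, hnb, h1, h2, hab.symm]
    · simp [branchVec, reattach, h, hu, hna, hnb, h1, h2, hab]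
  | inr e => rfl

/-- Only the last distribution of the branches matters. Hence `reattach` with the empty set is a
normal form for the type with `ab` contracted, and being related by sliding is the equality of
normal forms. -/
theorem reattach_reattach {S' : Finset (Fin V ⊕ Fin E)} (hS' : S' ⊆ K.branches a b) :
    (K.reattach hab S).reattach hab S' = K.reattach hab S' := by
  have hN := K.reattach_nbr hab S
  have hB : ∀ {u}, K.Nbr a b u → (K.reattach hab S).branchVec a b (.inl u) =
    K.branchVec a b (.inl u) := fun {u} hu => K.reattach_branchVec hab S (i := .inl u) hu
  have hsum : ∑ i ∈ S', (K.reattach hab S).branchVec a b i = ∑ i ∈ S', K.branchVec a b i :=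
    Finset.sum_congr rfl fun i hi =>
      K.reattach_branchVec hab S ((K.mem_branches a b).1 (hS' hi))
  ext1
  · ext x y
    have h1 := attach_eq_or (a := a) (b := b) S (.inl x)
    have h2 := attach_eq_or (a := a) (b := b) S (.inl y)
    simp only [reattach_adj, hN]
    grind
  · funext e
    have h1 := attach_eq_or (a := a) (b := b) S (.inr e)
    simp only [reattach]
    grind
  · rfl
  · funext x y
    have hoff : (x ≠ a ∧ x ≠ b) ∧ (y ≠ a ∧ y ≠ b) →
        ¬ (K.Nbr a b x ∧ y = attach a b S' (.inl x)) → ¬ (K.Nbr a b y ∧ x = attach a b S' (.inl y)) →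
        (K.reattach hab S).slope x y = K.slope x y := by
      intro h _ _
      have h1 := attach_eq_or (a := a) (b := b) S (.inl x)
      have h2 := attach_eq_or (a := a) (b := b) S (.inl y)
      simp only [reattach]
      grind
    have hN' : (K.reattach hab S).Nbr a b = K.Nbr a b := funext fun u => propext (hN u)
    rw [reattach_slope, K.reattach_slope hab S', hsum, hN']
    split_ifs with h1 h2 h3 h4 h5
    · rfl
    · rfl
    · rw [hB h3.1]
    · rw [hB h4.1]
    · exact hoff h5 h3 h4
    · rfl
  · rfl

/-- The branch is attached to `b`. -/
def IsBranchAt (b : Fin V) : Fin V ⊕ Fin E → Prop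
  | .inl u => K.graph.Adj b u
  | .inr e => K.foot e = b

open Classical in
/-- The branches at the edge `ab` that are attached to `b`. -/
noncomputable def branchesAt (a b : Fin V) : Finset (Fin V ⊕ Fin E) :=
  (K.branches a b).filter (K.IsBranchAt b)

theorem branchesAt_subset : K.branchesAt a b ⊆ K.branches a b := by
  classical
  unfold branchesAt
  exact Finset.filter_subset _ _

theorem mem_branchesAt {i : Fin V ⊕ Fin E} :
    i ∈ K.branchesAt a b ↔ K.IsBranch a b i ∧ K.IsBranchAt b i := by
  simp [branchesAt, mem_branches]

variable {K}

/-- Otherwise the cut at `ab` would have both values `0` and `1` at `u`. -/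
theorem Valid.not_adj_both (hK : K.Valid) (h : K.graph.Adj a b) {u : Fin V}
    (hau : K.graph.Adj a u) (hbu : K.graph.Adj b u) : False := by
  obtain ⟨χ, hχ⟩ := exists_isCut_of_isAcyclic hK.isTree.2 h
  have h1 := hχ.eq_of_adj a u hau (by rw [Ne, Sym2.eq_iff]; grind [SimpleGraph.irrefl])
  have h2 := hχ.eq_of_adj b u hbu (by rw [Ne, Sym2.eq_iff]; grind [SimpleGraph.irrefl])
  have := hχ.left
  have := hχ.right
  omega

theorem Valid.slope_self (hK : K.Valid) (v : Fin V) : K.slope v v = 0 :=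
  hK.slope_of_not_adj v v (K.graph.irrefl)

open Classical in
theorem sum_ite_mem_singleton (S : Finset (Fin V ⊕ Fin E)) (f : Fin V ⊕ Fin E → ℤ × ℤ) :
    S.val.map f = (∑ w, if .inl w ∈ S then ({f (.inl w)} : Multiset (ℤ × ℤ)) else 0) +
      ∑ e, if .inr e ∈ S then ({f (.inr e)} : Multiset (ℤ × ℤ)) else 0 := by
  rw [← sum_singleton_eq_map, ← Fintype.sum_sum_type
    (fun i => if i ∈ S then ({f i} : Multiset (ℤ × ℤ)) else 0), Finset.sum_ite_mem,
    Finset.univ_inter]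

open Classical in
/-- The star of the vertex `b` splits into the edge `ba` and the branches at `b`. -/
theorem star_eq_cons (h : K.graph.Adj a b)
    (hs : ∀ w, w ≠ a → K.graph.Adj b w → K.slope a w = 0) :
    K.star b = K.slope b a ::ₘ (K.branchesAt a b).val.map (K.branchVec a b) := by
  rw [sum_ite_mem_singleton, star, ← Multiset.singleton_add, ← add_assoc]
  congr 1
  · rw [← Finset.add_sum_erase _ _ (Finset.mem_univ a), if_pos h.symm]
    congr 1
    rw [← Finset.add_sum_erase _ _ (Finset.mem_univ a), if_neg, zero_add]
    · refine Finset.sum_congr rfl fun w hw => ?_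
      have hwa : w ≠ a := by simpa using hw
      have : (.inl w ∈ K.branchesAt a b) ↔ K.graph.Adj b w := by
        rw [mem_branchesAt]
        exact ⟨fun h => h.2, fun hw => ⟨⟨hwa, hw.ne', Or.inr hw⟩, hw⟩⟩
      simp only [this]
      split_ifs with hbw
      · simp [branchVec, hs w hwa hbw]
      · rfl
    · rw [mem_branchesAt]
      exact fun h => h.1.1 rfl
  · refine Finset.sum_congr rfl fun e _ => ?_
    have : (.inr e ∈ K.branchesAt a b) ↔ K.foot e = b := by
      rw [mem_branchesAt]
      exact ⟨fun h => h.2, fun h => ⟨Or.inr h, h⟩⟩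
    simp only [this]
    rfl

theorem Valid.star_right (hK : K.Valid) (h : K.graph.Adj a b) :
    K.star b = K.slope b a ::ₘ (K.branchesAt a b).val.map (K.branchVec a b) :=
  star_eq_cons h fun _ _ hbw => hK.slope_of_not_adj _ _ fun haw => hK.not_adj_both h haw hbw

theorem branches_comm : K.branches b a = K.branches a b := by
  ext i
  rw [mem_branches, mem_branches]
  cases i with
  | inl u => simp only [IsBranch, Nbr]; tauto
  | inr e => simp only [IsBranch]; tauto

theorem branchVec_comm : K.branchVec b a = K.branchVec a b := by
  funext i
  cases i with
  | inl u => exact add_comm _ _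
  | inr e => rfl

open Classical in
theorem Valid.branches_sdiff (hK : K.Valid) (h : K.graph.Adj a b) :
    K.branches a b \ K.branchesAt a b = K.branchesAt b a := by
  ext i
  rw [Finset.mem_sdiff, mem_branchesAt, mem_branchesAt, ← mem_branches, ← mem_branches,
    branches_comm, mem_branches]
  cases i with
  | inl u =>
    have := fun h1 h2 => hK.not_adj_both h (u := u) h1 h2
    simp only [IsBranch, Nbr, IsBranchAt]; tauto
  | inr e =>
    have := h.ne
    simp only [IsBranch, IsBranchAt]; grind

/-- The branches at an edge have zero sum. -/
theorem Valid.sum_branchVec (hK : K.Valid) (h : K.graph.Adj a b) :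
    ∑ i ∈ K.branches a b, K.branchVec a b i = 0 := by
  classical
  have h1 := hK.sum_star b
  have h2 := hK.sum_star a
  rw [hK.star_right h, Multiset.sum_cons, Finset.sum_map_val] at h1
  rw [hK.star_right h.symm, Multiset.sum_cons, Finset.sum_map_val, branchVec_comm,
    ← hK.branches_sdiff h] at h2
  rw [← Finset.sum_sdiff K.branchesAt_subset]
  rw [hK.slope_symm b a] at h2
  rw [← add_zero (0 : ℤ × ℤ)]
  nth_rewrite 1 [← h2]
  rw [← h1]
  abel

open Classical in
theorem attach_branchesAt_inl {u : Fin V} (hu : K.Nbr a b u) :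
    attach a b (K.branchesAt a b) (.inl u) = if K.graph.Adj b u then b else a := by
  classical
  have : .inl u ∈ K.branchesAt a b ↔ K.graph.Adj b u := by
    rw [mem_branchesAt]; exact ⟨fun h => h.2, fun h => ⟨hu, h⟩⟩
  simp only [attach, this]

open Classical in
theorem Valid.reattach_branchesAt_adj (hK : K.Valid) (h : K.graph.Adj a b) (x y : Fin V) :
    (K.reattach h.ne (K.branchesAt a b)).graph.Adj x y ↔ K.graph.Adj x y := by
  have hne := h.ne
  have hnot := fun u => hK.not_adj_both h (u := u)
  rw [reattach_adj]
  have hx : K.Nbr a b x → attach a b (K.branchesAt a b) (.inl x) =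
    if K.graph.Adj b x then b else a := attach_branchesAt_inl
  have hy : K.Nbr a b y → attach a b (K.branchesAt a b) (.inl y) =
    if K.graph.Adj b y then b else a := attach_branchesAt_inl
  have hxn : K.Nbr a b x ↔ x ≠ a ∧ x ≠ b ∧ (K.graph.Adj a x ∨ K.graph.Adj b x) := Iff.rfl
  have hyn : K.Nbr a b y ↔ y ≠ a ∧ y ≠ b ∧ (K.graph.Adj a y ∨ K.graph.Adj b y) := Iff.rfl
  have := hnot x
  have := hnot y
  have := h.symm
  have := K.graph.adj_comm x y
  have := K.graph.irrefl (v := a)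
  have := K.graph.irrefl (v := b)
  grind

theorem Valid.sum_branchesAt (hK : K.Valid) (h : K.graph.Adj a b) :
    ∑ i ∈ K.branchesAt a b, K.branchVec a b i = K.slope a b := by
  have h1 := hK.sum_star b
  rw [hK.star_right h, Multiset.sum_cons, Finset.sum_map_val, hK.slope_symm a b] at h1
  rwa [neg_add_eq_zero, eq_comm] at h1

open Classical in
theorem Valid.reattach_branchesAt_slope (hK : K.Valid) (h : K.graph.Adj a b) (x y : Fin V) :
    (K.reattach h.ne (K.branchesAt a b)).slope x y = K.slope x y := by
  have hne := h.ne
  have hnot := fun u => hK.not_adj_both h (u := u)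
  have hsum := hK.sum_branchesAt h
  rw [reattach_slope, hsum]
  have hx : K.Nbr a b x → attach a b (K.branchesAt a b) (.inl x) =
    if K.graph.Adj b x then b else a := attach_branchesAt_inl
  have hy : K.Nbr a b y → attach a b (K.branchesAt a b) (.inl y) =
    if K.graph.Adj b y then b else a := attach_branchesAt_inl
  have hxn : K.Nbr a b x ↔ x ≠ a ∧ x ≠ b ∧ (K.graph.Adj a x ∨ K.graph.Adj b x) := Iff.rfl
  have hyn : K.Nbr a b y ↔ y ≠ a ∧ y ≠ b ∧ (K.graph.Adj a y ∨ K.graph.Adj b y) := Iff.rfl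
  have e1 := hK.slope_symm a b
  have e2 := hK.slope_self a
  have e3 := hK.slope_self b
  have e4 := hK.slope_of_not_adj a y
  have e5 := hK.slope_of_not_adj b y
  have e6 := hK.slope_of_not_adj a x
  have e7 := hK.slope_of_not_adj b x
  have e8 := hK.slope_symm a x
  have e9 := hK.slope_symm b x
  have f1 : K.branchVec a b (.inl x) = K.slope a x + K.slope b x := rfl
  have f2 : K.branchVec a b (.inl y) = K.slope a y + K.slope b y := rfl
  split_ifs with h1 h2 h3 h4 h5
  · rw [h1.1, h1.2]
  · rw [h2.1, h2.2, e1]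
  · obtain ⟨hn, rfl⟩ := h3
    rw [f1, hx hn]
    split_ifs with hb
    · rw [e9, e6 (fun ha => hnot _ ha hb), zero_add]
    · rw [e8, e7 hb, add_zero]
  · obtain ⟨hn, rfl⟩ := h4
    rw [f2, hy hn]
    split_ifs with hb
    · rw [e4 (fun ha => hnot _ ha hb), zero_add]
    · rw [e5 hb, add_zero]
  · rfl
  · symm
    refine hK.slope_of_not_adj x y fun hxy => ?_
    rcases (K.reattach_adj h.ne _).1 ((hK.reattach_branchesAt_adj h x y).2 hxy) with
      h | h | h | h | h
    exacts [h1 h, h2 h, h3 h, h4 h, h5 ⟨h.1, h.2.1⟩]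

/-- A type is recovered from its branches at an edge. -/
theorem Valid.reattach_branchesAt (hK : K.Valid) (h : K.graph.Adj a b) :
    K.reattach h.ne (K.branchesAt a b) = K := by
  classical
  ext1
  · ext x y
    exact hK.reattach_branchesAt_adj h x y
  · funext e
    have : .inr e ∈ K.branchesAt a b ↔ K.foot e = b := by
      rw [mem_branchesAt]; exact ⟨fun h => h.2, fun h => ⟨Or.inr h, h⟩⟩
    simp only [reattach, attach, this]
    grind
  · rfl
  · funext x y
    exact hK.reattach_branchesAt_slope h x y
  · rfl

end Shape

/-! ### Edges, slopes and stars after sliding -/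

namespace Shape

variable {n V E : ℕ} {K : Shape n V E} {a b : Fin V} {S : Finset (Fin V ⊕ Fin E)}

theorem attach_eq_right_iff (hab : a ≠ b) {i : Fin V ⊕ Fin E} : attach a b S i = b ↔ i ∈ S := by
  unfold attach; split_ifs with h <;> simp [h, hab]

theorem attach_eq_left_iff (hab : a ≠ b) {i : Fin V ⊕ Fin E} : attach a b S i = a ↔ i ∉ S := by
  unfold attach; split_ifs with h <;> simp [h, hab.symm]

theorem not_nbr_left : ¬ K.Nbr a b a := fun h => h.1 rfl

theorem not_nbr_right : ¬ K.Nbr a b b := fun h => h.2.1 rfl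

theorem reattach_adj_left (hab : a ≠ b) {w : Fin V} (hw : w ≠ b) :
    (K.reattach hab S).graph.Adj a w ↔ K.Nbr a b w ∧ .inl w ∉ S := by
  rw [reattach_adj]
  have h1 := not_nbr_left (K := K) (a := a) (b := b)
  have h2 := attach_eq_left_iff hab (S := S) (i := .inl w)
  constructor
  · rintro (h | h | h | h | h)
    · exact absurd h.2 hw
    · exact absurd h.1 hab
    · exact absurd h.1 h1
    · exact ⟨h.1, h2.1 h.2.symm⟩
    · exact absurd rfl h.1.1
  · rintro ⟨h3, h4⟩
    exact Or.inr (Or.inr (Or.inr (Or.inl ⟨h3, (h2.2 h4).symm⟩)))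

theorem reattach_adj_right (hab : a ≠ b) {w : Fin V} (hw : w ≠ a) :
    (K.reattach hab S).graph.Adj b w ↔ K.Nbr a b w ∧ .inl w ∈ S := by
  rw [reattach_adj]
  have h1 := not_nbr_right (K := K) (a := a) (b := b)
  have h2 := attach_eq_right_iff hab (S := S) (i := .inl w)
  constructor
  · rintro (h | h | h | h | h)
    · exact absurd h.1 hab.symm
    · exact absurd h.2 hw
    · exact absurd h.1 h1
    · exact ⟨h.1, h2.1 h.2.symm⟩
    · exact absurd rfl h.1.2
  · rintro ⟨h3, h4⟩
    exact Or.inr (Or.inr (Or.inr (Or.inl ⟨h3, (h2.2 h4).symm⟩)))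

theorem reattach_adj_edge (hab : a ≠ b) : (K.reattach hab S).graph.Adj a b :=
  Or.inl ⟨rfl, rfl⟩

theorem reattach_adj_off (hab : a ≠ b) {x y : Fin V} (hx : x ≠ a ∧ x ≠ b) (hy : y ≠ a ∧ y ≠ b) :
    (K.reattach hab S).graph.Adj x y ↔ K.graph.Adj x y := by
  rw [reattach_adj]
  have h1 := attach_eq_or (a := a) (b := b) S (.inl x)
  have h2 := attach_eq_or (a := a) (b := b) S (.inl y)
  grind

theorem reattach_slope_edge (hab : a ≠ b) :
    (K.reattach hab S).slope a b = ∑ i ∈ S, K.branchVec a b i := by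
  rw [reattach_slope, if_pos ⟨rfl, rfl⟩]

theorem reattach_slope_edge' (hab : a ≠ b) :
    (K.reattach hab S).slope b a = -∑ i ∈ S, K.branchVec a b i := by
  rw [reattach_slope, if_neg fun h => hab h.2, if_pos ⟨rfl, rfl⟩]

theorem reattach_slope_off (hab : a ≠ b) {x y : Fin V} (hx : x ≠ a ∧ x ≠ b)
    (hy : y ≠ a ∧ y ≠ b) : (K.reattach hab S).slope x y = K.slope x y := by
  have h1 := attach_eq_or (a := a) (b := b) S (.inl x)
  have h2 := attach_eq_or (a := a) (b := b) S (.inl y)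
  rw [reattach_slope, if_neg, if_neg, if_neg, if_neg, if_pos ⟨hx, hy⟩] <;> grind

open Classical in
theorem reattach_slope_left (hab : a ≠ b) {w : Fin V} (hw : w ≠ b) :
    (K.reattach hab S).slope a w =
      if K.Nbr a b w ∧ .inl w ∉ S then K.branchVec a b (.inl w) else 0 := by
  rw [reattach_slope, if_neg fun h => hw h.2, if_neg fun h => hab h.1,
    if_neg fun h => not_nbr_left h.1]
  have h2 : a = attach a b S (.inl w) ↔ .inl w ∉ S := by rw [eq_comm, attach_eq_left_iff hab]
  simp [h2]

open Classical in
theorem reattach_slope_right (hab : a ≠ b) {w : Fin V} (hw : w ≠ a) :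
    (K.reattach hab S).slope b w =
      if K.Nbr a b w ∧ .inl w ∈ S then K.branchVec a b (.inl w) else 0 := by
  rw [reattach_slope, if_neg fun h => hab h.1.symm, if_neg fun h => hw h.2,
    if_neg fun h => not_nbr_right h.1]
  have h2 : b = attach a b S (.inl w) ↔ .inl w ∈ S := by rw [eq_comm, attach_eq_right_iff hab]
  simp [h2]

theorem reattach_slope_symm (hK : K.Valid) (hab : a ≠ b) (x y : Fin V) :
    (K.reattach hab S).slope y x = -(K.reattach hab S).slope x y := by
  have h1 := attach_eq_or (a := a) (b := b) S (.inl x)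
  have h2 := attach_eq_or (a := a) (b := b) S (.inl y)
  have hx : K.Nbr a b x → x ≠ a ∧ x ≠ b := fun h => ⟨h.1, h.2.1⟩
  have hy : K.Nbr a b y → y ≠ a ∧ y ≠ b := fun h => ⟨h.1, h.2.1⟩
  have := hK.slope_symm x y
  rw [reattach_slope, reattach_slope]
  split_ifs <;> grind

theorem reattach_slope_of_not_adj (hK : K.Valid) (hab : a ≠ b) (x y : Fin V)
    (h : ¬ (K.reattach hab S).graph.Adj x y) : (K.reattach hab S).slope x y = 0 := by
  rw [reattach_adj] at h
  rw [reattach_slope]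
  split_ifs with h1 h2 h3 h4 h5
  · exact absurd (Or.inl h1) h
  · exact absurd (Or.inr (Or.inl h2)) h
  · exact absurd (Or.inr (Or.inr (Or.inl h3))) h
  · exact absurd (Or.inr (Or.inr (Or.inr (Or.inl h4)))) h
  · exact hK.slope_of_not_adj x y fun hxy =>
      h (Or.inr (Or.inr (Or.inr (Or.inr ⟨h5.1, h5.2, hxy⟩))))
  · rfl

/-- The distribution can be read off from the result, so the sets `S` parametrize the types around a
wall injectively. -/
theorem branchesAt_reattach (hab : a ≠ b) (hS : S ⊆ K.branches a b) :
    (K.reattach hab S).branchesAt a b = S := by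
  ext i
  rw [mem_branchesAt, reattach_isBranch]
  have hi : i ∈ S → K.IsBranch a b i := fun h => (K.mem_branches a b).1 (hS h)
  cases i with
  | inl u =>
    constructor
    · rintro ⟨h1, h2⟩
      exact ((reattach_adj_right hab (show u ≠ a from h1.1)).1 h2).2
    · intro h
      exact ⟨hi h, (reattach_adj_right hab (show u ≠ a from (hi h).1)).2 ⟨hi h, h⟩⟩
  | inr e =>
    constructor
    · rintro ⟨h1, h2⟩
      have h1' : K.foot e = a ∨ K.foot e = b := h1
      simp only [IsBranchAt, reattach, if_pos h1'] at h2
      exact (attach_eq_right_iff hab).1 h2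
    · intro h
      have h1' : K.foot e = a ∨ K.foot e = b := hi h
      refine ⟨hi h, ?_⟩
      simp only [IsBranchAt, reattach, if_pos h1']
      exact (attach_eq_right_iff hab).2 h

open Classical in
theorem branchesAt_reattach' (hab : a ≠ b) :
    (K.reattach hab S).branchesAt b a = K.branches a b \ S := by
  ext i
  rw [mem_branchesAt, ← mem_branches, branches_comm, mem_branches, reattach_isBranch,
    Finset.mem_sdiff, mem_branches]
  refine and_congr_right fun hi => ?_
  cases i with
  | inl u =>
    have hu : K.Nbr a b u := hi
    rw [show (K.reattach hab S).IsBranchAt a (.inl u) ↔ _ from reattach_adj_left hab hu.2.1]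
    exact ⟨fun h => h.2, fun h => ⟨hu, h⟩⟩
  | inr e =>
    have h1' : K.foot e = a ∨ K.foot e = b := hi
    simp only [IsBranchAt, reattach, if_pos h1']
    exact attach_eq_left_iff hab

theorem star_reattach_right (hab : a ≠ b) (hS : S ⊆ K.branches a b) :
    (K.reattach hab S).star b =
      (-∑ i ∈ S, K.branchVec a b i) ::ₘ S.val.map (K.branchVec a b) := by
  rw [star_eq_cons (a := a) (reattach_adj_edge hab), branchesAt_reattach hab hS,
    reattach_slope_edge']
  · congr 1
    exact Multiset.map_congr rfl fun i hi =>
      K.reattach_branchVec hab S ((K.mem_branches a b).1 (hS hi))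
  · intro w hwa hw
    rw [reattach_adj_right hab hwa] at hw
    rw [reattach_slope_left hab hw.1.2.1, if_neg fun h => h.2 hw.2]

open Classical in
theorem star_reattach_left (hab : a ≠ b) :
    (K.reattach hab S).star a =
      (∑ i ∈ S, K.branchVec a b i) ::ₘ (K.branches a b \ S).val.map (K.branchVec a b) := by
  rw [star_eq_cons (a := b) (reattach_adj_edge hab).symm, branchesAt_reattach' hab,
    reattach_slope_edge,
    branchVec_comm (K := K.reattach hab S) (a := a) (b := b)]
  · congr 1
    exact Multiset.map_congr rfl fun i hi =>
      K.reattach_branchVec hab S ((K.mem_branches a b).1 (Finset.mem_sdiff.1 hi).1)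
  · intro w hwb hw
    rw [reattach_adj_left hab hwb] at hw
    rw [reattach_slope_right hab hw.1.1, if_neg fun h => hw.2 h.2]

open Classical in
-- At a vertex off the edge, at most the name of one neighbour changes between `a` and `b`; the
-- vector along that edge stays the same.
theorem star_reattach_off (hK : K.Valid) (h : K.graph.Adj a b) {x : Fin V}
    (hx : x ≠ a ∧ x ≠ b) : (K.reattach h.ne S).star x = K.star x := by
  have hab := h.ne
  rw [star, star]
  congr 1
  · rw [← Finset.add_sum_erase _ _ (Finset.mem_univ a),
      ← Finset.add_sum_erase _ _ (Finset.mem_erase.2 ⟨hab.symm, Finset.mem_univ b⟩),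
      ← Finset.add_sum_erase Finset.univ _ (Finset.mem_univ a),
      ← Finset.add_sum_erase _ _ (Finset.mem_erase.2 ⟨hab.symm, Finset.mem_univ b⟩),
      ← add_assoc, ← add_assoc]
    congr 1
    · rw [(K.reattach hab S).graph.adj_comm x a, (K.reattach hab S).graph.adj_comm x b,
        K.graph.adj_comm x a, K.graph.adj_comm x b, reattach_slope_symm hK hab a x,
        reattach_slope_symm hK hab b x, hK.slope_symm a x, hK.slope_symm b x]
      rw [reattach_slope_left hab hx.2, reattach_slope_right hab hx.1]
      simp only [reattach_adj_left hab hx.2, reattach_adj_right hab hx.1]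
      have hn : K.Nbr a b x ↔ (K.graph.Adj a x ∨ K.graph.Adj b x) := by
        simp [Nbr, hx]
      have hv : K.branchVec a b (.inl x) = K.slope a x + K.slope b x := rfl
      have e1 := hK.slope_of_not_adj a x
      have e2 := hK.slope_of_not_adj b x
      have e3 := hK.not_adj_both h (u := x)
      by_cases ha : K.graph.Adj a x
      · have hb : ¬ K.graph.Adj b x := fun hb => e3 ha hb
        by_cases hxS : Sum.inl x ∈ S <;> simp [hn, ha, hb, hxS, hv, e2 hb]
      · by_cases hb : K.graph.Adj b x
        · by_cases hxS : Sum.inl x ∈ S <;> simp [hn, ha, hb, hxS, hv, e1 ha]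
        · simp [hn, ha, hb]
    · refine Finset.sum_congr rfl fun w hw => ?_
      have hw' : w ≠ a ∧ w ≠ b := by simp at hw; tauto
      simp only [reattach_adj_off hab hx hw', reattach_slope_off hab hx hw']
  · refine Finset.sum_congr rfl fun e _ => ?_
    have : (K.reattach hab S).foot e = x ↔ K.foot e = x := by
      have h1 := attach_eq_or (a := a) (b := b) S (.inr e)
      simp only [reattach]
      grind
    simp only [this]
    rfl

end Shape

/-! ### Branch indicators; sliding yields a valid type -/

namespace Shape

variable {n V E : ℕ} {K : Shape n V E} {a b : Fin V} {S : Finset (Fin V ⊕ Fin E)}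

/-- The indicator functions of the branches at the edge `ab`. -/
structure IsBranchCut (K : Shape n V E) (a b : Fin V) (χ : Fin V ⊕ Fin E → Fin V → ℤ) : Prop where
  left : ∀ i, χ i a = 0
  right : ∀ i, χ i b = 0
  eq_of_adj : ∀ i x y, (x ≠ a ∧ x ≠ b) → (y ≠ a ∧ y ≠ b) → K.graph.Adj x y → χ i x = χ i y
  nbr : ∀ i u, K.Nbr a b u → χ i u = if i = .inl u then 1 else 0
  sum_eq_one : ∀ x, x ≠ a ∧ x ≠ b → ∑ i ∈ K.branches a b, χ i x = 1

/-- For a neighbour `u` of the edge use the cut at the edge leading to `u`. An end contains no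
finite vertex and gets the zero function. -/
theorem Valid.exists_isBranchCut (hK : K.Valid) (h : K.graph.Adj a b) :
    ∃ χ, K.IsBranchCut a b χ := by
  classical
  have key : ∀ i : Fin V ⊕ Fin E, ∃ χ : Fin V → ℤ, χ a = 0 ∧ χ b = 0 ∧
      (∀ x y, (x ≠ a ∧ x ≠ b) → (y ≠ a ∧ y ≠ b) → K.graph.Adj x y → χ x = χ y) ∧
      (∀ u, K.Nbr a b u → χ u = if i = .inl u then 1 else 0) := by
    intro i
    by_cases hi : ∃ u, K.Nbr a b u ∧ i = .inl u
    · obtain ⟨u, hu, rfl⟩ := hi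
      obtain ⟨c, hc, hcu⟩ : ∃ c, (c = a ∨ c = b) ∧ K.graph.Adj c u := by
        rcases hu.2.2 with h1 | h1
        exacts [⟨a, Or.inl rfl, h1⟩, ⟨b, Or.inr rfl, h1⟩]
      obtain ⟨χ, hχ⟩ := exists_isCut_of_isAcyclic hK.isTree.2 hcu
      have hu1 := hu.1
      have hu2 := hu.2.1
      have e1 : χ a = χ b := hχ.eq_of_adj a b h (by rw [Ne, Sym2.eq_iff]; grind)
      have e2 : χ a = 0 := by
        rcases hc with rfl | rfl
        · exact hχ.left
        · rw [e1]; exact hχ.left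
      refine ⟨χ, e2, e1 ▸ e2, fun x y hx hy hxy => ?_, fun u' hu' => ?_⟩
      · exact hχ.eq_of_adj x y hxy (by rw [Ne, Sym2.eq_iff]; grind)
      · by_cases huu : u = u'
        · subst huu; simp [hχ.right]
        · rw [if_neg fun h => huu (Sum.inl_injective h)]
          have hu1' := hu'.1
          have hu2' := hu'.2.1
          rcases hu'.2.2 with h1 | h1
          · rw [← hχ.eq_of_adj _ _ h1 (by rw [Ne, Sym2.eq_iff]; grind), e2]
          · rw [← hχ.eq_of_adj _ _ h1 (by rw [Ne, Sym2.eq_iff]; grind), ← e1, e2]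
    · refine ⟨fun _ => 0, rfl, rfl, fun _ _ _ _ _ => rfl, fun u hu => ?_⟩
      rw [if_neg fun h => hi ⟨u, hu, h⟩]
  choose χ h1 h2 h3 h4 using key
  refine ⟨χ, h1, h2, h3, h4, fun x hx => ?_⟩
  -- With the value `1` at `a` and `b`, the sum of the indicators is constant along all edges, hence
  -- on the whole tree.
  let f : Fin V → ℤ := fun x => if x = a ∨ x = b then 1 else ∑ i ∈ K.branches a b, χ i x
  have hnbr : ∀ u, K.Nbr a b u → f u = 1 := by
    intro u hu
    have : ¬ (u = a ∨ u = b) := fun h => h.elim hu.1 hu.2.1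
    simp only [f, if_neg this, h4 _ u hu]
    rw [Finset.sum_ite_eq', if_pos ((K.mem_branches a b (i := .inl u)).2 hu)]
  have hf : ∀ v w, K.graph.Adj v w → f v = f w := by
    have hfab : ∀ v, (v = a ∨ v = b) → f v = 1 := fun v hv => if_pos hv
    intro v w hvw
    by_cases hv : v = a ∨ v = b
    · rw [hfab v hv]
      by_cases hw : w = a ∨ w = b
      · rw [hfab w hw]
      · rw [hnbr w ⟨fun h => hw (Or.inl h), fun h => hw (Or.inr h), by
          rcases hv with rfl | rfl
          exacts [Or.inl hvw, Or.inr hvw]⟩]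
    · by_cases hw : w = a ∨ w = b
      · rw [hfab w hw, hnbr v ⟨fun h => hv (Or.inl h), fun h => hv (Or.inr h), by
          rcases hw with rfl | rfl
          exacts [Or.inl hvw.symm, Or.inr hvw.symm]⟩]
      · simp only [f, if_neg hv, if_neg hw]
        refine Finset.sum_congr rfl fun i _ => h3 i v w ?_ ?_ hvw <;> tauto
  have := eq_of_reachable hf (hK.isTree.1.preconnected x a)
  have hx' : ¬ (x = a ∨ x = b) := by tauto
  simpa [f, hx'] using this

/-- The indicator function of the side of `b` after attaching the branches `S` to `b`. -/
theorem IsBranchCut.isCut_edge {χ : Fin V ⊕ Fin E → Fin V → ℤ} (hχ : K.IsBranchCut a b χ)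
    (hab : a ≠ b) :
    IsCut (K.reattach hab S).graph a b fun x => ∑ i ∈ S, χ i x + if x = b then 1 else 0 := by
  classical
  refine ⟨by simp [hχ.left, hab], by simp [hχ.right], fun v w hvw hne => ?_⟩
  have hn : ∀ u, K.Nbr a b u → ∑ i ∈ S, χ i u + (if u = b then 1 else 0) =
      ∑ i ∈ S, χ i (attach a b S (.inl u)) + if attach a b S (.inl u) = b then 1 else 0 := by
    intro u hu
    have h0 : ∑ i ∈ S, χ i (attach a b S (.inl u)) = 0 := by
      refine Finset.sum_eq_zero fun i _ => ?_
      rcases attach_eq_or (a := a) (b := b) S (.inl u) with h | h <;> rw [h]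
      exacts [hχ.left i, hχ.right i]
    rw [h0, Finset.sum_congr rfl fun i _ => hχ.nbr i u hu, Finset.sum_ite_eq', if_neg hu.2.1]
    simp only [attach_eq_right_iff hab, add_zero, zero_add]
  rcases (K.reattach_adj hab S).1 hvw with h | h | h | h | h
  · exact absurd (by rw [h.1, h.2]) hne
  · exact absurd (by rw [h.1, h.2, Sym2.eq_swap]) hne
  · rw [h.2]; exact hn v h.1
  · rw [h.2]; exact (hn w h.1).symm
  · rw [if_neg h.1.2, if_neg h.2.1.2, Finset.sum_congr rfl fun i _ =>
      hχ.eq_of_adj i v w h.1 h.2.1 h.2.2]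

theorem IsBranchCut.isCut_branch {χ : Fin V ⊕ Fin E → Fin V → ℤ} (hχ : K.IsBranchCut a b χ)
    (hab : a ≠ b) {u : Fin V} (hu : K.Nbr a b u) :
    IsCut (K.reattach hab S).graph (attach a b S (.inl u)) u (χ (.inl u)) := by
  have h0 : ∀ j, χ (.inl u) (attach a b S j) = 0 := by
    intro j
    rcases attach_eq_or (a := a) (b := b) S j with h | h <;> rw [h]
    exacts [hχ.left _, hχ.right _]
  have hn : ∀ w, K.Nbr a b w → w ≠ u → χ (.inl u) w = 0 := by
    intro w hw hne
    rw [hχ.nbr _ w hw, if_neg fun h => hne (Sum.inl_injective h).symm]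
  refine ⟨h0 _, by rw [hχ.nbr _ u hu, if_pos rfl], fun v w hvw hne => ?_⟩
  rcases (K.reattach_adj hab S).1 hvw with h | h | h | h | h
  · rw [h.1, h.2, hχ.left, hχ.right]
  · rw [h.1, h.2, hχ.left, hχ.right]
  · rw [h.2, h0]
    exact hn v h.1 fun e => hne (by rw [h.2, e, Sym2.eq_swap])
  · rw [h.2, h0]
    exact (hn w h.1 fun e => hne (by rw [h.2, e])).symm
  · exact hχ.eq_of_adj _ v w h.1 h.2.1 h.2.2

/-- Connectedness holds since the ends of every old edge remain joined, if necessary through `ab`.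
Acyclicity is shown by a cut for each edge: the indicators of the branches in `S`, with `b` added,
for `ab`; a single branch indicator for an edge leading to a branch; the old cut for any other edge.
-/
theorem Valid.isTree_reattach (hK : K.Valid) (h : K.graph.Adj a b) :
    (K.reattach h.ne S).graph.IsTree := by
  have hab := h.ne
  obtain ⟨χ, hχ⟩ := hK.exists_isBranchCut h
  constructor
  · have : Nonempty (Fin V) := ⟨a⟩
    refine SimpleGraph.Connected.mk fun v w => ?_
    rw [← SimpleGraph.ConnectedComponent.eq]
    refine eq_of_reachable (G := K.graph) (fun x y hxy => ?_) (hK.isTree.1.preconnected v w)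
    rw [SimpleGraph.ConnectedComponent.eq]
    have hedge : (K.reattach hab S).graph.Reachable a b := (reattach_adj_edge hab).reachable
    have hc : ∀ c d, (c = a ∨ c = b) → (d = a ∨ d = b) →
        (K.reattach hab S).graph.Reachable c d := by
      rintro c d (rfl | rfl) (rfl | rfl)
      exacts [SimpleGraph.Reachable.refl _, hedge, hedge.symm, SimpleGraph.Reachable.refl _]
    have hn : ∀ c u, (c = a ∨ c = b) → K.Nbr a b u →
        (K.reattach hab S).graph.Reachable c u := by
      intro c u hc' hu
      refine (hc c _ hc' (attach_eq_or S (.inl u))).trans (SimpleGraph.Adj.reachable ?_)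
      exact Or.inr (Or.inr (Or.inr (Or.inl ⟨hu, rfl⟩)))
    by_cases hx : x = a ∨ x = b
    · by_cases hy : y = a ∨ y = b
      · exact hc x y hx hy
      · refine hn x y hx ⟨fun h => hy (Or.inl h), fun h => hy (Or.inr h), ?_⟩
        rcases hx with rfl | rfl
        exacts [Or.inl hxy, Or.inr hxy]
    · by_cases hy : y = a ∨ y = b
      · refine (hn y x hy ⟨fun h => hx (Or.inl h), fun h => hx (Or.inr h), ?_⟩).symm
        rcases hy with rfl | rfl
        exacts [Or.inl hxy.symm, Or.inr hxy.symm]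
      · exact SimpleGraph.Adj.reachable ((reattach_adj_off hab (by tauto) (by tauto)).2 hxy)
  · refine isAcyclic_of_exists_isCut fun p q hpq => ?_
    rcases (K.reattach_adj hab S).1 hpq with h1 | h1 | h1 | h1 | h1
    · obtain ⟨rfl, rfl⟩ := h1
      exact ⟨_, hχ.isCut_edge hab⟩
    · obtain ⟨rfl, rfl⟩ := h1
      exact ⟨_, (hχ.isCut_edge hab).symm⟩
    · obtain ⟨hn, rfl⟩ := h1
      exact ⟨_, (hχ.isCut_branch hab hn).symm⟩
    · obtain ⟨hn, rfl⟩ := h1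
      exact ⟨_, hχ.isCut_branch hab hn⟩
    · obtain ⟨hp, hq, hpq'⟩ := h1
      obtain ⟨ψ, hψ⟩ := exists_isCut_of_isAcyclic hK.isTree.2 hpq'
      have e1 : ψ a = ψ b := hψ.eq_of_adj a b h (by rw [Ne, Sym2.eq_iff]; grind)
      have hn : ∀ u, K.Nbr a b u → ψ u = ψ (attach a b S (.inl u)) := by
        intro u hu
        have : ψ u = ψ a := by
          rcases hu.2.2 with h2 | h2
          · exact (hψ.eq_of_adj _ _ h2 (by rw [Ne, Sym2.eq_iff]; grind)).symm
          · rw [e1]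
            exact (hψ.eq_of_adj _ _ h2 (by rw [Ne, Sym2.eq_iff]; grind)).symm
        rw [this]
        rcases attach_eq_or (a := a) (b := b) S (.inl u) with h2 | h2 <;> rw [h2]
        exact e1
      refine ⟨ψ, hψ.left, hψ.right, fun v w hvw hne => ?_⟩
      rcases (K.reattach_adj hab S).1 hvw with h2 | h2 | h2 | h2 | h2
      · rw [h2.1, h2.2, e1]
      · rw [h2.1, h2.2, e1]
      · rw [h2.2]; exact hn v h2.1
      · rw [h2.2]; exact (hn w h2.1).symm
      · exact hψ.eq_of_adj v w h2.2.2 hne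

/-- Sliding branches preserves the valencies if it preserves their number at `b`. -/
theorem Valid.card_star_reattach (hK : K.Valid) (h : K.graph.Adj a b) (hS : S ⊆ K.branches a b)
    (hcard : S.card = (K.branchesAt a b).card) (v : Fin V) :
    Multiset.card ((K.reattach h.ne S).star v) = Multiset.card (K.star v) := by
  classical
  have hself := hK.reattach_branchesAt h
  by_cases hvb : v = b
  · subst hvb
    conv_rhs => rw [← hself]
    rw [star_reattach_right h.ne hS, star_reattach_right h.ne K.branchesAt_subset]
    simp [hcard]
  by_cases hva : v = a
  · subst hva
    conv_rhs => rw [← hself]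
    rw [star_reattach_left h.ne, star_reattach_left h.ne]
    rw [Multiset.card_cons, Multiset.card_cons, Multiset.card_map, Multiset.card_map,
      Finset.card_val, Finset.card_val, Finset.card_sdiff_of_subset hS,
      Finset.card_sdiff_of_subset K.branchesAt_subset, hcard]
  · rw [star_reattach_off hK h ⟨hva, hvb⟩]

theorem Valid.reattach (hK : K.Valid) (h : K.graph.Adj a b) (hS : S ⊆ K.branches a b)
    (hcard : S.card = (K.branchesAt a b).card) : (K.reattach h.ne S).Valid := by
  classical
  refine ⟨hK.isTree_reattach h, hK.mark_injective, fun v => ?_, fun v hv => ?_,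
    reattach_slope_symm hK h.ne, reattach_slope_of_not_adj hK h.ne, hK.dir_ne_zero, fun v => ?_⟩
  · rw [hK.card_star_reattach h hS hcard]; exact hK.two_le v
  · rw [hK.card_star_reattach h hS hcard]; exact hK.three_le v hv
  · by_cases hvb : v = b
    · subst hvb
      rw [star_reattach_right h.ne hS, Multiset.sum_cons, Finset.sum_map_val, neg_add_cancel]
    by_cases hva : v = a
    · subst hva
      rw [star_reattach_left h.ne, Multiset.sum_cons, Finset.sum_map_val, add_comm,
        Finset.sum_sdiff hS, hK.sum_branchVec h]
    · rw [star_reattach_off hK h ⟨hva, hvb⟩, hK.sum_star]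

end Shape

/-! ### Moving between the types around a wall -/

theorem exists_eq_mul_wedge (l : ℝ × ℝ →ₗ[ℝ] ℝ) {b : ℤ × ℤ} (hb : b ≠ 0)
    (h : l (toPlane b) = 0) : ∃ d : ℝ, ∀ c : ℤ × ℤ, l (toPlane c) = d * (wedge b c : ℝ) := by
  have hl : ∀ u v : ℝ, l (u, v) = u * l (1, 0) + v * l (0, 1) := by
    intro u v
    have : (u, v) = u • ((1, 0) : ℝ × ℝ) + v • ((0, 1) : ℝ × ℝ) := by simp
    rw [this, map_add, map_smul, map_smul, smul_eq_mul, smul_eq_mul]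
  have hN : (b.1 * b.1 + b.2 * b.2 : ℝ) ≠ 0 := by
    intro h
    have h' : b.1 * b.1 + b.2 * b.2 = 0 := by exact_mod_cast h
    refine hb (Prod.ext ?_ ?_) <;> simp only [Prod.fst_zero, Prod.snd_zero] <;> nlinarith
  -- The constant is forced by evaluating at the quarter turn of `b`, whose area with `b` is the
  -- squared norm of `b`.
  refine ⟨(b.1 * l (0, 1) - b.2 * l (1, 0)) / (b.1 * b.1 + b.2 * b.2), fun c => ?_⟩
  rw [toPlane, hl] at h
  rw [toPlane, hl, wedge]
  push_cast
  rw [div_mul_eq_mul_div, eq_div_iff hN]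
  linear_combination (b.1 * c.1 + b.2 * c.2 : ℝ) * h

namespace Shape

variable {n V E : ℕ} {K : Shape n V E} {a b : Fin V} {S : Finset (Fin V ⊕ Fin E)}

theorem Valid.exists_adj_of_nbr (hK : K.Valid) (h : K.graph.Adj a b) {u : Fin V}
    (hu : K.Nbr a b u) :
    ∃ c, (c = a ∨ c = b) ∧ K.graph.Adj c u ∧ K.slope c u = K.branchVec a b (.inl u) := by
  rcases hu.2.2 with h1 | h1
  · exact ⟨a, Or.inl rfl, h1, by
      simp [branchVec, hK.slope_of_not_adj b u fun h2 => hK.not_adj_both h h1 h2]⟩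
  · exact ⟨b, Or.inr rfl, h1, by
      simp [branchVec, hK.slope_of_not_adj a u fun h2 => hK.not_adj_both h h2 h1]⟩

theorem Good.branchVec_ne_zero (hG : K.Good) (hK : K.Valid) (h : K.graph.Adj a b)
    {i : Fin V ⊕ Fin E} (hi : K.IsBranch a b i) : K.branchVec a b i ≠ 0 := by
  cases i with
  | inl u =>
    obtain ⟨c, -, hc, hs⟩ := hK.exists_adj_of_nbr h hi
    rw [← hs]
    exact hG.slope_ne_zero _ _ hc
  | inr e => exact hK.dir_ne_zero e

/-- The edges other than `ab` have lengths with property `P`. -/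
def EdgesOff (K : Shape n V E) (a b : Fin V) (P : ℝ → Prop) (p : Fin V → ℝ × ℝ) : Prop :=
  ∀ v w, K.graph.Adj v w → s(v, w) ≠ s(a, b) → ∃ t, P t ∧ p w = p v + t • toPlane (K.slope v w)

/-- When `a` and `b` have the same image, a branch does not notice to which of them it is attached.
-/
theorem EdgesOff.reattach {P : ℝ → Prop} {p : Fin V → ℝ × ℝ} (hp : K.EdgesOff a b P p)
    (hK : K.Valid) (h : K.graph.Adj a b) (hpab : p a = p b) :
    (K.reattach h.ne S).EdgesOff a b P p := by
  have hab := h.ne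
  have hc : ∀ c d, (c = a ∨ c = b) → (d = a ∨ d = b) → p c = p d := by
    rintro c d (rfl | rfl) (rfl | rfl) <;> simp [hpab]
  have hn : ∀ u, K.Nbr a b u → ∃ t, P t ∧
      p u = p (attach a b S (.inl u)) + t • toPlane (K.branchVec a b (.inl u)) := by
    intro u hu
    obtain ⟨c, hca, hcu, hs⟩ := hK.exists_adj_of_nbr h hu
    have h1 := hu.1
    have h2 := hu.2.1
    obtain ⟨t, ht, he⟩ := hp c u hcu (by rw [Ne, Sym2.eq_iff]; grind)
    rw [hs, hc c _ hca (attach_eq_or S (.inl u))] at he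
    exact ⟨t, ht, he⟩
  have hslope : ∀ u, K.Nbr a b u →
      (K.reattach hab S).slope (attach a b S (.inl u)) u = K.branchVec a b (.inl u) := by
    intro u hu
    by_cases hS : .inl u ∈ S
    · rw [(attach_eq_right_iff hab).2 hS, reattach_slope_right hab hu.1, if_pos ⟨hu, hS⟩]
    · rw [(attach_eq_left_iff hab).2 hS, reattach_slope_left hab hu.2.1, if_pos ⟨hu, hS⟩]
  intro v w hvw hne
  rcases (K.reattach_adj hab S).1 hvw with h1 | h1 | h1 | h1 | h1
  · exact absurd (by rw [h1.1, h1.2]) hne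
  · exact absurd (by rw [h1.1, h1.2, Sym2.eq_swap]) hne
  · obtain ⟨hv, rfl⟩ := h1
    obtain ⟨t, ht, he⟩ := hn v hv
    refine ⟨t, ht, ?_⟩
    rw [reattach_slope_symm hK hab _ v, hslope v hv, he, toPlane_neg, smul_neg]
    abel
  · obtain ⟨hw, rfl⟩ := h1
    obtain ⟨t, ht, he⟩ := hn w hw
    exact ⟨t, ht, by rw [hslope w hw, he]⟩
  · obtain ⟨t, ht, he⟩ := hp v w h1.2.2 hne
    exact ⟨t, ht, by rw [reattach_slope_off hab h1.1 h1.2.1, he]⟩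

theorem mem_maps_of_edgesOff {P : ℝ → Prop} {p : Fin V → ℝ × ℝ} (hp : K.EdgesOff a b P p)
    (hpab : p a = p b) : p ∈ K.maps := by
  intro v w hvw
  by_cases hne : s(v, w) = s(a, b)
  · refine ⟨0, ?_⟩
    rw [Sym2.eq_iff] at hne
    rcases hne with ⟨rfl, rfl⟩ | ⟨rfl, rfl⟩ <;> simp [hpab]
  · obtain ⟨t, -, ht⟩ := hp v w hvw hne
    exact ⟨t, ht⟩

theorem mem_maps_reattach (hK : K.Valid) (h : K.graph.Adj a b) {p : Fin V → ℝ × ℝ}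
    (hp : p ∈ K.maps) (hpab : p a = p b) : p ∈ (K.reattach h.ne S).maps :=
  mem_maps_of_edgesOff (EdgesOff.reattach (P := fun _ => True)
    (fun v w hvw _ => (hp v w hvw).imp fun _ ht => ⟨trivial, ht⟩) hK h hpab) hpab

/-- Sliding the branches back. -/
theorem Valid.reattach_back (hK : K.Valid) (h : K.graph.Adj a b) :
    (K.reattach h.ne S).reattach h.ne (K.branchesAt a b) = K := by
  rw [reattach_reattach _ _ _ K.branchesAt_subset, hK.reattach_branchesAt h]

theorem mem_maps_of_reattach (hK : K.Valid) (h : K.graph.Adj a b) (hS : S ⊆ K.branches a b)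
    (hcard : S.card = (K.branchesAt a b).card) {p : Fin V → ℝ × ℝ}
    (hp : p ∈ (K.reattach h.ne S).maps) (hpab : p a = p b) : p ∈ K.maps := by
  have := mem_maps_reattach (S := K.branchesAt a b) (hK.reattach h hS hcard)
    (reattach_adj_edge h.ne) hp hpab
  rwa [hK.reattach_back h] at this

/-- The map that moves the branches in `S` and the vertex `b` along the edge `ab`. -/
noncomputable def slide (K : Shape n V E) (a b : Fin V) (χ : Fin V ⊕ Fin E → Fin V → ℤ)
    (S : Finset (Fin V ⊕ Fin E)) : Fin V → ℝ × ℝ := fun x =>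
  ((∑ i ∈ S, χ i x + if x = b then 1 else 0 : ℤ) : ℝ) •
    toPlane (∑ i ∈ S, K.branchVec a b i)

variable {χ : Fin V ⊕ Fin E → Fin V → ℤ}

theorem slide_mem_maps (hK : K.Valid) (h : K.graph.Adj a b) (hS : S ⊆ K.branches a b)
    (hcard : S.card = (K.branchesAt a b).card) (hχ : K.IsBranchCut a b χ) :
    K.slide a b χ S ∈ (K.reattach h.ne S).maps := by
  have := cut_mem_maps (hK.reattach h hS hcard) (hχ.isCut_edge (S := S) h.ne)
  rwa [reattach_slope_edge] at this

theorem slide_left (hab : a ≠ b) (hχ : K.IsBranchCut a b χ) : K.slide a b χ S a = 0 := by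
  simp [slide, hχ.left, hab]

theorem slide_right (hχ : K.IsBranchCut a b χ) :
    K.slide a b χ S b = toPlane (∑ i ∈ S, K.branchVec a b i) := by
  simp [slide, hχ.right]

theorem slide_eq_of_adj (hab : a ≠ b) (hχ : K.IsBranchCut a b χ) {v w : Fin V}
    (hvw : (K.reattach hab S).graph.Adj v w) (hne : s(v, w) ≠ s(a, b)) :
    K.slide a b χ S v = K.slide a b χ S w := by
  have := (hχ.isCut_edge (S := S) hab).eq_of_adj v w hvw hne
  simp only [slide, this]

theorem Good.eq_of_length_eq_zero (hG : K.Good) (h : K.graph.Adj a b) {x : Fin n → ℝ × ℝ}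
    (hx : K.length a b x = 0) : hG.solve x a = hG.solve x b := by
  have := hG.eq_add_len (hG.solve_mem x) h
  rw [← hG.length_apply, hx, zero_smul, add_zero] at this
  exact this.symm

theorem Good.length_eq_zero_of_eq (hG : K.Good) {p : Fin V → ℝ × ℝ} (hp : p ∈ K.maps)
    (hpab : p a = p b) : K.length a b (K.evMap p) = 0 := by
  rw [hG.length_evMap _ _ hp, len_apply, hpab, sub_self, map_zero]

/-- The old and the new type have the same maps with `ab` contracted, and evaluation identifies
these with the hyperplane where the old length vanishes. The new maps are obtained by adding
multiples of the slide, so evaluation remains bijective once the slide is transversal to that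
hyperplane. -/
theorem Good.reattach (hG : K.Good) (hK : K.Valid) (h : K.graph.Adj a b)
    (hS : S ⊆ K.branches a b) (hcard : S.card = (K.branchesAt a b).card)
    (hχ : K.IsBranchCut a b χ) (hκ : K.length a b (K.evMap (K.slide a b χ S)) ≠ 0) :
    (K.reattach h.ne S).Good := by
  have hslide := slide_mem_maps hK h hS hcard hχ
  have hσ : ∑ i ∈ S, K.branchVec a b i ≠ 0 := by
    intro h0
    apply hκ
    have : K.slide a b χ S = 0 := by
      funext x; simp [slide, h0, toPlane_zero]
    rw [this, map_zero, map_zero]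
  refine ⟨fun v w hvw => ?_, fun p hp hp0 => ?_, fun x => ?_⟩
  · rcases (K.reattach_adj h.ne S).1 hvw with h1 | h1 | h1 | h1 | h1
    · rw [h1.1, h1.2, reattach_slope_edge]; exact hσ
    · rw [h1.1, h1.2, reattach_slope_edge', neg_ne_zero]; exact hσ
    · obtain ⟨hv, rfl⟩ := h1
      rw [reattach_slope_symm hK h.ne _ v, neg_ne_zero]
      by_cases hvS : .inl v ∈ S
      · rw [(attach_eq_right_iff h.ne).2 hvS, reattach_slope_right h.ne hv.1, if_pos ⟨hv, hvS⟩]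
        exact hG.branchVec_ne_zero hK h (i := .inl v) hv
      · rw [(attach_eq_left_iff h.ne).2 hvS, reattach_slope_left h.ne hv.2.1, if_pos ⟨hv, hvS⟩]
        exact hG.branchVec_ne_zero hK h (i := .inl v) hv
    · obtain ⟨hv, rfl⟩ := h1
      by_cases hvS : .inl w ∈ S
      · rw [(attach_eq_right_iff h.ne).2 hvS, reattach_slope_right h.ne hv.1, if_pos ⟨hv, hvS⟩]
        exact hG.branchVec_ne_zero hK h (i := .inl w) hv
      · rw [(attach_eq_left_iff h.ne).2 hvS, reattach_slope_left h.ne hv.2.1, if_pos ⟨hv, hvS⟩]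
        exact hG.branchVec_ne_zero hK h (i := .inl w) hv
    · rw [reattach_slope_off h.ne h1.1 h1.2.1]
      exact hG.slope_ne_zero _ _ h1.2.2
  · obtain ⟨t, ht⟩ := hp a b (reattach_adj_edge h.ne)
    rw [reattach_slope_edge] at ht
    have hp' : p - t • K.slide a b χ S ∈ (K.reattach h.ne S).maps :=
      Submodule.sub_mem _ hp (Submodule.smul_mem _ _ hslide)
    have hpab : (p - t • K.slide a b χ S) a = (p - t • K.slide a b χ S) b := by
      simp [slide_left h.ne hχ, slide_right hχ, ht]
    have h1 := mem_maps_of_reattach hK h hS hcard hp' hpab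
    have h2 := hG.length_eq_zero_of_eq h1 hpab
    have hp0' : K.evMap p = 0 := hp0
    rw [map_sub, hp0', map_smul, zero_sub, map_neg, map_smul, neg_eq_zero, smul_eq_mul,
      mul_eq_zero, or_iff_left hκ] at h2
    rw [h2, zero_smul, sub_zero] at h1
    exact hG.injective p h1 hp0'
  · set κ := K.length a b (K.evMap (K.slide a b χ S)) with hκdef
    set t := K.length a b x / κ with ht
    have h0 : K.length a b (x - t • K.evMap (K.slide a b χ S)) = 0 := by
      rw [map_sub, map_smul, ← hκdef, smul_eq_mul, ht, div_mul_cancel₀ _ hκ, sub_self]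
    have hm := mem_maps_reattach (S := S) hK h (hG.solve_mem _) (hG.eq_of_length_eq_zero h h0)
    refine ⟨_, Submodule.add_mem _ hm (Submodule.smul_mem _ t hslide), ?_⟩
    change K.evMap _ = x
    rw [map_add, hG.evMap_solve, map_smul, sub_add_cancel]

/-- The length of the edge `ab` after sliding branches. -/
theorem Good.length_reattach (hG : K.Good) (hK : K.Valid) (h : K.graph.Adj a b)
    (hS : S ⊆ K.branches a b) (hcard : S.card = (K.branchesAt a b).card)
    (hχ : K.IsBranchCut a b χ) (hG' : (K.reattach h.ne S).Good) (y : Fin n → ℝ × ℝ) :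
    K.length a b y =
      K.length a b (K.evMap (K.slide a b χ S)) * (K.reattach h.ne S).length a b y := by
  have hslide := slide_mem_maps hK h hS hcard hχ
  set p := hG'.solve y with hp
  have hpm : p ∈ (K.reattach h.ne S).maps := hG'.solve_mem y
  have hy : K.evMap p = y := hG'.evMap_solve y
  set t := (K.reattach h.ne S).length a b y with ht
  have he := hG'.eq_add_len hpm (reattach_adj_edge h.ne)
  rw [← hG'.length_apply, ← ht, reattach_slope_edge] at he
  -- Subtracting the slide by the full length contracts `ab`, which leads to the common wall; there
  -- the old length is zero.
  have hpab : (p - t • K.slide a b χ S) a = (p - t • K.slide a b χ S) b := by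
    simp [slide_left h.ne hχ, slide_right hχ, he]
  have h1 := mem_maps_of_reattach hK h hS hcard
    (Submodule.sub_mem _ hpm (Submodule.smul_mem _ t hslide)) hpab
  have h2 := hG.length_eq_zero_of_eq h1 hpab
  rw [map_sub, map_smul, map_sub, map_smul, hy, smul_eq_mul, sub_eq_zero] at h2
  rw [h2, mul_comm]

theorem Good.length_slide_ne_zero (hG : K.Good) (hK : K.Valid) (h : K.graph.Adj a b)
    (hS : S ⊆ K.branches a b) (hcard : S.card = (K.branchesAt a b).card)
    (hχ : K.IsBranchCut a b χ) (hG' : (K.reattach h.ne S).Good) :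
    K.length a b (K.evMap (K.slide a b χ S)) ≠ 0 := by
  intro h0
  obtain ⟨y, hy, -⟩ := hG.exists_length_eq hK h
  have := hG.length_reattach hK h hS hcard hχ hG' y
  rw [hy, h0, zero_mul] at this
  exact one_ne_zero this

/-- The point `x` lies on the wall on which only the edge `ab` has length zero. -/
def OnWall (K : Shape n V E) (a b : Fin V) (x : Fin n → ℝ × ℝ) : Prop :=
  K.graph.Adj a b ∧ K.length a b x = 0 ∧
    ∀ v w, K.graph.Adj v w → s(v, w) ≠ s(a, b) → 0 < K.length v w x

theorem OnWall.edgesOff {x : Fin n → ℝ × ℝ} (hx : K.OnWall a b x) (hG : K.Good) :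
    K.EdgesOff a b (fun t => 0 < t) (hG.solve x) := fun v w hvw hne =>
  ⟨K.length v w x, hx.2.2 v w hvw hne, by
    rw [hG.length_apply]; exact hG.eq_add_len (hG.solve_mem x) hvw⟩

/-- The same map, with `ab` contracted, solves the new type, and the lengths of the other edges do
not change under sliding. -/
theorem OnWall.reattach {x : Fin n → ℝ × ℝ} (hx : K.OnWall a b x) (hG : K.Good) (hK : K.Valid)
    (hG' : (K.reattach hx.1.ne S).Good) : (K.reattach hx.1.ne S).OnWall a b x := by
  have hpab := hG.eq_of_length_eq_zero hx.1 hx.2.1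
  have ho := (hx.edgesOff hG).reattach (S := S) hK hx.1 hpab
  have hm := mem_maps_of_edgesOff ho hpab
  have hev : (K.reattach hx.1.ne S).evMap (hG.solve x) = x := hG.evMap_solve x
  refine ⟨reattach_adj_edge _, ?_, fun v w hvw hne => ?_⟩
  · have := hG'.length_eq_zero_of_eq hm hpab
    rwa [hev] at this
  · have := hG'.length_evMap v w hm
    rw [hev] at this
    rw [this]
    obtain ⟨t, ht, he⟩ := ho v w hvw hne
    rwa [len_eq (hG'.slope_ne_zero v w hvw) he]

/-- Adding the slide opens the contracted edge to length `1` and leaves the other lengths alone.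
This supplies the nonempty open cell needed for the new type to be essential. -/
theorem OnWall.isOpen_slide {x : Fin n → ℝ × ℝ} (hx : K.OnWall a b x) (hG : K.Good) (hK : K.Valid)
    (hχ : K.IsBranchCut a b χ) :
    (K.reattach hx.1.ne S).IsOpen (hG.solve x + K.slide a b χ S) := by
  have hpab := hG.eq_of_length_eq_zero hx.1 hx.2.1
  have ho := (hx.edgesOff hG).reattach (S := S) hK hx.1 hpab
  intro v w hvw
  by_cases hne : s(v, w) = s(a, b)
  · refine ⟨1, one_pos, ?_⟩
    rw [Sym2.eq_iff] at hne
    rcases hne with ⟨rfl, rfl⟩ | ⟨rfl, rfl⟩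
    · simp [slide_left hx.1.ne hχ, slide_right hχ, hpab, reattach_slope_edge]
    · simp [slide_left hx.1.ne hχ, slide_right hχ, hpab, reattach_slope_edge', toPlane_neg]
  · obtain ⟨t, ht, he⟩ := ho v w hvw hne
    refine ⟨t, ht, ?_⟩
    rw [Pi.add_apply, Pi.add_apply, he, slide_eq_of_adj hx.1.ne hχ hvw hne]
    abel

end Shape

theorem eq_zero_of_mul_wedge {b : ℤ × ℤ} (hb : b ≠ 0) {d : ℝ}
    (h : ∀ c : ℤ × ℤ, d * (wedge b c : ℝ) = 0) : d = 0 := by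
  -- The area of `b` and its quarter turn is the squared norm of `b`.
  have h1 := h (-b.2, b.1)
  refine (mul_eq_zero.1 h1).resolve_right fun h2 => hb ?_
  have h3 : b.1 * b.1 + b.2 * b.2 = 0 := by
    have : wedge b (-b.2, b.1) = 0 := by exact_mod_cast h2
    simp only [wedge] at this
    linarith
  refine Prod.ext ?_ ?_ <;> simp only [Prod.fst_zero, Prod.snd_zero] <;> nlinarith

/-! ### How the branches act on the length of the shrinking edge -/

namespace Shape

variable {n V E : ℕ} {K : Shape n V E} {a b : Fin V} {χ : Fin V ⊕ Fin E → Fin V → ℤ}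

/-- A function constant on each branch is determined by its values at `a`, `b` and their neighbours.
Identities between branch indicators are verified this way. -/
theorem Valid.eq_zero_of_const_off (hK : K.Valid) (h : K.graph.Adj a b) {f : Fin V → ℤ}
    (ha : f a = 0) (hb : f b = 0) (hn : ∀ u, K.Nbr a b u → f u = 0)
    (hoff : ∀ x y, (x ≠ a ∧ x ≠ b) → (y ≠ a ∧ y ≠ b) → K.graph.Adj x y → f x = f y)
    (x : Fin V) : f x = 0 := by
  rw [← ha]
  refine eq_of_reachable (fun v w hvw => ?_) (hK.isTree.1.preconnected x a)
  have hvw' := hvw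
  rw [← hK.reattach_branchesAt h, reattach_adj] at hvw'
  have h0 : ∀ i, f (attach a b (K.branchesAt a b) i) = 0 := fun i => by
    rcases attach_eq_or (a := a) (b := b) (K.branchesAt a b) i with h | h <;> rw [h] <;> assumption
  rcases hvw' with h1 | h1 | h1 | h1 | h1
  · rw [h1.1, h1.2, ha, hb]
  · rw [h1.1, h1.2, ha, hb]
  · rw [h1.2, h0, hn v h1.1]
  · rw [h1.2, h0, hn w h1.1]
  · exact hoff v w h1.1 h1.2.1 hvw

theorem IsBranchCut.mul_eq_zero (hχ : K.IsBranchCut a b χ) (hK : K.Valid) (h : K.graph.Adj a b)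
    {i j : Fin V ⊕ Fin E} (hij : i ≠ j) (x : Fin V) : χ i x * χ j x = 0 := by
  refine hK.eq_zero_of_const_off h (f := fun x => χ i x * χ j x) (by simp [hχ.left])
    (by simp [hχ.right]) (fun u hu => ?_) (fun x y hx hy hxy => ?_) x
  · rw [hχ.nbr i u hu, hχ.nbr j u hu]
    split_ifs with h1 h2
    · exact absurd (h1.trans h2.symm) hij
    all_goals simp
  · rw [hχ.eq_of_adj i x y hx hy hxy, hχ.eq_of_adj j x y hx hy hxy]

theorem IsBranchCut.mul_self (hχ : K.IsBranchCut a b χ) (hK : K.Valid) (h : K.graph.Adj a b)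
    (i : Fin V ⊕ Fin E) (x : Fin V) : χ i x * χ i x = χ i x := by
  have := hK.eq_zero_of_const_off h (f := fun x => χ i x * χ i x - χ i x) (by simp [hχ.left])
    (by simp [hχ.right]) (fun u hu => ?_) (fun x y hx hy hxy => ?_) x
  · exact sub_eq_zero.1 this
  · rw [hχ.nbr i u hu]
    split_ifs <;> simp
  · simp only [hχ.eq_of_adj i x y hx hy hxy]

theorem IsBranchCut.inr_eq_zero (hχ : K.IsBranchCut a b χ) (hK : K.Valid) (h : K.graph.Adj a b)
    (e : Fin E) (x : Fin V) : χ (.inr e) x = 0 :=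
  hK.eq_zero_of_const_off h (hχ.left _) (hχ.right _)
    (fun u hu => by rw [hχ.nbr _ u hu, if_neg Sum.inr_ne_inl])
    (fun x y hx hy hxy => hχ.eq_of_adj _ x y hx hy hxy) x

/-- The effect on the length of the edge `ab` of a translation of the branch `i`. -/
noncomputable def branchForm (K : Shape n V E) (a b : Fin V) (χ : Fin V ⊕ Fin E → Fin V → ℤ)
    (i : Fin V ⊕ Fin E) : ℝ × ℝ →ₗ[ℝ] ℝ :=
  K.length a b ∘ₗ K.evMap ∘ₗ LinearMap.pi fun x => (χ i x : ℝ) • LinearMap.id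

theorem branchForm_apply (i : Fin V ⊕ Fin E) (u : ℝ × ℝ) :
    K.branchForm a b χ i u = K.length a b (K.evMap fun x => (χ i x : ℝ) • u) := rfl

/-- Moving a branch in its own direction only changes the length of the edge that attaches it. For
an end nothing moves. -/
theorem Good.branchForm_branchVec (hG : K.Good) (hK : K.Valid) (h : K.graph.Adj a b)
    (hχ : K.IsBranchCut a b χ) {i : Fin V ⊕ Fin E} (hi : K.IsBranch a b i) :
    K.branchForm a b χ i (toPlane (K.branchVec a b i)) = 0 := by
  rw [branchForm_apply]
  cases i with
  | inl u =>
    have hu : K.Nbr a b u := hi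
    have hc := hχ.isCut_branch (S := K.branchesAt a b) h.ne hu
    rw [hK.reattach_branchesAt h] at hc
    have hs : K.slope (attach a b (K.branchesAt a b) (.inl u)) u = K.branchVec a b (.inl u) := by
      rw [attach_branchesAt_inl hu]
      split_ifs with hb
      · simp [branchVec, hK.slope_of_not_adj a u fun ha => hK.not_adj_both h ha hb]
      · simp [branchVec, hK.slope_of_not_adj b u hb]
    have hm := cut_mem_maps hK hc
    rw [hs] at hm
    exact hG.length_eq_zero_of_eq hm (by rw [hχ.left, hχ.right])
  | inr e =>
    have : (fun x => (χ (.inr e) x : ℝ) • toPlane (K.branchVec a b (.inr e))) = 0 := by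
      funext x
      rw [hχ.inr_eq_zero hK h]
      simp
    rw [this, map_zero, map_zero]

theorem Good.exists_coeff (hG : K.Good) (hK : K.Valid) (h : K.graph.Adj a b)
    (hχ : K.IsBranchCut a b χ) : ∃ d : Fin V ⊕ Fin E → ℝ, ∀ i ∈ K.branches a b, ∀ c : ℤ × ℤ,
      K.branchForm a b χ i (toPlane c) = d i * (wedge (K.branchVec a b i) c : ℝ) := by
  have : ∀ i, ∃ d : ℝ, i ∈ K.branches a b → ∀ c : ℤ × ℤ,
      K.branchForm a b χ i (toPlane c) = d * (wedge (K.branchVec a b i) c : ℝ) := by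
    intro i
    by_cases hi : i ∈ K.branches a b
    · rw [mem_branches] at hi
      obtain ⟨d, hd⟩ := exists_eq_mul_wedge _ (hG.branchVec_ne_zero hK h hi)
        (hG.branchForm_branchVec hK h hχ hi)
      exact ⟨d, fun _ => hd⟩
    · exact ⟨0, fun h => absurd h hi⟩
  choose d hd using this
  exact ⟨d, hd⟩

/-- If `b` is not marked, sliding is a sum of translations of branches. -/
theorem length_slide (hb : ∀ m, K.mark m ≠ b) (S : Finset (Fin V ⊕ Fin E)) :
    K.length a b (K.evMap (K.slide a b χ S)) =
      ∑ i ∈ S, K.branchForm a b χ i (toPlane (∑ i ∈ S, K.branchVec a b i)) := by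
  simp only [branchForm_apply]
  rw [← map_sum, ← map_sum]
  congr 1
  funext m
  simp only [evMap_apply, slide, if_neg (hb m), Finset.sum_apply, add_zero, Int.cast_sum,
    Finset.sum_smul]

/-- Both branches move by the sum of their vectors, and the two area terms differ by antisymmetry.
The second factor turns the weight of the vertex `b` into a signed bracket. -/
theorem Good.length_slide_pair (hb : ∀ m, K.mark m ≠ b) {d : Fin V ⊕ Fin E → ℝ}
    (hd : ∀ i ∈ K.branches a b, ∀ c : ℤ × ℤ,
      K.branchForm a b χ i (toPlane c) = d i * (wedge (K.branchVec a b i) c : ℝ))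
    {i j : Fin V ⊕ Fin E} (hi : i ∈ K.branches a b) (hj : j ∈ K.branches a b) (hij : i ≠ j) :
    K.length a b (K.evMap (K.slide a b χ {i, j})) =
      (d i - d j) * (wedge (K.branchVec a b i) (K.branchVec a b j) : ℝ) := by
  rw [length_slide hb, Finset.sum_pair hij, Finset.sum_pair hij, hd i hi, hd j hj,
    wedge_add_right, wedge_add_right, wedge_self, wedge_self,
    wedge_swap (K.branchVec a b j) (K.branchVec a b i)]
  push_cast
  ring

/-- If neither `a` nor `b` is marked, the coefficients satisfy a balancing condition. -/
theorem Good.sum_coeff_wedge (hG : K.Good) (ha : ∀ m, K.mark m ≠ a)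
    (hb : ∀ m, K.mark m ≠ b) (hχ : K.IsBranchCut a b χ) {d : Fin V ⊕ Fin E → ℝ}
    (hd : ∀ i ∈ K.branches a b, ∀ c : ℤ × ℤ,
      K.branchForm a b χ i (toPlane c) = d i * (wedge (K.branchVec a b i) c : ℝ)) (c : ℤ × ℤ) :
    ∑ i ∈ K.branches a b, d i * (wedge (K.branchVec a b i) c : ℝ) = 0 := by
  rw [← Finset.sum_congr rfl fun i hi => hd i hi c]
  simp only [branchForm_apply]
  rw [← map_sum, ← map_sum]
  -- As every marked point lies in exactly one branch, moving all branches by `c` is, on the marked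
  -- points, a global translation, and this changes no length.
  have hconst : (fun _ : Fin V => toPlane c) ∈ K.maps := fun v w _ => ⟨0, by simp⟩
  rw [← hG.length_eq_zero_of_eq (a := a) (b := b) hconst rfl]
  congr 1
  funext m
  simp only [evMap_apply, Finset.sum_apply]
  rw [← Finset.sum_smul, ← Int.cast_sum, hχ.sum_eq_one _ ⟨ha m, hb m⟩, Int.cast_one, one_smul]

/-- The marked point `a` decouples the branches: at most one of them can affect the length. -/
theorem Good.branchForm_eq_zero_or (hG : K.Good) (hK : K.Valid) (h : K.graph.Adj a b)
    (hχ : K.IsBranchCut a b χ) {m₀ : Fin n} (hm₀ : K.mark m₀ = a) {i j : Fin V ⊕ Fin E}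
    (hij : i ≠ j) : K.branchForm a b χ i = 0 ∨ K.branchForm a b χ j = 0 := by
  -- `ψ` computes the length of `ab` after all marked points outside the branch `i` have been moved
  -- to the marked point `a`, taken as the origin.
  let ψ : (Fin n → ℝ × ℝ) →ₗ[ℝ] ℝ := K.length a b ∘ₗ LinearMap.pi fun m =>
    (χ i (K.mark m) : ℝ) • ((LinearMap.proj m : (Fin n → ℝ × ℝ) →ₗ[ℝ] ℝ × ℝ) - LinearMap.proj m₀)
  have hψ : ∀ x, ψ x = K.length a b fun m => (χ i (K.mark m) : ℝ) • (x m - x m₀) := fun x => rfl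
  -- If `a` and `b` coincide, collapsing everything outside the branch `i` to that point again gives
  -- a map of the same type with `ab` contracted. Hence `ψ` is a multiple of the length.
  have hker : ∀ x, K.length a b x = 0 → ψ x = 0 := by
    intro x hx
    set p := hG.solve x with hp
    have hpm : p ∈ K.maps := hG.solve_mem x
    have hpab : p a = p b := hG.eq_of_length_eq_zero h hx
    have hev : ∀ m, p (K.mark m) = x m := fun m => congrFun (hG.evMap_solve x) m
    let q : Fin V → ℝ × ℝ := fun v => (χ i v : ℝ) • (p v - p a)
    have hqa : ∀ c, (c = a ∨ c = b) → q c = 0 := by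
      rintro c (rfl | rfl)
      · simp [q]
      · simp [q, hpab]
    have hpc : ∀ c, (c = a ∨ c = b) → p c = p a := by
      rintro c (rfl | rfl)
      exacts [rfl, hpab.symm]
    have hqm : q ∈ K.maps := by
      intro v w hvw
      obtain ⟨t, ht⟩ := hpm v w hvw
      by_cases hv : v = a ∨ v = b
      · refine ⟨χ i w * t, ?_⟩
        rw [hqa v hv, zero_add]
        simp only [q]
        rw [ht, hpc v hv, add_sub_cancel_left, mul_smul]
      · by_cases hw : w = a ∨ w = b
        · refine ⟨χ i v * t, ?_⟩
          rw [hqa w hw]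
          simp only [q]
          rw [← hpc w hw, ht, mul_smul]
          simp
        · refine ⟨χ i v * t, ?_⟩
          have := hχ.eq_of_adj i v w (by tauto) (by tauto) hvw
          simp only [q]
          rw [← this, ht, mul_smul, ← smul_add]
          congr 1
          abel
    have h1 := hG.length_eq_zero_of_eq hqm ((hqa a (Or.inl rfl)).trans (hqa b (Or.inr rfl)).symm)
    rw [hψ, ← h1]
    congr 1
    funext m
    rw [evMap_apply, ← hev m, ← hev m₀, hm₀]
  obtain ⟨y, hy, -⟩ := hG.exists_length_eq hK h
  have hprop : ∀ x, ψ x = K.length a b x * ψ y := by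
    intro x
    have := hker (x - K.length a b x • y) (by
      rw [map_sub, map_smul, hy, smul_eq_mul, mul_one, sub_self])
    rw [map_sub, map_smul, smul_eq_mul, sub_eq_zero] at this
    exact this
  -- The indicators are orthogonal idempotents: `ψ` agrees with the length on translations of the
  -- branch `i` and vanishes on those of the branch `j`. A nonzero effect of `i` makes the factor
  -- equal to `1`, and then `j` has no effect.
  have hval : ∀ k u, ψ (K.evMap fun x => (χ k x : ℝ) • u) =
      K.length a b (K.evMap fun x => ((χ i x * χ k x : ℤ) : ℝ) • u) := by
    intro k u
    rw [hψ]
    congr 1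
    funext m
    simp only [evMap_apply, hm₀, hχ.left, Int.cast_zero, zero_smul, sub_zero, smul_smul,
      Int.cast_mul]
  by_cases hi : K.branchForm a b χ i = 0
  · exact Or.inl hi
  · refine Or.inr (LinearMap.ext fun u => ?_)
    obtain ⟨u₀, hu₀⟩ : ∃ u, K.branchForm a b χ i u ≠ 0 := by
      by_contra hcon
      push Not at hcon
      exact hi (LinearMap.ext hcon)
    have h1 := hprop (K.evMap fun x => (χ i x : ℝ) • u₀)
    rw [hval] at h1
    simp only [hχ.mul_self hK h] at h1
    rw [← branchForm_apply] at h1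
    have h2 : ψ y = 1 := by
      rw [eq_comm, mul_right_eq_self₀] at h1
      exact h1.resolve_right hu₀
    have h3 := hprop (K.evMap fun x => (χ j x : ℝ) • u)
    rw [hval, h2, mul_one] at h3
    simp only [hχ.mul_eq_zero hK h hij, Int.cast_zero, zero_smul] at h3
    rw [branchForm_apply, ← h3, LinearMap.zero_apply]
    exact (congrArg _ (map_zero K.evMap)).trans (map_zero _)

theorem Good.coeff_eq_zero_or (hG : K.Good) (hK : K.Valid) (h : K.graph.Adj a b)
    (hχ : K.IsBranchCut a b χ) {m₀ : Fin n} (hm₀ : K.mark m₀ = a) {d : Fin V ⊕ Fin E → ℝ}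
    (hd : ∀ i ∈ K.branches a b, ∀ c : ℤ × ℤ,
      K.branchForm a b χ i (toPlane c) = d i * (wedge (K.branchVec a b i) c : ℝ))
    {i j : Fin V ⊕ Fin E} (hi : i ∈ K.branches a b) (hj : j ∈ K.branches a b) (hij : i ≠ j) :
    d i = 0 ∨ d j = 0 := by
  have key : ∀ k ∈ K.branches a b, K.branchForm a b χ k = 0 → d k = 0 := fun k hk h0 =>
    eq_zero_of_mul_wedge (hG.branchVec_ne_zero hK h ((K.mem_branches a b).1 hk)) fun c => by
      rw [← hd k hk c, h0, LinearMap.zero_apply]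
  exact (hG.branchForm_eq_zero_or hK h hχ hm₀ hij).imp (key i hi) (key j hj)

/-- Two adjacent vertices of a good type are not both marked. -/
theorem Good.not_both_marked (hG : K.Good) (h : K.graph.Adj a b) {i j : Fin n}
    (hi : K.mark i = a) (hj : K.mark j = b) : False := by
  classical
  have hij : i ≠ j := fun e => h.ne (by rw [← hi, ← hj, e])
  set s := K.slope a b with hs
  -- Two marked points on a common edge cannot be placed freely: their difference is asked to be
  -- orthogonal to the slope.
  obtain ⟨p, hp, hx⟩ := hG.surjective (Pi.single j (-(s.2 : ℝ), (s.1 : ℝ)))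
  obtain ⟨t, ht⟩ := hp a b h
  have h1 : p a = 0 := by rw [← hi, ← K.evMap_apply p i, hx, Pi.single_eq_of_ne hij]
  have h2 : p b = (-(s.2 : ℝ), (s.1 : ℝ)) := by rw [← hj, ← K.evMap_apply p j, hx, Pi.single_eq_same]
  rw [h1, h2, zero_add, ← hs] at ht
  have e1 : -(s.2 : ℝ) = t * s.1 := congrArg Prod.fst ht
  have e2 : (s.1 : ℝ) = t * s.2 := congrArg Prod.snd ht
  have e3 : (s.1 : ℝ) * s.1 + s.2 * s.2 = 0 := by
    linear_combination s.1 * e2 - s.2 * e1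
  have e4 : s.1 * s.1 + s.2 * s.2 = 0 := by exact_mod_cast e3
  refine hG.slope_ne_zero a b h (Prod.ext ?_ ?_) <;> rw [← hs] <;>
    simp only [Prod.fst_zero, Prod.snd_zero] <;> nlinarith

end Shape

/-! ### Local sums at a wall -/

theorem sign_intCast (z : ℤ) : SignType.sign (z : ℝ) = SignType.sign z := by
  rcases lt_trichotomy z 0 with h | h | h
  · rw [sign_neg h, sign_neg (by exact_mod_cast h)]
  · simp [h]
  · rw [sign_pos h, sign_pos (by exact_mod_cast h)]

/-- The sum over the splittings of a marked vertex into a marked and an unmarked one. -/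
theorem sum_pairs_marked {ι : Type} [DecidableEq ι] (β : Finset ι) (b : ι → ℤ × ℤ) (d : ι → ℝ)
    (k : ℕ) (hcard : β.card = k + 3) (hsum : ∑ i ∈ β, b i = 0)
    (hd : ∀ i ∈ β, ∀ j ∈ β, i ≠ j → d i = 0 ∨ d j = 0) (G : Finset ι → RatFunc ℚ)
    (hG : ∀ i ∈ β, ∀ j ∈ β, i ≠ j → G {i, j} =
      ((SignType.sign (d i - d j) : SignType) : RatFunc ℚ) * oddBracket (wedge (b i) (b j)) *
        markedWeight k ((b i + b j) ::ₘ (β \ {i, j}).val.map b)) :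
    ∑ S ∈ β.powersetCard 2, G S = 0 := by
  by_cases h0 : ∀ i ∈ β, d i = 0
  · refine Finset.sum_eq_zero fun S hS => ?_
    rw [Finset.mem_powersetCard] at hS
    obtain ⟨i, j, hij, rfl⟩ := Finset.card_eq_two.1 hS.2
    have hi : i ∈ β := hS.1 (by simp)
    have hj : j ∈ β := hS.1 (by simp)
    rw [hG i hi j hj hij, h0 i hi, h0 j hj]
    simp
  · push Not at h0
    obtain ⟨i₀, hi₀, hdi₀⟩ := h0
    -- Pairs that avoid `i₀` have coefficient difference zero. For the others the sign is that of `d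
    -- i₀`, a common factor, and what remains is the wall-crossing identity with `b i₀` as the
    -- distinguished vector.
    have hz : ∀ j ∈ β, j ≠ i₀ → d j = 0 := fun j hj hne =>
      (hd j hj i₀ hi₀ hne).resolve_right hdi₀
    have hsub : (β.erase i₀).image (fun j => ({i₀, j} : Finset ι)) ⊆ β.powersetCard 2 := by
      intro S hS
      rw [Finset.mem_image] at hS
      obtain ⟨j, hj, rfl⟩ := hS
      rw [Finset.mem_erase] at hj
      rw [Finset.mem_powersetCard]
      refine ⟨?_, Finset.card_pair hj.1.symm⟩
      intro k hk
      simp only [Finset.mem_insert, Finset.mem_singleton] at hk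
      rcases hk with rfl | rfl
      exacts [hi₀, hj.2]
    rw [← Finset.sum_subset hsub, Finset.sum_image]
    · have h1 := sum_oddBracket_markedWeight k (b i₀) (β.erase i₀) b
        (by rw [Finset.card_erase_of_mem hi₀, hcard]; rfl)
        (by rw [Finset.add_sum_erase _ _ hi₀, hsum])
      rw [← mul_zero (((SignType.sign (d i₀) : SignType) : RatFunc ℚ)), ← h1, Finset.mul_sum]
      refine Finset.sum_congr rfl fun j hj => ?_
      rw [Finset.mem_erase] at hj
      have hsd : β \ {i₀, j} = (β.erase i₀).erase j := by ext; simp; tauto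
      rw [hG i₀ hi₀ j hj.2 hj.1.symm, hz j hj.2 hj.1, sub_zero, hsd, mul_assoc]
    · intro j hj j' hj' he
      have hj1 : j ≠ i₀ := (Finset.mem_erase.1 hj).1
      have : j ∈ ({i₀, j'} : Finset ι) := by
        have he' : ({i₀, j} : Finset ι) = {i₀, j'} := he
        rw [← he']; simp
      simpa [hj1] using this
    · intro S hS hS'
      rw [Finset.mem_powersetCard] at hS
      obtain ⟨i, j, hij, rfl⟩ := Finset.card_eq_two.1 hS.2
      have hi : i ∈ β := hS.1 (by simp)
      have hj : j ∈ β := hS.1 (by simp)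
      have hii : i ≠ i₀ := by
        rintro rfl
        exact hS' (Finset.mem_image.2 ⟨j, Finset.mem_erase.2 ⟨hij.symm, hj⟩, rfl⟩)
      have hji : j ≠ i₀ := by
        rintro rfl
        exact hS' (Finset.mem_image.2 ⟨i, Finset.mem_erase.2 ⟨hij, hi⟩, Finset.pair_comm _ _⟩)
      rw [hG i hi j hj hij, hz i hi hii, hz j hj hji]
      simp

/-- Proportionality of two triples with vanishing cross product. -/
theorem exists_eq_mul_of_cross {e₀ e₁ e₂ p q r : ℝ} (h : ¬ (p = 0 ∧ q = 0 ∧ r = 0))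
    (h1 : e₀ * p = e₂ * q) (h2 : e₁ * q = e₀ * r) (h3 : e₁ * p = e₂ * r) :
    ∃ t, e₀ = t * q ∧ e₁ = t * r ∧ e₂ = t * p := by
  by_cases hp : p = 0
  · by_cases hq : q = 0
    · have hr : r ≠ 0 := fun hr => h ⟨hp, hq, hr⟩
      refine ⟨e₁ / r, ?_, ?_, ?_⟩ <;> field_simp <;> linarith
    · refine ⟨e₀ / q, ?_, ?_, ?_⟩ <;> field_simp <;> linarith
  · refine ⟨e₂ / p, ?_, ?_, ?_⟩ <;> field_simp <;> linarith

/-- The sum over the splittings of an unmarked four-valent vertex into two trivalent ones. -/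
theorem sum_pairs_unmarked {ι : Type} [DecidableEq ι] (β : Finset ι) (b : ι → ℤ × ℤ) (d : ι → ℝ)
    (hcard : β.card = 4) (hsum : ∑ i ∈ β, b i = 0)
    (hd : ∀ c, ∑ i ∈ β, d i * (wedge (b i) c : ℝ) = 0) (G : Finset ι → RatFunc ℚ)
    (hG : ∀ i j k l, i ≠ j → k ≠ l → β \ {i, j} = {k, l} → i ∈ β → j ∈ β → G {i, j} =
      ((SignType.sign (d i - d j) : SignType) : RatFunc ℚ) * oddBracket (wedge (b i) (b j)) *
        bracketMinus (wedge (b k) (b l)).natAbs) :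
    ∑ S ∈ β.powersetCard 2, G S = 0 := by
  obtain ⟨f, hf⟩ : ∃ f : Fin 4 ↪ ι, β = Finset.univ.map f := by
    let e := (Finset.equivFinOfCardEq hcard).symm
    refine ⟨e.toEmbedding.trans (Function.Embedding.subtype _), ?_⟩
    ext x
    simp only [Finset.mem_map, Finset.mem_univ, true_and]
    exact ⟨fun hx => ⟨e.symm ⟨x, hx⟩, by simp⟩, by rintro ⟨y, rfl⟩; exact (e y).2⟩
  have hmem : ∀ i, f i ∈ β := fun i => by rw [hf]; simp
  have hG' : ∀ i j k l : Fin 4, i ≠ j → k ≠ l → (Finset.univ \ {i, j} : Finset (Fin 4)) = {k, l} →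
      G (Finset.map f {i, j}) = ((SignType.sign (d (f i) - d (f j)) : SignType) : RatFunc ℚ) *
        oddBracket (wedge (b (f i)) (b (f j))) *
        bracketMinus (wedge (b (f k)) (b (f l))).natAbs := by
    intro i j k l hij hkl hu
    rw [Finset.map_insert, Finset.map_singleton]
    refine hG _ _ _ _ (f.injective.ne hij) (f.injective.ne hkl) ?_ (hmem i) (hmem j)
    have h1 : ({f i, f j} : Finset ι) = Finset.map f {i, j} := by
      rw [Finset.map_insert, Finset.map_singleton]
    rw [h1, hf, ← Finset.map_sdiff, hu, Finset.map_insert, Finset.map_singleton]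
  rw [hf, Finset.sum_map, Fin.sum_univ_four] at hsum
  have hd' : ∀ c, d (f 0) * (wedge (b (f 0)) c : ℝ) + d (f 1) * (wedge (b (f 1)) c : ℝ) +
      d (f 2) * (wedge (b (f 2)) c : ℝ) + d (f 3) * (wedge (b (f 3)) c : ℝ) = 0 := by
    intro c
    have := hd c
    rwa [hf, Finset.sum_map, Fin.sum_univ_four] at this
  have hps : (Finset.univ : Finset (Fin 4)).powersetCard 2 =
      {{0, 1}, {0, 2}, {0, 3}, {1, 2}, {1, 3}, {2, 3}} := by decide
  rw [hf, Finset.powersetCard_map, Finset.sum_map, hps]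
  rw [Finset.sum_insert (by decide), Finset.sum_insert (by decide), Finset.sum_insert (by decide),
    Finset.sum_insert (by decide), Finset.sum_insert (by decide), Finset.sum_singleton]
  change G (Finset.map f {0, 1}) + (G (Finset.map f {0, 2}) + (G (Finset.map f {0, 3}) +
    (G (Finset.map f {1, 2}) + (G (Finset.map f {1, 3}) + G (Finset.map f {2, 3}))))) = 0
  rw [hG' 0 1 2 3 (by decide) (by decide) (by decide), hG' 0 2 1 3 (by decide) (by decide) (by decide),
    hG' 0 3 1 2 (by decide) (by decide) (by decide), hG' 1 2 0 3 (by decide) (by decide) (by decide),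
    hG' 1 3 0 2 (by decide) (by decide) (by decide), hG' 2 3 0 1 (by decide) (by decide) (by decide)]
  generalize b (f 0) = b₀ at *
  generalize b (f 1) = b₁ at *
  generalize b (f 2) = b₂ at *
  generalize b (f 3) = b₃ at *
  generalize d (f 0) = d₀ at *
  generalize d (f 1) = d₁ at *
  generalize d (f 2) = d₂ at *
  generalize d (f 3) = d₃ at *
  have hb₃ : b₃ = -(b₀ + b₁ + b₂) := by rw [eq_neg_iff_add_eq_zero, add_comm, hsum]
  set p := wedge b₀ b₁ with hp
  set q := wedge b₁ b₂ with hq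
  set r := wedge b₂ b₀ with hr
  have e02 : wedge b₀ b₂ = -r := wedge_swap _ _
  have e10 : wedge b₁ b₀ = -p := wedge_swap _ _
  have e21 : wedge b₂ b₁ = -q := wedge_swap _ _
  have e03 : wedge b₀ b₃ = r - p := by
    rw [hb₃, wedge_neg_right, wedge_add_right, wedge_add_right, wedge_self, e02, ← hp]; ring
  have e13 : wedge b₁ b₃ = p - q := by
    rw [hb₃, wedge_neg_right, wedge_add_right, wedge_add_right, wedge_self, e10, ← hq]; ring
  have e23 : wedge b₂ b₃ = q - r := by
    rw [hb₃, wedge_neg_right, wedge_add_right, wedge_add_right, wedge_self, e21, ← hr]; ring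
  have e30 : wedge b₃ b₀ = p - r := by rw [wedge_swap, e03]; ring
  have e31 : wedge b₃ b₁ = q - p := by rw [wedge_swap, e13]; ring
  have e32 : wedge b₃ b₂ = r - q := by rw [wedge_swap, e23]; ring
  rw [e02, e03, e13, e23]
  -- If the three areas vanish, so do the other areas by balancing, and each term is zero. Otherwise
  -- the conditions at `b₀`, `b₁`, `b₂` determine the differences of the coefficients up to a factor
  -- `t`.
  by_cases h0 : p = 0 ∧ q = 0 ∧ r = 0
  · obtain ⟨h1, h2, h3⟩ := h0
    rw [h1, h2, h3]
    simp [oddBracket_zero]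
  · have c0 := hd' b₀
    have c1 := hd' b₁
    have c2 := hd' b₂
    rw [wedge_self, e10, ← hr, e30] at c0
    rw [← hp, wedge_self, e21, e31] at c1
    rw [e02, ← hq, wedge_self, e32] at c2
    push_cast at c0 c1 c2
    obtain ⟨t, t0, t1, t2⟩ := exists_eq_mul_of_cross (e₀ := d₀ - d₃) (e₁ := d₁ - d₃)
      (e₂ := d₂ - d₃) (p := p) (q := q) (r := r) (by exact_mod_cast h0) (by linarith)
      (by linarith) (by linarith)
    have s01 : d₀ - d₁ = t * ((q - r : ℤ) : ℝ) := by push_cast; linarith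
    have s02 : d₀ - d₂ = t * ((q - p : ℤ) : ℝ) := by push_cast; linarith
    have s12 : d₁ - d₂ = t * ((r - p : ℤ) : ℝ) := by push_cast; linarith
    rw [s01, s02, s12, t0, t1, t2]
    simp only [sign_mul, SignType.coe_mul, sign_intCast]
    have hswap : (p - q).natAbs = (q - p).natAbs := by omega
    have o1 := sign_mul_bracketMinus_natAbs (q - r)
    have o2 := sign_mul_bracketMinus_natAbs (q - p)
    have o3 := sign_mul_bracketMinus_natAbs q
    have o4 := sign_mul_bracketMinus_natAbs (r - p)
    have o5 := sign_mul_bracketMinus_natAbs r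
    have o6 := sign_mul_bracketMinus_natAbs p
    have hpq : oddBracket (p - q) = -oddBracket (q - p) := by rw [← oddBracket_neg]; congr 1; ring
    have hcyc := oddBracket_oddBracket_cyclic p q r
    rw [hpq] at hcyc
    rw [hswap, oddBracket_neg, hpq, Int.natAbs_neg]
    -- Each remaining sign matches the weight of one of the two vertices and makes it antisymmetric.
    -- Complementary pairs contribute equally, hence the factor `2`.
    linear_combination ((SignType.sign t : SignType) : RatFunc ℚ) *
      (oddBracket p * o1 - oddBracket r * o2 + oddBracket (r - p) * o3 + oddBracket q * o4
        - oddBracket (q - p) * o5 + oddBracket (q - r) * o6 + 2 * hcyc)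

/-! ### Weights -/

namespace Shape

variable {n V E : ℕ} {K : Shape n V E} {a b : Fin V} {S : Finset (Fin V ⊕ Fin E)}

/-- All unmarked vertices are trivalent. -/
def Trivalent (K : Shape n V E) : Prop :=
  ∀ v, (∀ i, K.mark i ≠ v) → Multiset.card (K.star v) = 3

open Classical in
/-- The refined weight of a vertex. -/
noncomputable def vertexWeight (K : Shape n V E) (v : Fin V) : RatFunc ℚ :=
  if ∃ i, K.mark i = v then markedWeight (Multiset.card (K.star v) - 2) (K.star v)
  else bracketMinus (area (K.star v))

/-- The product of the refined weights of the vertices. -/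
noncomputable def weight (K : Shape n V E) : RatFunc ℚ := ∏ v, K.vertexWeight v

theorem Valid.prod_vertexWeight_toCurveType (hK : K.Valid) :
    ∏ v, hK.toCurveType.vertexWeight v = K.weight := by
  refine Finset.prod_congr rfl fun v _ => ?_
  have h1 := hK.star_toCurveType v
  have h2 := PlaneCurve.card_star hK.toCurveType v
  rw [h1] at h2
  unfold CurveType.vertexWeight vertexWeight
  rw [← h2, h1]
  by_cases hm : ∃ i, K.mark i = v
  · rw [if_pos hm]
    exact if_pos hm
  · rw [if_neg hm]
    exact if_neg hm

theorem vertexWeight_of_marked {v : Fin V} {i : Fin n} (h : K.mark i = v) :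
    K.vertexWeight v = markedWeight (Multiset.card (K.star v) - 2) (K.star v) :=
  if_pos ⟨i, h⟩

theorem vertexWeight_of_unmarked {v : Fin V} (h : ∀ i, K.mark i ≠ v) :
    K.vertexWeight v = bracketMinus (area (K.star v)) :=
  if_neg fun ⟨i, hi⟩ => h i hi

theorem Valid.vertexWeight_reattach_off (hK : K.Valid) (h : K.graph.Adj a b) {v : Fin V}
    (hv : v ≠ a ∧ v ≠ b) : (K.reattach h.ne S).vertexWeight v = K.vertexWeight v := by
  rw [vertexWeight, vertexWeight, star_reattach_off hK h hv]
  rfl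

theorem weight_eq_mul (hab : a ≠ b) : K.weight =
    (∏ v ∈ (Finset.univ.erase a).erase b, K.vertexWeight v) *
      (K.vertexWeight a * K.vertexWeight b) := by
  rw [weight, ← Finset.mul_prod_erase _ _ (Finset.mem_univ a),
    ← Finset.mul_prod_erase (Finset.univ.erase a) _ (Finset.mem_erase.2 ⟨hab.symm, Finset.mem_univ b⟩)]
  ring

theorem Valid.weight_reattach (hK : K.Valid) (h : K.graph.Adj a b) :
    (K.reattach h.ne S).weight = (∏ v ∈ (Finset.univ.erase a).erase b, K.vertexWeight v) *
      ((K.reattach h.ne S).vertexWeight a * (K.reattach h.ne S).vertexWeight b) := by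
  rw [weight_eq_mul h.ne]
  congr 1
  refine Finset.prod_congr rfl fun v hv => hK.vertexWeight_reattach_off h ?_
  rw [Finset.mem_erase, Finset.mem_erase] at hv
  exact ⟨hv.2.1, hv.1⟩

theorem Valid.card_branchesAt (hK : K.Valid) (h : K.graph.Adj a b) :
    (K.branchesAt a b).card + 1 = Multiset.card (K.star b) := by
  rw [hK.star_right h]; simp

open Classical in
theorem Valid.card_branches (hK : K.Valid) (h : K.graph.Adj a b) :
    (K.branches a b).card + 2 = Multiset.card (K.star a) + Multiset.card (K.star b) := by
  have h1 := Finset.card_sdiff_add_card_eq_card (K.branchesAt_subset (a := a) (b := b))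
  rw [hK.branches_sdiff h] at h1
  have h2 := hK.card_branchesAt h
  have h3 := hK.card_branchesAt h.symm
  omega

/-- The two lengths differ by the factor with which the slide changes the old length. If that factor
vanishes, the new type is not good and its length is zero by convention, so no case distinction is
needed later. -/
theorem Good.sign_length_reattach (hG : K.Good) (hK : K.Valid) (h : K.graph.Adj a b)
    {χ : Fin V ⊕ Fin E → Fin V → ℤ}
    (hS : S ⊆ K.branches a b) (hcard : S.card = (K.branchesAt a b).card)
    (hχ : K.IsBranchCut a b χ) (y : Fin n → ℝ × ℝ) :
    SignType.sign ((K.reattach h.ne S).length a b y) = SignType.sign (K.length a b y) *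
      SignType.sign (K.length a b (K.evMap (K.slide a b χ S))) := by
  by_cases hG' : (K.reattach h.ne S).Good
  · have hne := hG.length_slide_ne_zero hK h hS hcard hχ hG'
    rw [hG.length_reattach hK h hS hcard hχ hG' y, sign_mul]
    rcases lt_or_gt_of_ne hne with hl | hl
    · rw [sign_neg hl]
      generalize SignType.sign ((K.reattach h.ne S).length a b y) = s
      revert s
      decide
    · rw [sign_pos hl]; simp
  · have h0 : K.length a b (K.evMap (K.slide a b χ S)) = 0 := by
      by_contra hne
      exact hG' (hG.reattach hK h hS hcard hχ hne)
    rw [h0, length, dif_neg hG']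
    simp

open Classical in
/-- The signed weights of the types that differ by sliding branches along `ab` cancel. -/
theorem Good.sum_reattach (hG : K.Good) (hK : K.Valid) (hT : K.Trivalent) (h : K.graph.Adj a b)
    (hb : ∀ i, K.mark i ≠ b) (y : Fin n → ℝ × ℝ) :
    ∑ S ∈ (K.branches a b).powersetCard 2, (K.reattach h.ne S).weight *
      ((SignType.sign ((K.reattach h.ne S).length a b y) : SignType) : RatFunc ℚ) = 0 := by
  obtain ⟨χ, hχ⟩ := hK.exists_isBranchCut h
  obtain ⟨d, hd⟩ := hG.exists_coeff hK h hχ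
  set β := K.branches a b with hβ
  set bv := K.branchVec a b with hbv
  have hb2 : (K.branchesAt a b).card = 2 := by
    have := hK.card_branchesAt h
    rw [hT b hb] at this
    omega
  have hβc := hK.card_branches h
  rw [hT b hb, ← hβ] at hβc
  have hsum : ∑ i ∈ β, bv i = 0 := hK.sum_branchVec h
  -- The factor common to all distributions: the weights of the vertices off the edge and the sign
  -- of the direction `y` for the old type.
  set C : RatFunc ℚ := (∏ v ∈ (Finset.univ.erase a).erase b, K.vertexWeight v) *
    ((SignType.sign (K.length a b y) : SignType) : RatFunc ℚ) with hC
  have hpair : ∀ i ∈ β, ∀ j ∈ β, i ≠ j → (K.reattach h.ne {i, j}).weight *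
      ((SignType.sign ((K.reattach h.ne {i, j}).length a b y) : SignType) : RatFunc ℚ) =
      C * (((SignType.sign (d i - d j) : SignType) : RatFunc ℚ) * oddBracket (wedge (bv i) (bv j)) *
        (K.reattach h.ne {i, j}).vertexWeight a) := by
    intro i hi j hj hij
    have hS : ({i, j} : Finset _) ⊆ β := by
      intro k hk
      simp only [Finset.mem_insert, Finset.mem_singleton] at hk
      rcases hk with rfl | rfl
      exacts [hi, hj]
    have hcard : ({i, j} : Finset (Fin V ⊕ Fin E)).card = (K.branchesAt a b).card := by
      rw [hb2, Finset.card_pair hij]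
    rw [hG.sign_length_reattach hK h hS hcard hχ y, Good.length_slide_pair hb hd hi hj hij,
      hK.weight_reattach h]
    have hwb : (K.reattach h.ne {i, j}).vertexWeight b =
        bracketMinus (wedge (bv i) (bv j)).natAbs := by
      rw [vertexWeight_of_unmarked (K := K.reattach h.ne {i, j}) hb, star_reattach_right h.ne hS]
      have hval : ({i, j} : Finset (Fin V ⊕ Fin E)).val = {i, j} :=
        Finset.insert_val_of_notMem (by simpa using hij)
      rw [hval, Finset.sum_pair hij]
      have hperm : ((-(bv i + bv j)) ::ₘ Multiset.map bv {i, j}) =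
          {bv i, bv j, -(bv i + bv j)} := by
        change _ = bv i ::ₘ bv j ::ₘ {-(bv i + bv j)}
        rw [show Multiset.map bv {i, j} = bv i ::ₘ bv j ::ₘ 0 from by simp]
        rw [Multiset.cons_swap, Multiset.cons_swap (-(bv i + bv j))]
        rfl
      rw [hperm, area_triple _ _ _ (by abel)]
    rw [hwb, ← sign_mul_bracketMinus_natAbs, hC, sign_mul, SignType.coe_mul, SignType.coe_mul,
      sign_intCast]
    ring
  have hred : ∀ G : Finset (Fin V ⊕ Fin E) → RatFunc ℚ, (C ≠ 0 →
      ∑ S ∈ β.powersetCard 2, C⁻¹ * G S = 0) →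
      (∀ i ∈ β, ∀ j ∈ β, i ≠ j → C = 0 → G {i, j} = 0) → ∑ S ∈ β.powersetCard 2, G S = 0 := by
    intro G h1 h2
    by_cases hC0 : C = 0
    · refine Finset.sum_eq_zero fun S hS => ?_
      rw [Finset.mem_powersetCard] at hS
      obtain ⟨i, j, hij, rfl⟩ := Finset.card_eq_two.1 hS.2
      exact h2 i (hS.1 (by simp)) j (hS.1 (by simp)) hij hC0
    · have := h1 hC0
      rw [← Finset.mul_sum] at this
      exact (mul_eq_zero.1 this).resolve_left (inv_ne_zero hC0)
  refine hred _ (fun hC0 => ?_) fun i hi j hj hij hC0 => by rw [hpair i hi j hj hij, hC0, zero_mul]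
  by_cases ha : ∃ m, K.mark m = a
  -- With `a` of valency `k + 2` and `b` trivalent there are `k + 3` branches; after two of them go
  -- to `b`, the star of `a` consists of `k + 1` branches and the edge `ab`.
  · obtain ⟨m, hm⟩ := ha
    have ha2 := hK.two_le a
    obtain ⟨k, hk⟩ : ∃ k, β.card = k + 3 := ⟨β.card - 3, by omega⟩
    refine sum_pairs_marked β bv d k hk hsum
      (fun i hi j hj hij => hG.coeff_eq_zero_or hK h hχ hm hd hi hj hij) _ fun i hi j hj hij => ?_
    rw [hpair i hi j hj hij, inv_mul_cancel_left₀ hC0,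
      vertexWeight_of_marked (K := K.reattach h.ne {i, j}) hm, star_reattach_left h.ne,
      Finset.sum_pair hij]
    have hc : (β \ {i, j}).card = k + 1 := by
      rw [Finset.card_sdiff_of_subset, hk, Finset.card_pair hij]
      · rfl
      · intro l hl
        simp only [Finset.mem_insert, Finset.mem_singleton] at hl
        rcases hl with rfl | rfl
        exacts [hi, hj]
    congr 2
    rw [Multiset.card_cons, Multiset.card_map, Finset.card_val, hc]
    rfl
  · push Not at ha
    have hk : β.card = 4 := by
      rw [hT a ha] at hβc
      omega
    refine sum_pairs_unmarked β bv d hk hsum (hG.sum_coeff_wedge ha hb hχ hd) _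
      fun i j k l hij hkl he hi hj => ?_
    rw [hpair i hi j hj hij, inv_mul_cancel_left₀ hC0,
      vertexWeight_of_unmarked (K := K.reattach h.ne {i, j}) ha, star_reattach_left h.ne,
      Finset.sum_pair hij, he]
    have hval : ({k, l} : Finset (Fin V ⊕ Fin E)).val = {k, l} :=
      Finset.insert_val_of_notMem (by simpa using hkl)
    have hz : bv k + bv l + (bv i + bv j) = 0 := by
      rw [← hsum, ← Finset.sum_sdiff (s₁ := {i, j}) (s₂ := β), he, Finset.sum_pair hij,
        Finset.sum_pair hkl]
      intro l hl
      simp only [Finset.mem_insert, Finset.mem_singleton] at hl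
      rcases hl with rfl | rfl
      exacts [hi, hj]
    have hperm : ((bv i + bv j) ::ₘ Multiset.map bv {k, l}) = {bv k, bv l, bv i + bv j} := by
      change _ = bv k ::ₘ bv l ::ₘ {bv i + bv j}
      rw [show Multiset.map bv {k, l} = bv k ::ₘ bv l ::ₘ 0 from by simp]
      rw [Multiset.cons_swap, Multiset.cons_swap (bv i + bv j)]
      rfl
    rw [hval, hperm, area_triple _ _ _ hz]

end Shape

/-! ### Essential types on a wall -/

namespace Shape

variable {n V E : ℕ} {K : Shape n V E} {a b : Fin V} {S : Finset (Fin V ⊕ Fin E)}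

theorem Valid.valency_toCurveType (hK : K.Valid) (v : Fin V) :
    hK.toCurveType.valency v = Multiset.card (K.star v) := by
  have h2 := PlaneCurve.card_star hK.toCurveType v
  have h1 := hK.star_toCurveType v
  rw [h1] at h2
  exact h2.symm

open Classical in
-- Each of the `V - 1` edges is counted twice and each end once.
theorem Valid.sum_card_star (hK : K.Valid) : ∑ v, Multiset.card (K.star v) + 2 = 2 * V + E := by
  have h1 : ∀ v, Multiset.card (K.star v) =
      K.graph.degree v + ∑ e, if K.foot e = v then 1 else 0 := by
    intro v
    rw [star, Multiset.card_add, Multiset.card_sum, Multiset.card_sum, SimpleGraph.degree,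
      SimpleGraph.neighborFinset_eq_filter, Finset.card_filter]
    congr 1 <;> refine Finset.sum_congr rfl fun w _ => ?_ <;> split_ifs <;> simp
  have h2 := hK.isTree.card_edgeFinset
  rw [Finset.sum_congr rfl fun v _ => h1 v, Finset.sum_add_distrib,
    SimpleGraph.sum_degrees_eq_twice_card_edges, Finset.sum_comm]
  simp only [Finset.sum_ite_eq, Finset.mem_univ, if_true, Finset.sum_const, Finset.card_univ,
    Fintype.card_fin, smul_eq_mul, mul_one] at h2 ⊢
  omega

/-- Summing a function that is constant on consecutive blocks. -/
theorem sum_range_blocks (N : ℕ → ℕ) (c : ℕ → ℕ) (k : ℕ)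
    (hc : ∀ i j, j < k → ∑ l ∈ Finset.range j, N l ≤ i → i < ∑ l ∈ Finset.range (j + 1), N l →
      c i = j + 2) :
    ∑ i ∈ Finset.range (∑ l ∈ Finset.range k, N l), c i =
      ∑ j ∈ Finset.range k, (j + 2) * N j := by
  induction k with
  | zero => simp
  | succ k ih =>
    rw [Finset.sum_range_succ N, Finset.sum_range_succ _ k, Finset.sum_range_add,
      ih fun i j hj => hc i j (by omega)]
    congr 1
    rw [Finset.sum_congr rfl fun i hi => hc _ k (by omega) (Nat.le_add_right _ _) (by
      rw [Finset.sum_range_succ]; have := Finset.mem_range.1 hi; omega)]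
    simp [mul_comm]

theorem Valid.sum_card_star_mark (hK : K.Valid) {N : ℕ →₀ ℕ}
    (hn : (N.sum fun _ m => m) = n) (hP : hK.toCurveType.HasProfile N) :
    ∑ i, Multiset.card (K.star (K.mark i)) = (N.sum fun k m => (k + 1) * m) + n := by
  obtain ⟨k, hk⟩ : ∃ k, N.support ⊆ Finset.range k := by
    refine ⟨N.support.sup id + 1, fun i hi => Finset.mem_range.2 ?_⟩
    have := Finset.le_sup (f := id) hi
    simp only [id] at this
    omega
  have hn' : ∑ l ∈ Finset.range k, N l = n := by
    rw [← hn, Finsupp.sum_of_support_subset _ hk _ (by simp)]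
  let c : ℕ → ℕ := fun i => if h : i < n then Multiset.card (K.star (K.mark ⟨i, h⟩)) else 0
  have h1 : ∑ i, Multiset.card (K.star (K.mark i)) = ∑ i ∈ Finset.range n, c i := by
    rw [Finset.sum_range]
    exact Finset.sum_congr rfl fun i _ => by simp [c]
  have hmono : ∀ j, j < k → ∑ l ∈ Finset.range (j + 1), N l ≤ n := by
    intro j hj
    rw [← hn']
    exact Finset.sum_le_sum_of_subset (Finset.range_subset_range.2 hj)
  have h2 := sum_range_blocks N c k fun i j hj h1 h2 => by
    have hi : i < n := h2.trans_le (hmono j hj)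
    simp only [c, dif_pos hi]
    rw [← hK.valency_toCurveType]
    exact hP ⟨i, hi⟩ j h1 h2
  rw [h1, ← hn', h2, Finsupp.sum_of_support_subset _ hk _ (by simp), ← Finset.sum_add_distrib]
  exact Finset.sum_congr rfl fun j _ => by ring

open Classical in
/-- The dimension count forces unmarked vertices to be trivalent. -/
theorem Valid.trivalent (hK : K.Valid) {N : ℕ →₀ ℕ} (hV : V + 1 = 2 * n)
    (hn : (N.sum fun _ m => m) = n) (hN : (N.sum fun k m => (k + 1) * m) + 1 = E)
    (hP : hK.toCurveType.HasProfile N) : K.Trivalent := by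
  have h1 := hK.sum_card_star
  have h2 := hK.sum_card_star_mark hn hP
  set M : Finset (Fin V) := Finset.univ.image K.mark with hM
  have hMc : M.card = n := by
    rw [hM, Finset.card_image_of_injective _ hK.mark_injective]; simp
  have h3 : ∑ v ∈ M, Multiset.card (K.star v) = ∑ i, Multiset.card (K.star (K.mark i)) := by
    rw [hM, Finset.sum_image fun i _ j _ h => hK.mark_injective h]
  have h4 := Finset.sum_add_sum_compl M fun v => Multiset.card (K.star v)
  have h5 : Mᶜ.card = V - n := by rw [Finset.card_compl, hMc]; simp
  have hmem : ∀ v, v ∈ Mᶜ ↔ ∀ i, K.mark i ≠ v := by intro v; simp [hM]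
  -- The marked valencies add up to `E - 1 + n`, which leaves `2 * V + E - 2 - (E - 1 + n) = 3 * (n
  -- - 1)` for the `V - n = n - 1` unmarked vertices. As each has valency at least three, equality
  -- holds everywhere.
  have h6 : ∑ v ∈ Mᶜ, 3 = ∑ v ∈ Mᶜ, Multiset.card (K.star v) := by
    rw [Finset.sum_const, h5, smul_eq_mul]
    omega
  have h7 := (Finset.sum_eq_sum_iff_of_le fun v hv => hK.three_le v ((hmem v).1 hv)).1 h6
  exact fun v hv => (h7 v ((hmem v).2 hv)).symm

theorem OnWall.symm {x : Fin n → ℝ × ℝ} (hx : K.OnWall a b x) (hK : K.Valid) : K.OnWall b a x :=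
  ⟨hx.1.symm, by rw [hK.length_symm]; exact hx.2.1, fun v w hvw hne =>
    hx.2.2 v w hvw (by rwa [Sym2.eq_swap (a := a)])⟩

/-- The type is valid and essential. -/
def Essential (D : Multiset (ℤ × ℤ)) (N : ℕ →₀ ℕ) (K : Shape n V E) : Prop :=
  ∃ h : K.Valid, h.toCurveType.IsEssential D N

theorem finite_essential (D : Multiset (ℤ × ℤ)) (N : ℕ →₀ ℕ) :
    {K : Shape n V E | K.Essential D N}.Finite :=
  (finite_valid D).subset fun _ ⟨h, he⟩ => ⟨h, he.1⟩

/-- The finite set of essential types. -/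
noncomputable def essentials (n V E : ℕ) (D : Multiset (ℤ × ℤ)) (N : ℕ →₀ ℕ) :
    Finset (Shape n V E) := (finite_essential D N).toFinset

theorem mem_essentials {D : Multiset (ℤ × ℤ)} {N : ℕ →₀ ℕ} :
    K ∈ essentials n V E D N ↔ K.Essential D N := by
  simp [essentials]

theorem Essential.good {D : Multiset (ℤ × ℤ)} {N : ℕ →₀ ℕ} (h : K.Essential D N) : K.Good :=
  let ⟨_, he⟩ := h; (good_of_isEssential _ he).2

theorem Essential.trivalent {D : Multiset (ℤ × ℤ)} {N : ℕ →₀ ℕ} (h : K.Essential D N)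
    (hn : (N.sum fun _ m => m) = n) (hN : (N.sum fun k m => (k + 1) * m) + 1 = Multiset.card D) :
    K.Trivalent := by
  obtain ⟨hK, he⟩ := h
  refine hK.trivalent (good_of_isEssential hK he).1 hn ?_ he.2.1
  have h1 : Finset.univ.val.map K.dir = D := he.1
  rw [hN, ← h1]
  simp

/-- Sliding preserves degree, number of vertices and valencies, and the slide from the wall supplies
a point of the open cell. -/
theorem Essential.reattach {D : Multiset (ℤ × ℤ)} {N : ℕ →₀ ℕ} (he : K.Essential D N)
    {x : Fin n → ℝ × ℝ} (hx : K.OnWall a b x) (hS : S ⊆ K.branches a b)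
    (hcard : S.card = (K.branchesAt a b).card) (hG' : (K.reattach hx.1.ne S).Good) :
    (K.reattach hx.1.ne S).Essential D N := by
  obtain ⟨hK, he⟩ := he
  obtain ⟨hV, hG⟩ := good_of_isEssential hK he
  obtain ⟨χ, hχ⟩ := hK.exists_isBranchCut hx.1
  have hK' := hK.reattach hx.1 hS hcard
  refine ⟨hK', isEssential_of_good hK' hV hG' (hx.isOpen_slide hG hK hχ) he.1 ?_⟩
  intro i k h1 h2
  have h3 := he.2.1 i k h1 h2
  have h4 := hK.valency_toCurveType (K.mark i)
  have h5 := hK'.valency_toCurveType (K.mark i)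
  rw [hK.card_star_reattach hx.1 hS hcard, ← h4] at h5
  exact h5.trans h3

/-! ### Cancellation over all essential types at a wall -/

variable {D : Multiset (ℤ × ℤ)} {N : ℕ →₀ ℕ}

open Classical in
/-- The signed sum over the essential types with markings of a given kind, unmarked `b`, and for
which the edge `ab` is the only one to shrink at `x`. -/
theorem sum_onWall_unmarked (hn : (N.sum fun _ m => m) = n)
    (hN : (N.sum fun k m => (k + 1) * m) + 1 = Multiset.card D) (hab : a ≠ b)
    (R : (Fin n → Fin V) → Prop) (x y : Fin n → ℝ × ℝ) :
    ∑ K ∈ (essentials n V E D N).filter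
        (fun K => K.OnWall a b x ∧ (∀ i, K.mark i ≠ b) ∧ R K.mark),
      K.weight * ((SignType.sign (K.length a b y) : SignType) : RatFunc ℚ) = 0 := by
  set A := (essentials n V E D N).filter
    (fun K => K.OnWall a b x ∧ (∀ i, K.mark i ≠ b) ∧ R K.mark) with hA
  have hmem : ∀ K, K ∈ A ↔ K.Essential D N ∧ K.OnWall a b x ∧ (∀ i, K.mark i ≠ b) ∧
      R K.mark := by
    intro K; rw [hA, Finset.mem_filter, mem_essentials]
  have hcard : ∀ K ∈ A, (K.branchesAt a b).card = 2 := by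
    intro K hK
    obtain ⟨he, hx, hb, hR⟩ := (hmem K).1 hK
    have := he.1.card_branchesAt hx.1
    rw [he.trivalent hn hN b hb] at this
    omega
  -- Group the types by the normal form in which all branches are attached to `a`; a group consists
  -- of the types that degenerate to the same contracted type.
  rw [← Finset.sum_fiberwise_of_maps_to (g := fun K => K.reattach hab ∅)
    (t := A.image fun K => K.reattach hab ∅) fun K hK => Finset.mem_image_of_mem _ hK]
  refine Finset.sum_eq_zero fun c hc => ?_
  rw [Finset.mem_image] at hc
  obtain ⟨K, hK, rfl⟩ := hc
  obtain ⟨he, hx, hb, hR⟩ := (hmem K).1 hK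
  rw [← he.good.sum_reattach he.1 (he.trivalent hn hN) hx.1 hb y]
  have hback : ∀ L ∈ A.filter (fun L => L.reattach hab ∅ = K.reattach hab ∅),
      L.branchesAt a b ⊆ K.branches a b ∧ K.reattach hab (L.branchesAt a b) = L := by
    intro L hL
    rw [Finset.mem_filter] at hL
    obtain ⟨he', hx', -⟩ := (hmem L).1 hL.1
    have hsub : L.branchesAt a b ⊆ K.branches a b := by
      rw [← K.reattach_branches hab ∅, ← hL.2, L.reattach_branches hab ∅]
      exact L.branchesAt_subset
    refine ⟨hsub, ?_⟩
    rw [← K.reattach_reattach hab ∅ hsub, ← hL.2, L.reattach_reattach hab ∅ L.branchesAt_subset]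
    exact he'.1.reattach_branchesAt hx'.1
  -- Inside a group a type is the set of two branches at `b`. Sets giving a type that is not good
  -- correspond to no member of the group, but their terms are zero.
  refine Finset.sum_bij_ne_zero (fun L _ _ => L.branchesAt a b) (fun L hL _ => ?_)
    (fun L hL _ L' hL' _ h => ?_) (fun S hS hne => ?_) fun L hL _ => ?_
  · exact Finset.mem_powersetCard.2 ⟨(hback L hL).1, hcard L (Finset.mem_filter.1 hL).1⟩
  · rw [← (hback L hL).2, ← (hback L' hL').2, h]
  · rw [Finset.mem_powersetCard] at hS
    have hG' : (K.reattach hab S).Good := by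
      by_contra hG'
      apply hne
      have h0 : (K.reattach hab S).length a b = 0 := dif_neg hG'
      rw [h0]
      simp
    have hS2 : S.card = (K.branchesAt a b).card := by rw [hS.2, hcard K hK]
    refine ⟨K.reattach hab S, ?_, hne, branchesAt_reattach hab hS.1⟩
    rw [Finset.mem_filter, hmem]
    exact ⟨⟨he.reattach hx hS.1 hS2 hG', hx.reattach he.good he.1 hG', hb, hR⟩,
      K.reattach_reattach hab S (Finset.empty_subset _)⟩
  · rw [(hback L hL).2]

open Classical in
/-- The signed sum over the essential types for which the edge `ab` is the only one to shrink. -/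
theorem sum_onWall (hn : (N.sum fun _ m => m) = n)
    (hN : (N.sum fun k m => (k + 1) * m) + 1 = Multiset.card D) (a b : Fin V)
    (x y : Fin n → ℝ × ℝ) :
    ∑ K ∈ (essentials n V E D N).filter (fun K => K.OnWall a b x),
      K.weight * ((SignType.sign (K.length a b y) : SignType) : RatFunc ℚ) = 0 := by
  by_cases hab : a = b
  · refine Finset.sum_eq_zero fun K hK => ?_
    exact absurd hab (Finset.mem_filter.1 hK).2.1.ne
  -- If `b` is marked, `a` is not, and the roles of the two vertices are exchanged. The extra
  -- predicate on the markings keeps the two cases disjoint; sliding preserves it because it does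
  -- not change the markings.
  rw [← Finset.sum_filter_add_sum_filter_not _ (fun K => ∀ i, K.mark i ≠ b), Finset.filter_filter,
    Finset.filter_filter]
  have h1 := sum_onWall_unmarked (E := E) hn hN hab (fun _ => True) x y
  have h2 := sum_onWall_unmarked (E := E) hn hN (Ne.symm hab) (fun m => ∃ i, m i = b) x y
  simp only [and_true] at h1
  rw [h1, zero_add, ← h2]
  refine Finset.sum_congr (Finset.ext fun K => ?_) fun K hK => ?_
  · simp only [Finset.mem_filter]
    refine and_congr_right fun hK => ?_
    have he := mem_essentials.1 hK
    push Not
    constructor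
    · rintro ⟨hx, i, hi⟩
      exact ⟨(hx.symm he.1), fun j hj => he.good.not_both_marked hx.1 hj hi, i, hi⟩
    · rintro ⟨hx, -, i, hi⟩
      exact ⟨(hx.symm he.1), i, hi⟩
  · simp only [Finset.mem_filter] at hK
    rw [(mem_essentials.1 hK.1).1.length_symm]

end Shape

/-! ### Crossing walls along a generic line -/

section Walls

variable {W : Type*} [AddCommGroup W] [Module ℝ W] {κ ε R : Type*} [Fintype ε] [CommRing R]

/-- Finitely many nonzero forms are all nonzero at some `y`. A small step from `x` along `y` leaves
the kernels that contain `x` and reaches no other. -/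
theorem exists_ne_zero_near [TopologicalSpace W] [ContinuousAdd W] [ContinuousSMul ℝ W]
    {ι : Type*} (I : Finset ι) (φ : ι → W →ₗ[ℝ] ℝ) (hφ : ∀ i ∈ I, φ i ≠ 0) (x : W)
    {P : W → Prop} (hP : ∀ᶠ z in 𝓝 x, P z) : ∃ z, P z ∧ ∀ i ∈ I, φ i z ≠ 0 := by
  obtain ⟨y, hy⟩ : ∃ y, ∀ i ∈ I, φ i y ≠ 0 := by
    obtain ⟨y, hy⟩ := Module.Dual.exists_forall_ne_zero_of_forall_exists (fun i : I => φ i)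
      fun i => by
        by_contra! h
        exact hφ i i.2 (LinearMap.ext h)
    exact ⟨y, fun i hi => hy ⟨i, hi⟩⟩
  have h1 : ∀ᶠ t : ℝ in 𝓝[≠] 0, P (x + t • y) := by
    have hc : Tendsto (fun t : ℝ => x + t • y) (𝓝 0) (𝓝 x) := by
      have : Continuous fun t : ℝ => x + t • y := by fun_prop
      simpa using this.tendsto 0
    exact (hc.eventually hP).filter_mono nhdsWithin_le_nhds
  have h2 : ∀ᶠ t : ℝ in 𝓝[≠] 0, ∀ i ∈ I, φ i (x + t • y) ≠ 0 := by
    rw [eventually_all_finset]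
    intro i hi
    by_cases hx : φ i x = 0
    · filter_upwards [self_mem_nhdsWithin] with t ht
      rw [map_add, map_smul, hx, zero_add, smul_eq_mul]
      exact mul_ne_zero ht (hy i hi)
    · have hc : ContinuousAt (fun t : ℝ => φ i x + t * φ i y) 0 := by fun_prop
      have := hc.eventually_ne (y := 0) (by simpa using hx)
      filter_upwards [this.filter_mono nhdsWithin_le_nhds] with t ht
      rwa [map_add, map_smul, smul_eq_mul]
  obtain ⟨t, ht⟩ := (h1.and h2).exists
  exact ⟨_, ht⟩

open Classical in
/-- The contribution of one chamber to the jump at a wall. -/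
theorem ite_sub_ite_eq_sum (ed : Finset ε) (c B : ε → ℝ) (hB : ∀ e ∈ ed, c e = 0 → B e ≠ 0)
    (huniq : ∀ e ∈ ed, ∀ e' ∈ ed, c e = 0 → c e' = 0 → e = e') (w : R) :
    (if ∀ e ∈ ed, 0 < c e ∨ (c e = 0 ∧ 0 < B e) then w else 0) -
      (if ∀ e ∈ ed, 0 < c e ∨ (c e = 0 ∧ B e < 0) then w else 0) =
    ∑ e, if e ∈ ed ∧ c e = 0 ∧ ∀ e' ∈ ed, e' ≠ e → 0 < c e' then
      w * ((SignType.sign (B e) : SignType) : R) else 0 := by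
  by_cases h0 : ∃ e ∈ ed, c e = 0
  · obtain ⟨e₀, he₀, hc₀⟩ := h0
    by_cases hpos : ∀ e' ∈ ed, e' ≠ e₀ → 0 < c e'
    · rw [Finset.sum_eq_single e₀]
      · have h1 : ∀ Q : ℝ → Prop, (∀ e ∈ ed, 0 < c e ∨ (c e = 0 ∧ Q (B e))) ↔ Q (B e₀) := by
          intro Q
          constructor
          · intro h
            rcases h e₀ he₀ with h | h
            · exact absurd hc₀ h.ne'
            · exact h.2
          · intro hQ e he
            by_cases hee : e = e₀
            · exact .inr ⟨hee ▸ hc₀, hee ▸ hQ⟩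
            · exact .inl (hpos e he hee)
        have h2 := h1 fun r => 0 < r
        have h3 := h1 fun r => r < 0
        rw [if_pos (show e₀ ∈ ed ∧ _ from ⟨he₀, hc₀, hpos⟩)]
        rcases lt_or_gt_of_ne (hB e₀ he₀ hc₀) with hl | hl
        · rw [if_neg (mt h2.1 hl.le.not_gt), if_pos (h3.2 hl), sign_neg hl]; simp
        · rw [if_pos (h2.2 hl), if_neg (mt h3.1 hl.le.not_gt), sign_pos hl]; simp
      · intro e _ hee
        exact if_neg fun h => (hpos e h.1 hee).ne' h.2.1
      · simp
    · push Not at hpos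
      obtain ⟨e₁, he₁, hne, hle⟩ := hpos
      have hlt : c e₁ < 0 := lt_of_le_of_ne hle fun h => hne (huniq _ he₁ _ he₀ h hc₀)
      have h1 : ∀ Q : ℝ → Prop, ¬ (∀ e ∈ ed, 0 < c e ∨ (c e = 0 ∧ Q (B e))) := by
        intro Q h
        rcases h e₁ he₁ with h | h
        · exact hle.not_gt h
        · exact hlt.ne h.1
      rw [if_neg (h1 fun r => 0 < r), if_neg (h1 fun r => r < 0), sub_zero]
      refine (Finset.sum_eq_zero fun e _ => if_neg fun h => ?_).symm
      have := huniq _ h.1 _ he₀ h.2.1 hc₀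
      subst this
      exact hle.not_gt (h.2.2 e₁ he₁ hne)
  · push Not at h0
    have h1 : ∀ Q : ℝ → Prop, (∀ e ∈ ed, 0 < c e ∨ (c e = 0 ∧ Q (B e))) ↔ ∀ e ∈ ed, 0 < c e :=
      fun Q => forall₂_congr fun e he => by simp [h0 e he]
    have h2 := h1 fun r => 0 < r
    have h3 := h1 fun r => r < 0
    rw [if_congr h2 rfl rfl, if_congr h3 rfl rfl, sub_self]
    exact (Finset.sum_eq_zero fun e _ => if_neg fun h => h0 e h.1 h.2.1).symm

open Classical in
/-- A weighted count of the cones containing a point does not jump along a line that meets the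
walls one at a time. -/
theorem count_eq_of_line (s : Finset κ) (ed : κ → Finset ε) (ℓ : κ → ε → W →ₗ[ℝ] ℝ) (w : κ → R)
    (hwall : ∀ e x y, ∑ K ∈ s, (if e ∈ ed K ∧ ℓ K e x = 0 ∧ ∀ e' ∈ ed K, e' ≠ e → 0 < ℓ K e' x then
      w K * ((SignType.sign (ℓ K e y) : SignType) : R) else 0) = 0)
    (x x' : W) (hx : ∀ K ∈ s, ∀ e ∈ ed K, ℓ K e x ≠ 0) (hx' : ∀ K ∈ s, ∀ e ∈ ed K, ℓ K e x' ≠ 0)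
    (hxx : ∀ K ∈ s, ∀ e ∈ ed K, ∀ e' ∈ ed K, e ≠ e' →
      ℓ K e x * ℓ K e' x' - ℓ K e' x * ℓ K e x' ≠ 0) :
    (∑ K ∈ s, if ∀ e ∈ ed K, 0 < ℓ K e x then w K else 0) =
      ∑ K ∈ s, if ∀ e ∈ ed K, 0 < ℓ K e x' then w K else 0 := by
  set A : κ → ε → ℝ := fun K e => ℓ K e x with hA
  set B : κ → ε → ℝ := fun K e => ℓ K e (x' - x) with hB
  have hc : ∀ K e (t : ℝ), ℓ K e (x + t • (x' - x)) = A K e + t * B K e := by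
    intro K e t
    rw [map_add, map_smul, smul_eq_mul]
  -- `g t` counts the cones that contain the points of the line immediately after `t`, so it is also
  -- meaningful at the parameters of the walls.
  set g : ℝ → R := fun t => ∑ K ∈ s, if ∀ e ∈ ed K, 0 < A K e + t * B K e ∨
    (A K e + t * B K e = 0 ∧ 0 < B K e) then w K else 0 with hg
  have hBne : ∀ t, ∀ K ∈ s, ∀ e ∈ ed K, A K e + t * B K e = 0 → B K e ≠ 0 := by
    intro t K hK e he h0 hB0
    rw [hB0, mul_zero, add_zero] at h0
    exact hx K hK e he h0
  -- Two forms of one cone that vanish at the same point of the line would have a vanishing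
  -- determinant at `x`, `x'`.
  have huniq : ∀ t, ∀ K ∈ s, ∀ e ∈ ed K, ∀ e' ∈ ed K, A K e + t * B K e = 0 →
      A K e' + t * B K e' = 0 → e = e' := by
    intro t K hK e he e' he' h1 h2
    by_contra hne
    apply hxx K hK e he e' he' hne
    have h3 : ℓ K e x' = A K e + B K e := by simp [hA, hB]
    have h4 : ℓ K e' x' = A K e' + B K e' := by simp [hA, hB]
    rw [h3, h4]
    change A K e * (A K e' + B K e') - A K e' * (A K e + B K e) = 0
    linear_combination B K e' * h1 - B K e * h2
  have hconst : IsLocallyConstant g := by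
    rw [IsLocallyConstant.iff_eventually_eq]
    intro t₀
    have hcont : ∀ K e, ContinuousAt (fun t : ℝ => A K e + t * B K e) t₀ := fun K e => by fun_prop
    have hev : ∀ᶠ t in 𝓝 t₀, ∀ K ∈ s, ∀ e ∈ ed K,
        (0 < A K e + t₀ * B K e → 0 < A K e + t * B K e) ∧
        (A K e + t₀ * B K e < 0 → A K e + t * B K e < 0) := by
      rw [eventually_all_finset]
      intro K _
      rw [eventually_all_finset]
      intro e _
      rcases lt_trichotomy (A K e + t₀ * B K e) 0 with h | h | h
      · filter_upwards [(hcont K e).eventually (gt_mem_nhds h)] with t ht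
        exact ⟨fun h' => absurd h' h.le.not_gt, fun _ => ht⟩
      · exact Eventually.of_forall fun t => ⟨fun h' => absurd h h'.ne', fun h' => absurd h h'.ne⟩
      · filter_upwards [(hcont K e).eventually (lt_mem_nhds h)] with t ht
        exact ⟨fun _ => ht, fun h' => absurd h' h.le.not_gt⟩
    filter_upwards [hev] with t ht
    have hsgn : ∀ K e, A K e + t * B K e = (A K e + t₀ * B K e) + (t - t₀) * B K e := by
      intro K e; ring
    rcases lt_trichotomy t t₀ with hlt | rfl | hlt
    -- Just before `t₀`, a form vanishing at `t₀` is positive exactly when it decreases. The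
    -- difference from `g t₀` is the sum over edges of the signed sums at the walls.
    · have hgt : g t = ∑ K ∈ s, if ∀ e ∈ ed K, 0 < A K e + t₀ * B K e ∨
          (A K e + t₀ * B K e = 0 ∧ B K e < 0) then w K else 0 := by
        refine Finset.sum_congr rfl fun K hK => if_congr (forall₂_congr fun e he => ?_) rfl rfl
        obtain ⟨hp, hm⟩ := ht K hK e he
        rcases lt_trichotomy (A K e + t₀ * B K e) 0 with h | h | h
        · simp [h.le.not_gt, (hm h).le.not_gt, h.ne, (hm h).ne]
        · have hb := hBne t₀ K hK e he h
          rw [hsgn, h, zero_add]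
          simp [hb, (sub_neg.2 hlt).ne, mul_pos_iff, sub_pos, sub_neg, hlt, hlt.le.not_gt]
        · simp [h, hp h]
      rw [hgt, eq_comm, ← sub_eq_zero, hg, ← Finset.sum_sub_distrib,
        Finset.sum_congr rfl fun K hK => ite_sub_ite_eq_sum (ed K) (fun e => A K e + t₀ * B K e)
          (B K) (hBne t₀ K hK) (huniq t₀ K hK) (w K), Finset.sum_comm]
      refine Finset.sum_eq_zero fun e _ => ?_
      have hw := hwall e (x + t₀ • (x' - x)) (x' - x)
      simp only [hc] at hw
      exact hw
    · rfl
    · refine Finset.sum_congr rfl fun K hK => if_congr (forall₂_congr fun e he => ?_) rfl rfl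
      obtain ⟨hp, hm⟩ := ht K hK e he
      rcases lt_trichotomy (A K e + t₀ * B K e) 0 with h | h | h
      · simp [h.le.not_gt, (hm h).le.not_gt, h.ne, (hm h).ne]
      · have hb := hBne t₀ K hK e he h
        rw [hsgn, h, zero_add]
        simp [hb, (sub_pos.2 hlt).ne', sub_pos, hlt]
      · simp [h, hp h]
  have h01 : g 0 = g 1 := hconst.apply_eq_of_isPreconnected isPreconnected_univ trivial trivial
  have h0 : g 0 = ∑ K ∈ s, if ∀ e ∈ ed K, 0 < ℓ K e x then w K else 0 := by
    refine Finset.sum_congr rfl fun K hK => if_congr (forall₂_congr fun e he => ?_) rfl rfl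
    have := hx K hK e he
    simp only [zero_mul, add_zero]
    simp [hA, this]
  have h1 : g 1 = ∑ K ∈ s, if ∀ e ∈ ed K, 0 < ℓ K e x' then w K else 0 := by
    refine Finset.sum_congr rfl fun K hK => if_congr (forall₂_congr fun e he => ?_) rfl rfl
    have := hx' K hK e he
    have h3 : A K e + 1 * B K e = ℓ K e x' := by simp [hA, hB]
    rw [h3]
    simp [this]
  rw [← h0, ← h1, h01]

open Classical in
/-- A weighted count of simplicial cones is the same at all points off the boundaries of the
cones if the signed sums at the walls vanish. -/
theorem count_eq_of_walls [TopologicalSpace W] [ContinuousAdd W] [ContinuousSMul ℝ W]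
    (s : Finset κ) (ed : κ → Finset ε) (ℓ : κ → ε → W →ₗ[ℝ] ℝ) (w : κ → R)
    (hℓ : ∀ K e, Continuous (ℓ K e))
    (hind : ∀ K ∈ s, ∀ e ∈ ed K, ∃ y, ℓ K e y = 1 ∧ ∀ e' ∈ ed K, e' ≠ e → ℓ K e' y = 0)
    (hwall : ∀ e x y, ∑ K ∈ s, (if e ∈ ed K ∧ ℓ K e x = 0 ∧ ∀ e' ∈ ed K, e' ≠ e → 0 < ℓ K e' x then
      w K * ((SignType.sign (ℓ K e y) : SignType) : R) else 0) = 0)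
    (x x' : W) (hx : ∀ K ∈ s, (∀ e ∈ ed K, 0 ≤ ℓ K e x) → ∀ e ∈ ed K, 0 < ℓ K e x)
    (hx' : ∀ K ∈ s, (∀ e ∈ ed K, 0 ≤ ℓ K e x') → ∀ e ∈ ed K, 0 < ℓ K e x') :
    (∑ K ∈ s, if ∀ e ∈ ed K, 0 < ℓ K e x then w K else 0) =
      ∑ K ∈ s, if ∀ e ∈ ed K, 0 < ℓ K e x' then w K else 0 := by
  -- For each cone either all forms are positive at `x` or some form is negative there, and both
  -- persist nearby. Thus both points can be moved into general position without changing the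
  -- counts.
  have hloc : ∀ x : W, (∀ K ∈ s, (∀ e ∈ ed K, 0 ≤ ℓ K e x) → ∀ e ∈ ed K, 0 < ℓ K e x) →
      ∀ᶠ z in 𝓝 x, (∑ K ∈ s, if ∀ e ∈ ed K, 0 < ℓ K e x then w K else 0) =
        ∑ K ∈ s, if ∀ e ∈ ed K, 0 < ℓ K e z then w K else 0 := by
    intro x hx
    have hev : ∀ᶠ z in 𝓝 x, ∀ K ∈ s, (∀ e ∈ ed K, 0 < ℓ K e x) ↔ ∀ e ∈ ed K, 0 < ℓ K e z := by
      rw [eventually_all_finset]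
      intro K hK
      by_cases h : ∀ e ∈ ed K, 0 < ℓ K e x
      · have : ∀ᶠ z in 𝓝 x, ∀ e ∈ ed K, 0 < ℓ K e z := by
          rw [eventually_all_finset]
          exact fun e he => (hℓ K e).continuousAt.eventually (lt_mem_nhds (h e he))
        filter_upwards [this] with z hz
        exact ⟨fun _ => hz, fun _ => h⟩
      · have h' := mt (hx K hK) h
        push Not at h'
        obtain ⟨e, he, hlt⟩ := h'
        filter_upwards [(hℓ K e).continuousAt.eventually (gt_mem_nhds hlt)] with z hz
        exact ⟨fun h' => absurd h' h, fun h' => absurd (h' e he) hz.le.not_gt⟩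
    filter_upwards [hev] with z hz
    exact Finset.sum_congr rfl fun K hK => if_congr (hz K hK) rfl rfl
  let I : Finset (κ × ε) := s.biUnion fun K => (ed K).image fun e => (K, e)
  have hI : ∀ K e, (K, e) ∈ I ↔ K ∈ s ∧ e ∈ ed K := by
    intro K e
    simp [I]
  obtain ⟨x₁, h1, h1'⟩ := exists_ne_zero_near I (fun p => ℓ p.1 p.2) (by
    rintro ⟨K, e⟩ hp h0
    rw [hI] at hp
    obtain ⟨y, hy, -⟩ := hind K hp.1 e hp.2
    rw [show ℓ K e = 0 from h0] at hy
    simp at hy) x (hloc x hx)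
  let J : Finset (κ × ε × ε) := s.biUnion fun K => ((ed K) ×ˢ (ed K)).image fun e => (K, e)
  have hJ : ∀ K e e', (K, e, e') ∈ J ↔ K ∈ s ∧ e ∈ ed K ∧ e' ∈ ed K := by
    intro K e e'
    simp [J]
  -- The diagonal entries keep `x₂` off all hyperplanes. The others prevent the line from `x₁` from
  -- meeting two facets of one cone at once; they are nonzero forms because the forms of a cone are
  -- independent and do not vanish at `x₁`.
  obtain ⟨x₂, h2, h2'⟩ := exists_ne_zero_near J
    (fun p => if p.2.1 = p.2.2 then ℓ p.1 p.2.1 else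
      ℓ p.1 p.2.1 x₁ • ℓ p.1 p.2.2 - ℓ p.1 p.2.2 x₁ • ℓ p.1 p.2.1) (by
    rintro ⟨K, e, e'⟩ hp h0
    rw [hJ] at hp
    dsimp only at h0
    split_ifs at h0 with he
    · obtain ⟨y, hy, -⟩ := hind K hp.1 e hp.2.1
      rw [h0] at hy
      simp at hy
    · obtain ⟨y, hy, hy'⟩ := hind K hp.1 e' hp.2.2
      have := LinearMap.congr_fun h0 y
      simp only [LinearMap.sub_apply, LinearMap.smul_apply, smul_eq_mul, hy, hy' e hp.2.1 he,
        mul_one, mul_zero, sub_zero, LinearMap.zero_apply] at this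
      exact h1' (K, e) ((hI K e).2 ⟨hp.1, hp.2.1⟩) this) x' (hloc x' hx')
  rw [h1, h2]
  refine count_eq_of_line s ed ℓ w hwall x₁ x₂ (fun K hK e he => h1' (K, e) ((hI K e).2 ⟨hK, he⟩))
    (fun K hK e he => ?_) fun K hK e he e' he' hne => ?_
  · have := h2' (K, e, e) ((hJ K e e).2 ⟨hK, he, he⟩)
    simpa using this
  · have := h2' (K, e, e') ((hJ K e e').2 ⟨hK, he, he'⟩)
    dsimp only at this
    rwa [if_neg hne, LinearMap.sub_apply, LinearMap.smul_apply, LinearMap.smul_apply, smul_eq_mul,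
      smul_eq_mul] at this

end Walls

/-! ### Invariance of the labelled count -/

namespace Shape

variable {n V E : ℕ} {K : Shape n V E} {D : Multiset (ℤ × ℤ)} {N : ℕ →₀ ℕ}

/-- The type is realized by a curve through `x`. -/
def PassesThrough (K : Shape n V E) (x : Fin n → ℝ × ℝ) : Prop :=
  ∀ v w, K.graph.Adj v w → 0 < K.length v w x

open Classical in
/-- The weighted number of the labelled essential types that are realized by a curve through `x`. -/
noncomputable def count (V E : ℕ) (D : Multiset (ℤ × ℤ)) (N : ℕ →₀ ℕ) (x : Fin n → ℝ × ℝ) :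
    RatFunc ℚ :=
  ∑ K ∈ (essentials n V E D N).filter (PassesThrough · x), K.weight

/-- What genericity contributes to the invariance: a point of the closed cell over `x` lies in the
open cell, so `x` is on the boundary of no cone. -/
theorem Essential.pos_of_nonneg (h : K.Essential D N) {x : Fin n → ℝ × ℝ}
    (hx : x ∈ genericConfigurations n D N) (h0 : ∀ v w, K.graph.Adj v w → 0 ≤ K.length v w x) :
    K.PassesThrough x := by
  have hG := h.good
  obtain ⟨hK, he⟩ := h
  obtain ⟨len, h1, h2, h3, h4⟩ := exists_lengths hK (P := fun t => 0 ≤ t) (p := hG.solve x)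
    fun v w hvw => ⟨K.length v w x, h0 v w hvw, by
      rw [hG.length_apply]; exact hG.eq_add_len (hG.solve_mem x) hvw⟩
  have hev : hK.toCurveType.ev (hG.solve x, len) = x := hG.evMap_solve x
  have hq := hx hK.toCurveType he (hG.solve x, len) ⟨h1, h2, h3, h4⟩ hev
  exact (hG.mem_image_openCell_iff hK x).1 ⟨_, hq.1, hev⟩

open Classical in
/-- The edges, each with one of its orientations. -/
noncomputable def edges (K : Shape n V E) : Finset (Fin V × Fin V) :=
  Finset.univ.filter fun p => p.1 < p.2 ∧ K.graph.Adj p.1 p.2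

theorem mem_edges {p : Fin V × Fin V} : p ∈ K.edges ↔ p.1 < p.2 ∧ K.graph.Adj p.1 p.2 := by
  simp [edges]

theorem Valid.forall_edges_iff (hK : K.Valid) {Q : ℝ → Prop} {x : Fin n → ℝ × ℝ} :
    (∀ p ∈ K.edges, Q (K.length p.1 p.2 x)) ↔ ∀ v w, K.graph.Adj v w → Q (K.length v w x) := by
  refine ⟨fun h v w hvw => ?_, fun h p hp => h _ _ (mem_edges.1 hp).2⟩
  rcases lt_or_gt_of_ne hvw.ne with hlt | hlt
  · exact h (v, w) (mem_edges.2 ⟨hlt, hvw⟩)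
  · rw [hK.length_symm w v]
    exact h (w, v) (mem_edges.2 ⟨hlt, hvw.symm⟩)

theorem Valid.onWall_iff (hK : K.Valid) {a b : Fin V} (hab : a < b) {x : Fin n → ℝ × ℝ} :
    ((a, b) ∈ K.edges ∧ K.length a b x = 0 ∧
      ∀ p ∈ K.edges, p ≠ (a, b) → 0 < K.length p.1 p.2 x) ↔ K.OnWall a b x := by
  rw [mem_edges]
  refine ⟨fun ⟨h1, h2, h3⟩ => ⟨h1.2, h2, fun v w hvw hne => ?_⟩, fun ⟨h1, h2, h3⟩ =>
    ⟨⟨hab, h1⟩, h2, fun p hp hne => h3 _ _ (mem_edges.1 hp).2 fun h => hne ?_⟩⟩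
  · rcases lt_or_gt_of_ne hvw.ne with hlt | hlt
    · exact h3 (v, w) (mem_edges.2 ⟨hlt, hvw⟩) fun h => hne (by
        rw [Prod.mk.injEq] at h; rw [h.1, h.2])
    · rw [hK.length_symm w v]
      exact h3 (w, v) (mem_edges.2 ⟨hlt, hvw.symm⟩) fun h => hne (by
        rw [Prod.mk.injEq] at h; rw [h.1, h.2, Sym2.eq_swap])
  · rcases Sym2.eq_iff.1 h with ⟨h, h'⟩ | ⟨h, h'⟩
    · exact Prod.ext h h'
    · have := (mem_edges.1 hp).1
      rw [h, h'] at this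
      exact absurd this hab.not_gt

open Classical in
theorem count_eq (hn : (N.sum fun _ m => m) = n)
    (hN : (N.sum fun k m => (k + 1) * m) + 1 = Multiset.card D) {x x' : Fin n → ℝ × ℝ}
    (hx : x ∈ genericConfigurations n D N) (hx' : x' ∈ genericConfigurations n D N) :
    count V E D N x = count V E D N x' := by
  have hc : ∀ x : Fin n → ℝ × ℝ, count V E D N x = ∑ K ∈ essentials n V E D N,
      if ∀ p ∈ K.edges, 0 < K.length p.1 p.2 x then K.weight else 0 := by
    intro x
    rw [count, Finset.sum_filter]
    exact Finset.sum_congr rfl fun K hK =>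
      if_congr ((mem_essentials.1 hK).1.forall_edges_iff (Q := fun t => 0 < t)).symm rfl rfl
  rw [hc, hc]
  have hgen : ∀ x ∈ genericConfigurations n D N, ∀ K ∈ essentials n V E D N,
      (∀ p ∈ K.edges, 0 ≤ K.length p.1 p.2 x) → ∀ p ∈ K.edges, 0 < K.length p.1 p.2 x := by
    intro x hx K hK h
    have he := mem_essentials.1 hK
    rw [he.1.forall_edges_iff (Q := fun t => 0 < t)]
    exact he.pos_of_nonneg hx ((he.1.forall_edges_iff (Q := fun t => 0 ≤ t)).1 h)
  have hcont : ∀ (K : Shape n V E) (p : Fin V × Fin V), Continuous (K.length p.1 p.2) :=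
    fun K p => LinearMap.continuous_of_finiteDimensional _
  have hind : ∀ K ∈ essentials n V E D N, ∀ p ∈ K.edges, ∃ y, K.length p.1 p.2 y = 1 ∧
      ∀ q ∈ K.edges, q ≠ p → K.length q.1 q.2 y = 0 := by
    intro K hK p hp
    have he := mem_essentials.1 hK
    obtain ⟨y, hy, hy'⟩ := he.good.exists_length_eq he.1 (mem_edges.1 hp).2
    refine ⟨y, hy, fun q hq hne => hy' _ _ (mem_edges.1 hq).2 fun h => hne ?_⟩
    rcases Sym2.eq_iff.1 h with ⟨h, h'⟩ | ⟨h, h'⟩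
    · exact Prod.ext h h'
    · have h1 := (mem_edges.1 hq).1
      rw [h, h'] at h1
      exact absurd h1 (mem_edges.1 hp).1.not_gt
  have key := count_eq_of_walls (essentials n V E D N) edges (fun K p => K.length p.1 p.2) weight
    hcont hind (fun p x y => ?_) x x' (hgen x hx) (hgen x' hx')
  · convert key
  · by_cases hlt : p.1 < p.2
    · refine Eq.trans ?_ (sum_onWall (E := E) hn hN p.1 p.2 x y)
      rw [Finset.sum_filter]
      refine Finset.sum_congr rfl fun K hK => ?_
      have hiff := (mem_essentials.1 hK).1.onWall_iff (x := x) hlt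
      by_cases hw : K.OnWall p.1 p.2 x
      · rw [if_pos hw]
        exact if_pos (hiff.2 hw)
      · rw [if_neg hw]
        exact if_neg (mt hiff.1 hw)
    · exact Finset.sum_eq_zero fun K _ => if_neg fun h => hlt (mem_edges.1 h.1).1

end Shape

/-! ### Renaming vertices and ends -/

namespace Shape

variable {n V E : ℕ} {K : Shape n V E} {D : Multiset (ℤ × ℤ)} {N : ℕ →₀ ℕ}

/-- Renaming the vertices and the ends. -/
def relabel (K : Shape n V E) (σ : Equiv.Perm (Fin V)) (τ : Equiv.Perm (Fin E)) : Shape n V E where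
  graph := K.graph.comap σ.symm
  foot e := σ (K.foot (τ.symm e))
  mark i := σ (K.mark i)
  slope v w := K.slope (σ.symm v) (σ.symm w)
  dir e := K.dir (τ.symm e)

variable (σ : Equiv.Perm (Fin V)) (τ : Equiv.Perm (Fin E))

theorem relabel_adj {v w : Fin V} :
    (K.relabel σ τ).graph.Adj (σ v) (σ w) ↔ K.graph.Adj v w := by
  simp [relabel]

theorem relabel_slope (v w : Fin V) : (K.relabel σ τ).slope (σ v) (σ w) = K.slope v w := by
  simp [relabel]

theorem star_relabel (v : Fin V) : (K.relabel σ τ).star (σ v) = K.star v := by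
  classical
  rw [star, star]
  congr 1
  · rw [← Equiv.sum_comp σ]
    simp only [relabel_adj, relabel_slope]
  · rw [← Equiv.sum_comp τ]
    simp [relabel]

theorem Valid.relabel (hK : K.Valid) : (K.relabel σ τ).Valid where
  isTree := by
    have e : (K.relabel σ τ).graph ≃g K.graph := ⟨σ.symm, Iff.rfl⟩
    exact e.isTree_iff.2 hK.isTree
  mark_injective := σ.injective.comp hK.mark_injective
  two_le v := by
    obtain ⟨v, rfl⟩ := σ.surjective v
    rw [star_relabel]
    exact hK.two_le v
  three_le v hv := by
    obtain ⟨v, rfl⟩ := σ.surjective v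
    rw [star_relabel]
    exact hK.three_le v fun i hi => hv i (congrArg σ hi)
  slope_symm v w := hK.slope_symm _ _
  slope_of_not_adj v w h := hK.slope_of_not_adj _ _ h
  dir_ne_zero e := hK.dir_ne_zero _
  sum_star v := by
    obtain ⟨v, rfl⟩ := σ.surjective v
    rw [star_relabel]
    exact hK.sum_star v

theorem mem_maps_relabel {p : Fin V → ℝ × ℝ} :
    p ∈ (K.relabel σ τ).maps ↔ p ∘ σ ∈ K.maps := by
  constructor
  · intro h v w hvw
    obtain ⟨t, ht⟩ := h (σ v) (σ w) ((relabel_adj σ τ).2 hvw)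
    exact ⟨t, by rwa [relabel_slope] at ht⟩
  · intro h v w hvw
    obtain ⟨v, rfl⟩ := σ.surjective v
    obtain ⟨w, rfl⟩ := σ.surjective w
    obtain ⟨t, ht⟩ := h v w ((relabel_adj σ τ).1 hvw)
    exact ⟨t, by rwa [relabel_slope]⟩

theorem evMap_relabel (p : Fin V → ℝ × ℝ) : (K.relabel σ τ).evMap p = K.evMap (p ∘ σ) := rfl

theorem IsOpen.relabel {p : Fin V → ℝ × ℝ} (h : K.IsOpen p) :
    (K.relabel σ τ).IsOpen (p ∘ σ.symm) := by
  intro v w hvw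
  obtain ⟨v, rfl⟩ := σ.surjective v
  obtain ⟨w, rfl⟩ := σ.surjective w
  obtain ⟨t, ht, he⟩ := h v w ((relabel_adj σ τ).1 hvw)
  exact ⟨t, ht, by simpa [relabel_slope] using he⟩

theorem Good.relabel (hG : K.Good) : (K.relabel σ τ).Good where
  slope_ne_zero v w h := hG.slope_ne_zero _ _ h
  injective p hp h0 := by
    have := hG.injective (p ∘ σ) ((mem_maps_relabel σ τ).1 hp) h0
    funext v
    obtain ⟨v, rfl⟩ := σ.surjective v
    exact congrFun this v
  surjective x := by
    obtain ⟨p, hp, hx⟩ := hG.surjective x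
    refine ⟨p ∘ σ.symm, (mem_maps_relabel σ τ).2 ?_, ?_⟩
    · rwa [Function.comp_assoc, Equiv.symm_comp_self, Function.comp_id]
    · rwa [evMap_relabel, Function.comp_assoc, Equiv.symm_comp_self, Function.comp_id]

theorem Good.passesThrough_iff (hG : K.Good) {x : Fin n → ℝ × ℝ} :
    K.PassesThrough x ↔ ∃ p, K.IsOpen p ∧ K.evMap p = x := by
  constructor
  · intro h
    refine ⟨hG.solve x, (hG.isOpen_iff (hG.solve_mem x)).2 fun v w hvw => ?_, hG.evMap_solve x⟩
    rw [← hG.length_apply]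
    exact h v w hvw
  · rintro ⟨p, hp, rfl⟩ v w hvw
    rw [hG.length_evMap _ _ hp.mem_maps]
    exact (hG.isOpen_iff hp.mem_maps).1 hp v w hvw

theorem Essential.relabel (h : K.Essential D N) {x : Fin n → ℝ × ℝ} (hx : K.PassesThrough x) :
    (K.relabel σ τ).Essential D N ∧ (K.relabel σ τ).PassesThrough x := by
  obtain ⟨hK, he⟩ := h
  obtain ⟨hV, hG⟩ := good_of_isEssential hK he
  have hG' := hG.relabel σ τ
  have hK' := hK.relabel σ τ
  obtain ⟨p, hp, hpx⟩ := hG.passesThrough_iff.1 hx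
  have hp' := hp.relabel σ τ
  refine ⟨⟨hK', isEssential_of_good hK' hV hG' hp' ?_ fun i k h1 h2 => ?_⟩,
    hG'.passesThrough_iff.2 ⟨_, hp', ?_⟩⟩
  · rw [← show Finset.univ.val.map K.dir = D from he.1]
    have h1 : (K.relabel σ τ).dir = K.dir ∘ τ.symm := rfl
    rw [h1, ← Multiset.map_map, ← Finset.map_univ_equiv τ.symm]
    simp
  · have h3 := he.2.1 i k h1 h2
    have h4 := hK.valency_toCurveType (K.mark i)
    have h5 := hK'.valency_toCurveType (σ (K.mark i))
    rw [star_relabel, ← h4] at h5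
    exact h5.trans h3
  · rw [evMap_relabel, Function.comp_assoc, Equiv.symm_comp_self, Function.comp_id, hpx]

/-- The metric data of a curve are determined by the positions of the marked points. -/
theorem Good.params_unique (hG : K.Good) (hK : K.Valid) {q q' : hK.toCurveType.Params}
    (hq : q ∈ hK.toCurveType.openCell) (hq' : q' ∈ hK.toCurveType.openCell)
    (he : hK.toCurveType.ev q = hK.toCurveType.ev q') : q = q' := by
  have h1 : q.1 = q'.1 := hG.eq_of_evMap_eq (isOpen_of_mem_openCell hK hq).mem_maps
    (isOpen_of_mem_openCell hK hq').mem_maps he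
  refine Prod.ext h1 (funext fun v => funext fun w => ?_)
  by_cases hvw : K.graph.Adj v w
  · have h2 := len_eq (hG.slope_ne_zero v w hvw) (hq.1.2.2.2 v w hvw)
    have h3 := len_eq (hG.slope_ne_zero v w hvw) (hq'.1.2.2.2 v w hvw)
    rw [← h2, ← h3, h1]
  · rw [hq.1.2.1 v w hvw, hq'.1.2.1 v w hvw]

/-- The curve of an essential type through `x`. -/
noncomputable def Essential.realize (h : K.Essential D N) {x : Fin n → ℝ × ℝ}
    (hx : K.PassesThrough x) : PlaneCurve n where
  toCurveType := h.1.toCurveType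
  params := ((h.good.mem_image_openCell_iff h.1 x).2 hx).choose
  params_mem := ((h.good.mem_image_openCell_iff h.1 x).2 hx).choose_spec.1

theorem Essential.ev_realize (h : K.Essential D N) {x : Fin n → ℝ × ℝ}
    (hx : K.PassesThrough x) : h.1.toCurveType.ev (h.realize hx).params = x :=
  ((h.good.mem_image_openCell_iff h.1 x).2 hx).choose_spec.2

/-- A renaming respects the metric data automatically, since these are determined by the type and
the marked points; isomorphisms are therefore purely combinatorial. -/
theorem Essential.exists_iso_iff {K' : Shape n V E} (h : K.Essential D N) (h' : K'.Essential D N)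
    {x : Fin n → ℝ × ℝ} (hx : K.PassesThrough x) (hx' : K'.PassesThrough x) :
    (∃ f : PlaneCurve.Iso (h.realize hx) (h'.realize hx'), f.onVerts = σ ∧ f.onEnds = τ) ↔
      K.relabel σ τ = K' := by
  constructor
  · rintro ⟨f, rfl, rfl⟩
    refine Shape.ext ?_ ?_ ?_ ?_ ?_
    · ext v w
      obtain ⟨v, rfl⟩ := f.onVerts.surjective v
      obtain ⟨w, rfl⟩ := f.onVerts.surjective w
      exact (relabel_adj f.onVerts f.onEnds).trans (f.adj_iff v w).symm
    · funext e
      obtain ⟨e, rfl⟩ := f.onEnds.surjective e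
      refine Eq.trans ?_ (f.map_foot e).symm
      exact congrArg f.onVerts (congrArg K.foot (f.onEnds.symm_apply_apply e))
    · funext i
      exact (f.map_mark i).symm
    · funext v w
      obtain ⟨v, rfl⟩ := f.onVerts.surjective v
      obtain ⟨w, rfl⟩ := f.onVerts.surjective w
      exact (relabel_slope f.onVerts f.onEnds v w).trans (f.map_slope v w).symm
    · funext e
      obtain ⟨e, rfl⟩ := f.onEnds.surjective e
      refine Eq.trans ?_ (f.map_dir e).symm
      exact congrArg K.dir (f.onEnds.symm_apply_apply e)
  · rintro rfl
    have hq := (h.realize hx).params_mem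
    have hq' := (h'.realize hx').params_mem
    set q := (h.realize hx).params with hqd
    set q' := (h'.realize hx').params with hqd'
    have hmem : (⟨fun v => q'.1 (σ v), fun v w => q'.2 (σ v) (σ w)⟩ : h.1.toCurveType.Params) ∈
        h.1.toCurveType.openCell := by
      refine ⟨⟨fun v w => hq'.1.1 _ _, fun v w hvw => ?_, fun v w hvw => ?_, fun v w hvw => ?_⟩,
        fun v w hvw => ?_⟩
      · exact hq'.1.2.1 _ _ (mt (relabel_adj σ τ).1 hvw)
      · exact hq'.1.2.2.1 _ _ ((relabel_adj σ τ).2 hvw)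
      · have := hq'.1.2.2.2 _ _ ((relabel_adj σ τ).2 hvw)
        have hs : (h'.realize hx').slope (σ v) (σ w) = (h.realize hx).slope v w :=
          relabel_slope σ τ v w
        rw [hs] at this
        exact this
      · exact hq'.2 _ _ ((relabel_adj σ τ).2 hvw)
    have heq := h.good.params_unique h.1 hmem hq
      (Eq.trans (h'.ev_realize hx') (h.ev_realize hx).symm)
    refine ⟨⟨σ, τ, fun v w => relabel_adj σ τ, fun e => ?_, fun i => rfl, fun v w => ?_,
      fun v => ?_, fun v w => relabel_slope σ τ v w, fun e => ?_⟩, rfl, rfl⟩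
    · exact congrArg σ (congrArg K.foot (τ.symm_apply_apply e))
    · exact congrFun (congrFun (congrArg Prod.snd heq) v) w
    · exact congrFun (congrArg Prod.fst heq) v
    · exact congrArg K.dir (τ.symm_apply_apply e)

end Shape

/-! ### Isomorphism classes as orbits of renamings -/

namespace Shape

variable {n V E : ℕ} {K : Shape n V E} {D : Multiset (ℤ × ℤ)} {N : ℕ →₀ ℕ}

theorem iso_ext {C C' : PlaneCurve n} {f g : PlaneCurve.Iso C C'} (h1 : f.onVerts = g.onVerts)
    (h2 : f.onEnds = g.onEnds) : f = g := by
  cases f; cases g; cases h1; cases h2; rfl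

open Classical in
theorem Essential.card_iso {K' : Shape n V E} (h : K.Essential D N) (h' : K'.Essential D N)
    {x : Fin n → ℝ × ℝ} (hx : K.PassesThrough x) (hx' : K'.PassesThrough x) :
    Nat.card (PlaneCurve.Iso (h.realize hx) (h'.realize hx')) =
      (Finset.univ.filter fun g : Equiv.Perm (Fin V) × Equiv.Perm (Fin E) =>
        K.relabel g.1 g.2 = K').card := by
  let e : PlaneCurve.Iso (h.realize hx) (h'.realize hx') →
      {g : Equiv.Perm (Fin V) × Equiv.Perm (Fin E) // K.relabel g.1 g.2 = K'} := fun f =>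
    ⟨(f.onVerts, f.onEnds), (h.exists_iso_iff _ _ h' hx hx').1 ⟨f, rfl, rfl⟩⟩
  have he : Function.Bijective e := by
    refine ⟨fun f g hfg => ?_, fun g => ?_⟩
    · have h1 := congrArg Subtype.val hfg
      exact iso_ext (congrArg Prod.fst h1) (congrArg Prod.snd h1)
    · obtain ⟨f, h1, h2⟩ := (h.exists_iso_iff _ _ h' hx hx').2 g.2
      exact ⟨f, Subtype.ext (Prod.ext h1 h2)⟩
  rw [Nat.card_congr (Equiv.ofBijective e he), Nat.card_eq_fintype_card, Fintype.card_subtype]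

/-- The isomorphism class of the curve of an essential type through `x`. -/
noncomputable def curveClass (D : Multiset (ℤ × ℤ)) (N : ℕ →₀ ℕ) (x : Fin n → ℝ × ℝ)
    (K : {K : Shape n V E // K.Essential D N ∧ K.PassesThrough x}) :
    Quotient (PlaneCurve.isoSetoid n) :=
  Quotient.mk _ (K.2.1.realize K.2.2)

/-- Being essential forces `V + 1 = 2 * n`, so all curves in question can be labelled by the same
sets. The truncated subtraction at `n = 0` is harmless, as both sides are then empty. -/
theorem curvesThrough_eq_range (x : Fin n → ℝ × ℝ) (hV : V = 2 * n - 1) (hE : E = Multiset.card D) :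
    curvesThrough D N x = Set.range (curveClass (V := V) (E := E) D N x) := by
  ext c
  constructor
  · rintro ⟨C, hC, hx, rfl⟩
    have hCV : C.numVerts = V := by
      obtain ⟨K, hK, hT⟩ := exists_toCurveType_eq C.toCurveType rfl rfl
      rw [← hT] at hC
      have := (good_of_isEssential hK hC).1
      omega
    have hCE : C.numEnds = E := by
      rw [hE, ← hC.1, CurveType.degree]
      simp
    obtain ⟨K, hK, hT⟩ := exists_toCurveType_eq C.toCurveType hCV hCE
    obtain ⟨T, q, hq⟩ := C
    dsimp only at hT
    subst hT
    have he : K.Essential D N := ⟨hK, hC⟩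
    have hp : K.PassesThrough x := (he.good.mem_image_openCell_iff hK x).1 ⟨q, hq, hx⟩
    refine ⟨⟨K, he, hp⟩, ?_⟩
    have : he.realize hp = ⟨hK.toCurveType, q, hq⟩ := by
      have := he.good.params_unique hK (he.realize hp).params_mem hq
        ((he.ev_realize hp).trans hx.symm)
      subst this
      rfl
    rw [curveClass, this]
  · rintro ⟨⟨K, he, hp⟩, rfl⟩
    exact ⟨he.realize hp, he.2, he.ev_realize hp, rfl⟩

theorem classWeight_curveClass {x : Fin n → ℝ × ℝ}
    (K : {K : Shape n V E // K.Essential D N ∧ K.PassesThrough x}) :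
    PlaneCurve.classWeight (curveClass D N x K) =
      (Nat.card (PlaneCurve.Iso (K.2.1.realize K.2.2) (K.2.1.realize K.2.2)) : RatFunc ℚ)⁻¹ *
        K.1.weight := by
  rw [← K.2.1.1.prod_vertexWeight_toCurveType]
  rfl

instance finite_isos (C C' : PlaneCurve n) : Finite (PlaneCurve.Iso C C') :=
  Finite.of_injective (fun f => (f.onVerts, f.onEnds)) fun _ _ h =>
    iso_ext (congrArg Prod.fst h) (congrArg Prod.snd h)

theorem card_iso_eq {C C' : PlaneCurve n} (f : PlaneCurve.Iso C C') :
    Nat.card (PlaneCurve.Iso C C') = Nat.card (PlaneCurve.Iso C' C') := by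
  refine Nat.card_congr ⟨fun g => f.symm.trans g, fun g => f.trans g, fun g => ?_, fun g => ?_⟩ <;>
  · refine iso_ext ?_ ?_ <;> ext <;> simp [PlaneCurve.Iso.trans, PlaneCurve.Iso.symm]

instance finite_passesThrough (x : Fin n → ℝ × ℝ) :
    Finite {K : Shape n V E // K.Essential D N ∧ K.PassesThrough x} :=
  ((finite_essential D N).subset fun _ h => h.1).to_subtype

open Classical in
/-- The labelled count is a multiple of the count of isomorphism classes. -/
theorem count_eq_mul_refinedCount (x : Fin n → ℝ × ℝ) (hV : V = 2 * n - 1)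
    (hE : E = Multiset.card D) :
    count V E D N x = (V.factorial * E.factorial : ℕ) * refinedCount D N x := by
  let Q := {K : Shape n V E // K.Essential D N ∧ K.PassesThrough x}
  have : Fintype Q := Fintype.ofFinite _
  have hcount : count V E D N x = ∑ K : Q, K.1.weight := by
    rw [count]
    exact Finset.sum_subtype _ (fun K => by rw [Finset.mem_filter, mem_essentials]) _
  have href : refinedCount D N x = ∑ c ∈ Finset.univ.image (fun K : Q => curveClass D N x K),
      PlaneCurve.classWeight c := by
    rw [refinedCount, curvesThrough_eq_range x hV hE, ← finsum_mem_coe_finset]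
    simp only [Finset.coe_image, Finset.coe_univ, Set.image_univ]
  rw [hcount, href, Finset.mul_sum, ← Finset.sum_fiberwise_of_maps_to
    (g := fun K : Q => curveClass D N x K) (t := Finset.univ.image fun K : Q => curveClass D N x K)
    fun K hK => Finset.mem_image_of_mem _ hK]
  refine Finset.sum_congr rfl fun c hc => ?_
  obtain ⟨K₀, -, rfl⟩ := Finset.mem_image.1 hc
  set F := Finset.univ.filter fun K : Q => curveClass D N x K = curveClass D N x K₀ with hF
  -- The renamings that carry `K₀` to `K` correspond to the isomorphisms between the two curves,
  -- which are as many as the automorphisms. Their number cancels the denominator of the class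
  -- weight.
  have h1 : ∀ K ∈ F, K.1.weight = ((Finset.univ.filter
      fun g : Equiv.Perm (Fin V) × Equiv.Perm (Fin E) => K₀.1.relabel g.1 g.2 = K.1).card : RatFunc ℚ)
        * PlaneCurve.classWeight (curveClass D N x K₀) := by
    intro K hK
    have hcl : curveClass D N x K = curveClass D N x K₀ := (Finset.mem_filter.1 hK).2
    obtain ⟨f⟩ : Nonempty (PlaneCurve.Iso (K₀.2.1.realize K₀.2.2) (K.2.1.realize K.2.2)) :=
      Quotient.exact hcl.symm
    rw [← K₀.2.1.card_iso K.2.1 K₀.2.2 K.2.2, card_iso_eq f, ← hcl, classWeight_curveClass]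
    have : Nonempty (PlaneCurve.Iso (K.2.1.realize K.2.2) (K.2.1.realize K.2.2)) :=
      ⟨PlaneCurve.Iso.refl _⟩
    rw [mul_inv_cancel_left₀ (Nat.cast_ne_zero.2 Nat.card_pos.ne')]
  rw [Finset.sum_congr rfl h1, ← Finset.sum_mul, ← Nat.cast_sum]
  congr 2
  -- The sets of renamings from `K₀` to the members of its class partition all `V! * E!` renamings.
  let r : Equiv.Perm (Fin V) × Equiv.Perm (Fin E) → Q := fun g =>
    ⟨K₀.1.relabel g.1 g.2, K₀.2.1.relabel g.1 g.2 K₀.2.2⟩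
  have h2 := Finset.card_eq_sum_card_fiberwise (s := Finset.univ) (t := F) (f := r) fun g _ => by
    obtain ⟨f, -⟩ := (K₀.2.1.exists_iso_iff g.1 g.2 (r g).2.1 K₀.2.2 (r g).2.2).2 rfl
    simp only [hF, Finset.coe_filter, Finset.mem_univ, true_and, Set.mem_ofPred_eq]
    exact Quotient.sound ⟨f.symm⟩
  rw [Finset.card_univ, Fintype.card_prod, Fintype.card_perm, Fintype.card_perm, Fintype.card_fin,
    Fintype.card_fin] at h2
  rw [h2]
  refine Finset.sum_congr rfl fun K _ => ?_
  congr 1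
  ext g
  simp only [Finset.mem_filter, Finset.mem_univ, true_and]
  exact ⟨fun h => Subtype.ext h, fun h => congrArg Subtype.val h⟩

end Shape

end PlaneTropical

theorem theorem2p1 (D : Multiset (ℤ × ℤ)) (hD0 : (0 : ℤ × ℤ) ∉ D) (hDbal : D.sum = 0)
    (hDnd : PlaneTropical.Nondegenerate D) (N : ℕ →₀ ℕ) (n : ℕ)
    (hn : (N.sum fun _ m => m) = n)
    (hN : ((N.sum fun k m => (k + 1) * m : ℕ) : ℤ) = (Multiset.card D : ℤ) - 1) :
    (∀ x ∈ PlaneTropical.genericConfigurations n D N, (PlaneTropical.curvesThrough D N x).Finite) ∧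
    ∀ x ∈ PlaneTropical.genericConfigurations n D N, ∀ x' ∈ PlaneTropical.genericConfigurations n D N,
      PlaneTropical.refinedCount D N x = PlaneTropical.refinedCount D N x' := by
  refine ⟨fun x _ => ?_, fun x hx x' hx' => ?_⟩
  · rw [PlaneTropical.Shape.curvesThrough_eq_range x rfl rfl]
    exact Set.finite_range _
  · have hN' : (N.sum fun k m => (k + 1) * m) + 1 = Multiset.card D := by omega
    have h := PlaneTropical.Shape.count_eq (V := 2 * n - 1) (E := Multiset.card D) hn hN' hx hx'
    rw [PlaneTropical.Shape.count_eq_mul_refinedCount x rfl rfl,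
      PlaneTropical.Shape.count_eq_mul_refinedCount x' rfl rfl] at h
    exact mul_left_cancel₀ (Nat.cast_ne_zero.2
      (Nat.mul_ne_zero (Nat.factorial_ne_zero _) (Nat.factorial_ne_zero _))) h
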